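/- Conventions. A skew shape is $A=\lambda/\mu$ for partitions $\mu\subseteq\lambda$, and $|A|$ is its number of boxes. The skew Schur function $s_A$ is the sum of $x^T$ over all semistandard tableaux $T$ of shape $A$. For a composition $\alpha=(\alpha_1,\dots,\alpha_k)$ of $n$ let $S(\alpha)=\{\alpha_1,\alpha_1+\alpha_2,\dots,\alpha_1+\cdots+\alpha_{k-1}\}$ and consider the following bases of the quasisymmetric functions over $\mathbb{Q}$ in $x_1,x_2,\dots$: - $M_\alpha=\sum_{i_1<\cdots<i_k}x_{i_1}^{\alpha_1}\cdots x_{i_k}^{\alpha_k}$ (monomial); - $F_\alpha=\sum_{\beta}M_\beta$, over the compositions $\beta$ of $n$ with $S(\alpha)\subseteq S(\beta)$ (fundamental); - $S_\alpha$ (quasisymmetric Schur), the sum of $x^T$ over semistandard composition tableaux of shape $\alpha$: fillings of the diagram of $\alpha$ with rows weakly decreasing from left to right, first column strictly increasing from top to bottom, such that for rows $i<j$ and every box $(j,k+1)$, $T(j,k+1)\ge T(i,k+1)$ implies $T(j,k+1)>T(i,k)$, where positions outside the diagram count as $0$; - $D_\alpha$ (dual immaculate), the sum of $x^T$ over immaculate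 tableaux of shape $\alpha$: fillings with rows weakly increasing from left to right and first column strictly increasing from top to bottom. A function is $B$-positive if all coefficients of its expansion in the basis $B$ are nonnegative. The $B$-support of $A$, $\operatorname{supp}_B(A)$, is the set of indices with positive coefficient in the $B$-expansion of $s_A$; for $B=D$ one may also use "nonzero" in place of "positive". The Schur support $\operatorname{supp}_s(A)$ is the set of $\lambda$ with nonzero coefficient in the Schur expansion of $s_A$. For $k\ge 1$, $\operatorname{rows}_k(A)$ is the partition formed by the numbers of columns occupied in common by $k$ consecutive rows of $A$, $\operatorname{cols}_\ell(A)$ is the analogue for columns, and $\operatorname{rects}_{k,\ell}(A)$ is the number of $k\times\ell$ rectangular subdiagrams of $A$. Write $a\preceq b$ if $a_1+\dots+a_m\le b_1+\dots+b_m$ for all $m$ up to the number of parts of $a$, with missing parts read as $0$ (the sizes of $a$ and $b$ may differ). **Theorem.** Every $s_A$ has a unique expansion in the Schur functions and in each of the families $M,F,S,D$. For all skew shapes $A$ and $B$: 1. If $s_A-s_B$ is $D$-positive, then it is Schur-positive. 2. $\operatorname{supp}_D(A)\supseteq\operatorname{supp}_D(B)$ if and only if $\operatorname{supp}_s(A)\supseteq\operatorname{supp}_s(B)$,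 with either convention for the $D$-support. 3. A symmetric function is $S$-positive if and only if it is Schur-positive; in particular this holds for $s_A-s_B$. Moreover $\operatorname{supp}_S(A)\supseteq\operatorname{supp}_S(B)$ if and only if $\operatorname{supp}_s(A)\supseteq\operatorname{supp}_s(B)$. 4. The conditions "$\operatorname{rows}_k(A)\preceq\operatorname{rows}_k(B)$ for all $k\ge1$", "$\operatorname{cols}_\ell(A)\preceq\operatorname{cols}_\ell(B)$ for all $\ell\ge1$" and "$\operatorname{rects}_{k,\ell}(A)\le\operatorname{rects}_{k,\ell}(B)$ for all $k,\ell\ge1$" are equivalent; call them the overlap condition. 5. Writing $X^{+}$ for "$s_A-s_B$ is $X$-positive" and $X^{\supseteq}$ for "$\operatorname{supp}_X(A)\supseteq\operatorname{supp}_X(B)$", with $s$ for Schur, the following implications hold: $D^+\Rightarrow s^+\Rightarrow F^+\Rightarrow M^+$; $\ s^+\Rightarrow s^{\supseteq}$, $F^+\Rightarrow F^{\supseteq}$, $M^+\Rightarrow M^{\supseteq}$; $\ s^{\supseteq}\Rightarrow F^{\supseteq}\Rightarrow M^{\supseteq}$; and $F^{\supseteq}$ implies the overlap condition. 6. The diagram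 in 5 is complete: let $P,Q$ be two of the eight conditions $D^+,s^+,F^+,M^+,s^{\supseteq},F^{\supseteq},M^{\supseteq}$, overlap, such that $Q$ cannot be reached from $P$ by a (possibly empty) chain of the implications in 5, and such that $(P,Q)$ is neither (overlap, $F^{\supseteq}$) nor (overlap, $M^{\supseteq}$). Then there are skew shapes $A,B$ with $|A|=|B|$ for which $P$ holds and $Q$ fails. In particular the converse of every implication in 5, with the possible exception of $F^{\supseteq}\Rightarrow$ overlap, is false. -/

import Mathlib

namespace SkewQSym

noncomputable section

/-! ### Power series, expansions, positivity, support

The variables `x_1 < x_2 < ⋯` are indexed by `ℕ` in its usual order (so the first one has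
index `0`); a monomial is its exponent vector `m : ℕ →₀ ℕ`. -/

/-- Formal power series with rational coefficients in countably many ordered variables. -/
abbrev Series : Type := MvPowerSeries ℕ ℚ

/-- `c` is an expansion of `f` as a (finite) linear combination of the family `B`. -/
def IsExpansion {ι : Type} (B : ι → Series) (c : ι →₀ ℚ) (f : Series) : Prop :=
  Finsupp.linearCombination ℚ B c = f

/-- `f` is `B`-positive: all coefficients in its `B`-expansion are nonnegative. -/
def IsPositive {ι : Type} (B : ι → Series) (f : Series) : Prop :=
  ∃ c : ι →₀ ℚ, IsExpansion B c f ∧ ∀ i, 0 ≤ c i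

/-- The indices that appear with positive coefficient in the `B`-expansion of `f`. -/
def posSupport {ι : Type} (B : ι → Series) (f : Series) : Set ι :=
  {i | ∃ c : ι →₀ ℚ, IsExpansion B c f ∧ 0 < c i}

/-- The indices that appear with nonzero coefficient in the `B`-expansion of `f`. -/
def nzSupport {ι : Type} (B : ι → Series) (f : Series) : Set ι :=
  {i | ∃ c : ι →₀ ℚ, IsExpansion B c f ∧ c i ≠ 0}

/-- Symmetric functions: power series of bounded degree, invariant under every permutation
of the variables. -/
def IsSymmetricFunction (f : Series) : Prop :=
  (∃ d : ℕ, ∀ m : ℕ →₀ ℕ, d < m.degree → MvPowerSeries.coeff m f = 0) ∧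
  ∀ (σ : Equiv.Perm ℕ) (m : ℕ →₀ ℕ),
    MvPowerSeries.coeff (m.equivMapDomain σ) f = MvPowerSeries.coeff m f

/-! ### Fillings of diagrams -/

/-- The content of a filling `T` of the boxes in `cells`: its `i`-th exponent is the number of
boxes with entry `i`. -/
def content (cells : Finset (ℕ × ℕ)) (T : ℕ → ℕ → ℕ) : ℕ →₀ ℕ :=
  ∑ c ∈ cells, Finsupp.single (T c.1 c.2) 1

/-- The sum of `x^T` over all fillings `T` of the boxes `(row, column)` in `cells` that satisfy
`P`. Entries outside `cells` are set to `0`, so that each filling is counted once. -/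
def fillingSeries (cells : Finset (ℕ × ℕ)) (P : (ℕ → ℕ → ℕ) → Prop) : Series :=
  fun m => (Nat.card {T : ℕ → ℕ → ℕ //
    (∀ i j, (i, j) ∉ cells → T i j = 0) ∧ P T ∧ content cells T = m} : ℚ)

/-! ### Skew shapes and (skew) Schur functions -/

/-- A skew shape `outer / inner`. -/
structure SkewShape where
  outer : YoungDiagram
  inner : YoungDiagram
  le : inner ≤ outer

namespace SkewShape

/-- The boxes `(row, column)` of a skew shape; rows are numbered from the top. -/
def cells (A : SkewShape) : Finset (ℕ × ℕ) := A.outer.cells \ A.inner.cells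

/-- The number of boxes. -/
def size (A : SkewShape) : ℕ := A.cells.card

/-- The transposed skew shape. -/
def transpose (A : SkewShape) : SkewShape where
  outer := A.outer.transpose
  inner := A.inner.transpose
  le := YoungDiagram.transpose_mono A.le

/-- A partition as the skew shape `μ / ∅`. -/
def straight (μ : YoungDiagram) : SkewShape where
  outer := μ
  inner := ⊥
  le := bot_le

end SkewShape

/-- Semistandard: rows weakly increase from left to right, columns strictly increase from top to
bottom. -/
def IsSemistandard (cells : Finset (ℕ × ℕ)) (T : ℕ → ℕ → ℕ) : Prop :=
  (∀ i j₁ j₂, j₁ < j₂ → (i, j₁) ∈ cells → (i, j₂) ∈ cells → T i j₁ ≤ T i j₂) ∧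
  (∀ i₁ i₂ j, i₁ < i₂ → (i₁, j) ∈ cells → (i₂, j) ∈ cells → T i₁ j < T i₂ j)

/-- The skew Schur function `s_A`: the sum of `x^T` over all semistandard tableaux of shape
`A`. -/
def skewSchur (A : SkewShape) : Series :=
  fillingSeries A.cells (IsSemistandard A.cells)

/-- The Schur function of a partition. -/
def schur (μ : YoungDiagram) : Series := skewSchur (SkewShape.straight μ)

/-! ### Bases of the quasisymmetric functions -/

/-- Compositions of all nonnegative integers. -/
abbrev Comp : Type := (n : ℕ) × Composition n

/-- The exponents of a monomial, read in increasing order of the variables. -/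
def exponents (m : ℕ →₀ ℕ) : List ℕ := (m.support.sort (· ≤ ·)).map m

/-- The monomial quasisymmetric function `M_α = ∑_{i_1 < ⋯ < i_k} x_{i_1}^{α_1} ⋯ x_{i_k}^{α_k}`:
the coefficient of a monomial is `1` if its sequence of exponents is `α`, and `0` otherwise. -/
def monomialQ (α : Comp) : Series :=
  fun m => if exponents m = α.2.blocks then 1 else 0

/-- `S(α) = {α_1, α_1 + α_2, …, α_1 + ⋯ + α_{k-1}}`. -/
def descentSet {n : ℕ} (α : Composition n) : Finset ℕ :=
  (Finset.Ioo 0 α.length).image α.sizeUpTo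

/-- The fundamental quasisymmetric function `F_α`, the sum of the `M_β` with `|β| = |α|` and
`S(α) ⊆ S(β)`. -/
def fundamentalQ (α : Comp) : Series :=
  ∑ β : Composition α.1 with descentSet α.2 ⊆ descentSet β, monomialQ ⟨α.1, β⟩

/-- The diagram of a composition: row `i` (from the top) has boxes in columns
`0, …, α_i - 1`. -/
def compCells (α : Comp) : Finset (ℕ × ℕ) :=
  (Finset.range α.2.length ×ˢ Finset.range α.1).filter fun c => c.2 < α.2.blocks.getD c.1 0

/-- The first column strictly increases from top to bottom. -/
def FirstColumnStrict (cells : Finset (ℕ × ℕ)) (T : ℕ → ℕ → ℕ) : Prop :=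
  ∀ i₁ i₂, i₁ < i₂ → (i₁, 0) ∈ cells → (i₂, 0) ∈ cells → T i₁ 0 < T i₂ 0

/-- Immaculate: rows weakly increase from left to right and the first column strictly increases
from top to bottom. -/
def IsImmaculate (cells : Finset (ℕ × ℕ)) (T : ℕ → ℕ → ℕ) : Prop :=
  (∀ i j₁ j₂, j₁ < j₂ → (i, j₁) ∈ cells → (i, j₂) ∈ cells → T i j₁ ≤ T i j₂) ∧
  FirstColumnStrict cells T

/-- The dual immaculate function `D_α`: the sum of `x^T` over all immaculate tableaux `T` of
shape `α`. -/
def dualImmaculate (α : Comp) : Series :=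
  fillingSeries (compCells α) (IsImmaculate (compCells α))

/-- A filling extended by an entry `⊥`, smaller than all others, at every position that is not a
box. -/
def extended (cells : Finset (ℕ × ℕ)) (T : ℕ → ℕ → ℕ) (i j : ℕ) : WithBot ℕ :=
  if (i, j) ∈ cells then (T i j : WithBot ℕ) else ⊥

/-- Semistandard composition tableaux: rows weakly decrease from left to right, the first column
strictly increases from top to bottom, and the triple rule holds: for rows `i < j` and a box
`(j, k + 1)`, if `T(j, k + 1) ≥ T(i, k + 1)` then `T(j, k + 1) > T(i, k)`, where positions
without a box carry the least entry `⊥`. -/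
def IsCompositionTableau (cells : Finset (ℕ × ℕ)) (T : ℕ → ℕ → ℕ) : Prop :=
  (∀ i j₁ j₂, j₁ < j₂ → (i, j₁) ∈ cells → (i, j₂) ∈ cells → T i j₂ ≤ T i j₁) ∧
  FirstColumnStrict cells T ∧
  ∀ i j k, i < j → (j, k + 1) ∈ cells →
    extended cells T i (k + 1) ≤ extended cells T j (k + 1) →
    extended cells T i k < extended cells T j (k + 1)

/-- The quasisymmetric Schur function `S_α`: the sum of `x^T` over all semistandard composition
tableaux `T` of shape `α`. -/
def quasiSchur (α : Comp) : Series :=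
  fillingSeries (compCells α) (IsCompositionTableau (compCells α))

/-! ### Overlap partitions -/

/-- The number of columns occupied in common by the `k` rows `i, i + 1, …, i + k - 1`. -/
def rowOverlap (A : SkewShape) (k i : ℕ) : ℕ :=
  ((Finset.range (A.outer.rowLen 0)).filter fun j => ∀ t < k, (i + t, j) ∈ A.cells).card

/-- The partition `rows_k(A)` (for `k ≥ 1`): the overlaps among `k` consecutive rows, in weakly
decreasing order; zeros are not parts. -/
def rowsPartition (A : SkewShape) (k : ℕ) : List ℕ :=
  (((Multiset.range (A.outer.colLen 0 + 1 - k)).map (rowOverlap A k)).filter (0 < ·)).sort (· ≥ ·)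

/-- The partition `cols_l(A)` (for `l ≥ 1`): the same for columns. -/
def colsPartition (A : SkewShape) (l : ℕ) : List ℕ := rowsPartition A.transpose l

/-- `rects_{k,l}(A)` (for `k, l ≥ 1`): the number of rectangles with `k` rows and `l` columns
contained in `A`, counted by their top left boxes. -/
def rects (A : SkewShape) (k l : ℕ) : ℕ :=
  (A.cells.filter fun c => ∀ a < k, ∀ b < l, (c.1 + a, c.2 + b) ∈ A.cells).card

/-- Dominance order `a ≼ b` for partitions of possibly different sizes. -/
def Dominated (a b : List ℕ) : Prop :=
  ∀ m ≤ a.length, (a.take m).sum ≤ (b.take m).sum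

/-! ### The implication diagram -/

/-- The classes of conditions in the implication diagram. -/
inductive Condition
  | dPos | schurPos | fPos | mPos
  | schurSupp | fSupp | mSupp
  | overlaps

namespace Condition

/-- The condition (one representative of each class) for a pair of skew shapes `A`, `B`. -/
def Holds (A B : SkewShape) : Condition → Prop
  | dPos => IsPositive dualImmaculate (skewSchur A - skewSchur B)
  | schurPos => IsPositive schur (skewSchur A - skewSchur B)
  | fPos => IsPositive fundamentalQ (skewSchur A - skewSchur B)
  | mPos => IsPositive monomialQ (skewSchur A - skewSchur B)
  | schurSupp => nzSupport schur (skewSchur B) ⊆ nzSupport schur (skewSchur A)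
  | fSupp => posSupport fundamentalQ (skewSchur B) ⊆ posSupport fundamentalQ (skewSchur A)
  | mSupp => posSupport monomialQ (skewSchur B) ⊆ posSupport monomialQ (skewSchur A)
  | overlaps => ∀ k, 1 ≤ k → Dominated (rowsPartition A k) (rowsPartition B k)

/-- The arrows of the implication diagram. -/
inductive Arrow : Condition → Condition → Prop
  | dPos_schurPos : Arrow dPos schurPos
  | schurPos_fPos : Arrow schurPos fPos
  | fPos_mPos : Arrow fPos mPos
  | schurPos_schurSupp : Arrow schurPos schurSupp
  | fPos_fSupp : Arrow fPos fSupp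
  | mPos_mSupp : Arrow mPos mSupp
  | schurSupp_fSupp : Arrow schurSupp fSupp
  | fSupp_mSupp : Arrow fSupp mSupp
  | fSupp_overlaps : Arrow fSupp overlaps

/-- The two implications that are left undecided. -/
inductive Undecided : Condition → Condition → Prop
  | overlaps_fSupp : Undecided overlaps fSupp
  | overlaps_mSupp : Undecided overlaps mSupp

end Condition

end

end SkewQSym

open SkewQSym

namespace SkewQSym

/-! ### Linear independence, expansions and contents -/

/-! Every claim is turned into a statement about coefficients in linearly independent families.
Independence of the M, F, S and D families is triangularity with respect to suitable test monomials
(`linearIndependent_of_triangular`); for Schur functions it is then inherited from D.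

Fundamental basis. Standardization matches semistandard tableaux of content `m` with standard
tableaux all of whose descents are partial sums of `m` (`skewSchur_apply`), so the F-coefficients of
a skew Schur function count standard tableaux by descent set. This gives F-positivity, hence
M-positivity. For the overlap condition, one standard tableau of `B` is enough for each rectangle
size (k+1)×(l+1): peel off the top boxes of the columns k times, then the first boxes of the rows l
times. The boxes that remain correspond to rectangles of `B`. A tableau of `A` with the same
descents must place the lower right corner of every such rectangle of `A` among the remaining
entries, so `A` has at most as many rectangles (`rects_le_of_tableauComp`). Dominance of the overlap
partitions is equivalent to inequalities between rectangle counts by a Legendre-type duality between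
prefix sums and truncated sums (`dominated_iff`).

Schur basis. Tableaux are towers of horizontal strips. Bender–Knuth moves give symmetry. The Schur
coefficient of a symmetric function is an alternating sum of monomial coefficients (`schurCoeff`); a
Bender–Knuth move restricted to the columns left of the first violation is a sign-reversing
involution, in the style of Stembridge's proof of the Littlewood–Richardson rule, so on a skew Schur
function the coefficient counts towers without violations (`schurCoeff_skewSchur`). A straight shape
has only one such tower, so these functionals are dual to the Schur functions. They detect every
symmetric function, because a monomial of maximal sum of squares is seen by the identity permutation
alone (`eq_zero_of_schurCoeff`). Hence Schur expansions exist, and those of skew Schur functions are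
nonnegative.

The bases D and S. In both, the Schur functions expand with pairwise disjoint supports, and the
composition formed by the rows of μ has coefficient 1 in the expansion of s_μ
(`IsDisjointExpansion`). Statements 1 to 3 follow formally. For D the expansion is a determinant,
proved by induction on the number of variables: column operations replace the interlacing conditions
of horizontal strips by the plain inequalities of immaculate chains (`stripCount_eq_signed_sum`).
For S it is a sum over all rearrangements of the rows: semistandard and composition tableaux are
both determined by the entry sets of their columns, and the admissible sequences of sets agree after
reversing the alphabet (`schur_eq_sum_quasiSchur`).

Completeness of the diagram. Four pairs of small shapes, checked by computing finitely many
coefficients, refute four implications; every other undetermined pair of conditions follows from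
these by composing with arrows (`exists_holds_not_holds`). -/

lemma linearCombination_eval {ι : Type} (B : ι → Series) (c : ι →₀ ℚ) (m : ℕ →₀ ℕ) :
    (Finsupp.linearCombination ℚ B c : Series) m = ∑ i ∈ c.support, c i * B i m := by
  have h : MvPowerSeries.coeff m (Finsupp.linearCombination ℚ B c) =
      ∑ i ∈ c.support, c i * B i m := by
    rw [Finsupp.linearCombination_apply, Finsupp.sum, map_sum]
    rfl
  exact h

lemma IsExpansion.eval {ι : Type} {B : ι → Series} {c : ι →₀ ℚ} {f : Series}
    (h : IsExpansion B c f) (m : ℕ →₀ ℕ) : f m = ∑ i ∈ c.support, c i * B i m := by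
  rw [← linearCombination_eval, h]

/-- A family of series that is triangular with respect to test monomials `t i` and a rank is
linearly independent. -/
lemma linearIndependent_of_triangular {ι : Type} (B : ι → Series) (t : ι → ℕ →₀ ℕ) (rk : ι → ℤ)
    (h1 : ∀ i, B i (t i) ≠ 0) (h2 : ∀ i j, B j (t i) ≠ 0 → j = i ∨ rk i < rk j) :
    LinearIndependent ℚ B := by
  rw [linearIndependent_iff]
  intro l hl
  by_contra hne
  -- For an index of maximal rank in a vanishing combination, any other term visible at its test
  -- monomial would have larger rank; so its coefficient survives alone.
  obtain ⟨i, hi, hmax⟩ := l.support.exists_max_image rk (Finsupp.support_nonempty_iff.2 hne)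
  have h := linearCombination_eval B l (t i)
  rw [hl, Finset.sum_eq_single i] at h
  · exact mul_ne_zero (Finsupp.mem_support_iff.1 hi) (h1 i) h.symm
  · intro j hj hji
    by_contra h0
    rcases h2 i j (right_ne_zero_of_mul h0) with h' | h'
    · exact hji h'
    · exact absurd (hmax j hj) (not_le.2 h')
  · exact fun h' => absurd hi h'

section Expansions

variable {ι : Type} {B : ι → Series} {f g : Series} {c d : ι →₀ ℚ}

lemma IsExpansion.unique (hB : LinearIndependent ℚ B) (hc : IsExpansion B c f)
    (hd : IsExpansion B d f) : c = d :=
  hB (show Finsupp.linearCombination ℚ B c = Finsupp.linearCombination ℚ B d from hc.trans hd.symm)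

lemma IsExpansion.sub (hc : IsExpansion B c f) (hd : IsExpansion B d g) :
    IsExpansion B (c - d) (f - g) := by
  unfold IsExpansion at *
  rw [map_sub, hc, hd]

lemma IsExpansion.existsUnique (hB : LinearIndependent ℚ B) (hc : IsExpansion B c f) :
    ∃! c, IsExpansion B c f :=
  ⟨c, hc, fun _ hd => IsExpansion.unique hB hd hc⟩

lemma IsExpansion.isPositive_iff (hB : LinearIndependent ℚ B) (hc : IsExpansion B c f) :
    IsPositive B f ↔ ∀ i, 0 ≤ c i :=
  ⟨fun ⟨_, hd, h⟩ => IsExpansion.unique hB hd hc ▸ h, fun h => ⟨c, hc, h⟩⟩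

lemma IsExpansion.mem_posSupport_iff (hB : LinearIndependent ℚ B) (hc : IsExpansion B c f)
    (i : ι) : i ∈ posSupport B f ↔ 0 < c i :=
  ⟨fun ⟨_, hd, h⟩ => IsExpansion.unique hB hd hc ▸ h, fun h => ⟨c, hc, h⟩⟩

lemma IsExpansion.mem_nzSupport_iff (hB : LinearIndependent ℚ B) (hc : IsExpansion B c f)
    (i : ι) : i ∈ nzSupport B f ↔ c i ≠ 0 :=
  ⟨fun ⟨_, hd, h⟩ => IsExpansion.unique hB hd hc ▸ h, fun h => ⟨c, hc, h⟩⟩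

/-- Substitution of expansions. -/
lemma IsExpansion.bind {κ : Type} {C : κ → Series} {e : κ → ι →₀ ℚ}
    (he : ∀ k, IsExpansion B (e k) (C k)) {c : κ →₀ ℚ} (hc : IsExpansion C c f) :
    IsExpansion B (Finsupp.linearCombination ℚ e c) f := by
  unfold IsExpansion at *
  rw [← hc, Finsupp.linearCombination_apply ℚ (v := e), Finsupp.sum, map_sum,
    Finsupp.linearCombination_apply, Finsupp.sum]
  exact Finset.sum_congr rfl fun k _ => by rw [map_smul, he k]

lemma linearCombination_finsupp_apply {κ : Type} (e : κ → ι →₀ ℚ) (c : κ →₀ ℚ) (i : ι) :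
    (Finsupp.linearCombination ℚ e c) i = ∑ k ∈ c.support, c k * e k i := by
  rw [Finsupp.linearCombination_apply, Finsupp.sum, Finsupp.finsetSum_apply]
  rfl

end Expansions

lemma comp_ext {α β : Comp} (h : α.2.blocks = β.2.blocks) : α = β :=
  Composition.sigma_eq_iff_blocks_eq.2 h

/-- The content whose exponents are the entries of a word. -/
noncomputable def wordContent (l : List ℕ) : ℕ →₀ ℕ :=
  Finsupp.onFinset (Finset.range l.length) (fun i => l.getD i 0) fun i hi => by
    by_contra h
    rw [Finset.mem_range, not_lt] at h
    exact hi (List.getD_eq_default _ _ h)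

lemma wordContent_apply (l : List ℕ) (i : ℕ) : wordContent l i = l.getD i 0 := rfl

lemma wordContent_support (l : List ℕ) (hl : ∀ x ∈ l, 0 < x) :
    (wordContent l).support = Finset.range l.length := by
  ext i
  rw [Finsupp.mem_support_iff, Finset.mem_range, wordContent_apply]
  constructor
  · intro h
    by_contra h'
    exact h (List.getD_eq_default _ _ (not_lt.1 h'))
  · intro h
    rw [List.getD_eq_getElem _ _ h]
    exact (hl _ (List.getElem_mem h)).ne'

lemma exponents_wordContent (l : List ℕ) (hl : ∀ x ∈ l, 0 < x) :
    exponents (wordContent l) = l := by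
  rw [exponents, wordContent_support l hl, Finset.sort_range]
  refine List.ext_getElem (by simp) fun i h1 h2 => ?_
  simp only [List.getElem_map, List.getElem_range, wordContent_apply]
  exact List.getD_eq_getElem _ _ h2

lemma exponents_pos (m : ℕ →₀ ℕ) {x : ℕ} (hx : x ∈ exponents m) : 0 < x := by
  rw [exponents, List.mem_map] at hx
  obtain ⟨i, hi, rfl⟩ := hx
  rw [Finset.mem_sort, Finsupp.mem_support_iff] at hi
  omega

lemma list_sum_map_sort (s : Finset ℕ) (f : ℕ → ℕ) :
    ((s.sort (· ≤ ·)).map f).sum = ∑ i ∈ s, f i := by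
  rw [← Multiset.sum_coe, ← Multiset.map_coe, Finset.sort_eq]
  rfl

lemma exponents_sum (m : ℕ →₀ ℕ) : (exponents m).sum = m.degree := by
  rw [exponents, list_sum_map_sort]
  rfl

/-- The composition of exponents of a monomial. -/
def expComp (m : ℕ →₀ ℕ) : Composition m.degree where
  blocks := exponents m
  blocks_pos := fun h => exponents_pos m h
  blocks_sum := exponents_sum m

/-- A monomial with prescribed exponents. -/
noncomputable def testContent (α : Comp) : ℕ →₀ ℕ := wordContent α.2.blocks

lemma exponents_testContent (α : Comp) : exponents (testContent α) = α.2.blocks :=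
  exponents_wordContent _ fun _ h => α.2.blocks_pos h

lemma degree_testContent (α : Comp) : (testContent α).degree = α.1 := by
  rw [← exponents_sum, exponents_testContent, α.2.blocks_sum]

lemma monomialQ_apply (α : Comp) (m : ℕ →₀ ℕ) :
    monomialQ α m = if exponents m = α.2.blocks then 1 else 0 := rfl

lemma linearIndependent_monomialQ : LinearIndependent ℚ monomialQ := by
  refine linearIndependent_of_triangular _ testContent (fun _ => 0) (fun i => ?_) fun i j h => ?_
  · rw [monomialQ_apply, exponents_testContent, if_pos rfl]
    exact one_ne_zero
  · rw [monomialQ_apply, exponents_testContent] at h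
    refine Or.inl (comp_ext ?_)
    by_contra h'
    exact h (if_neg fun h'' => h' h''.symm)

/-! ### Descent sets and the fundamental basis -/

lemma mem_descentSet {n : ℕ} (α : Composition n) (p : ℕ) :
    p ∈ descentSet α ↔ (∃ i, α.sizeUpTo i = p) ∧ 0 < p ∧ p < n := by
  rw [descentSet, Finset.mem_image]
  constructor
  · rintro ⟨i, hi, rfl⟩
    rw [Finset.mem_Ioo] at hi
    refine ⟨⟨i, rfl⟩, ?_, ?_⟩
    · exact lt_of_lt_of_le (by simpa using α.sizeUpTo_strict_mono (i := 0) (by omega))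
        (α.monotone_sizeUpTo (show 0 + 1 ≤ i by omega))
    · exact lt_of_lt_of_le (α.sizeUpTo_strict_mono hi.2) (α.sizeUpTo_le _)
  · rintro ⟨⟨i, rfl⟩, h0, hn⟩
    refine ⟨i, Finset.mem_Ioo.2 ⟨Nat.pos_of_ne_zero ?_, ?_⟩, rfl⟩
    · rintro rfl
      simp at h0
    · by_contra h
      rw [α.sizeUpTo_ofLength_le i (not_lt.1 h)] at hn
      exact lt_irrefl _ hn

lemma mem_boundaries_iff {n : ℕ} (α : Composition n) (p : Fin (n + 1)) :
    p ∈ α.boundaries ↔ (p : ℕ) = 0 ∨ (p : ℕ) = n ∨ (p : ℕ) ∈ descentSet α := by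
  have hb : p ∈ α.boundaries ↔ ∃ i, α.sizeUpTo i = p := by
    simp only [Composition.boundaries, Finset.mem_map, Finset.mem_univ, true_and]
    constructor
    · rintro ⟨i, rfl⟩
      exact ⟨i, rfl⟩
    · rintro ⟨i, hi⟩
      refine ⟨⟨min i α.length, by omega⟩, Fin.ext ?_⟩
      change α.sizeUpTo (min i α.length) = p
      rcases le_total i α.length with h | h
      · rw [min_eq_left h, hi]
      · rw [min_eq_right h, ← hi, α.sizeUpTo_ofLength_le i h, α.sizeUpTo_length]
  rw [hb, mem_descentSet]
  constructor
  · intro h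
    have := p.2
    by_cases h0 : (p : ℕ) = 0
    · exact Or.inl h0
    · by_cases h1 : (p : ℕ) = n
      · exact Or.inr (Or.inl h1)
      · exact Or.inr (Or.inr ⟨h, by omega, by omega⟩)
  · rintro (h | h | h)
    · exact ⟨0, by simp [h]⟩
    · exact ⟨α.length, by simp [h]⟩
    · exact h.1

/-- Adding 0 and `n` to the descent set gives the boundary set, which determines a composition. -/
lemma descentSet_injective {n : ℕ} : Function.Injective (descentSet (n := n)) := by
  intro α β h
  apply (compositionEquiv n).injective
  apply CompositionAsSet.ext
  ext p
  change p ∈ α.boundaries ↔ p ∈ β.boundaries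
  rw [mem_boundaries_iff, mem_boundaries_iff, h]

lemma exists_descentSet_eq {n : ℕ} (D : Finset ℕ) (hD : ∀ p ∈ D, 0 < p ∧ p < n) :
    ∃ α : Composition n, descentSet α = D := by
  classical
  let c : CompositionAsSet n :=
    { boundaries := Finset.univ.filter fun p : Fin (n + 1) => (p : ℕ) = 0 ∨ (p : ℕ) = n ∨ (p : ℕ) ∈ D
      zero_mem := by simp
      getLast_mem := by simp }
  refine ⟨c.toComposition, ?_⟩
  have hb := CompositionAsSet.toComposition_boundaries c
  ext p
  constructor
  · intro hp
    obtain ⟨-, h0, hn⟩ := (mem_descentSet _ _).1 hp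
    have : (⟨p, by omega⟩ : Fin (n + 1)) ∈ c.toComposition.boundaries :=
      (mem_boundaries_iff _ _).2 (Or.inr (Or.inr hp))
    rw [hb] at this
    have h := (Finset.mem_filter.1 this).2
    rcases h with h | h | h
    · exact absurd h h0.ne'
    · exact absurd h hn.ne
    · exact h
  · intro hp
    obtain ⟨h0, hn⟩ := hD p hp
    have : (⟨p, by omega⟩ : Fin (n + 1)) ∈ c.toComposition.boundaries := by
      rw [hb]
      exact Finset.mem_filter.2 ⟨Finset.mem_univ _, Or.inr (Or.inr hp)⟩
    rcases (mem_boundaries_iff _ _).1 this with h | h | h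
    · exact absurd h h0.ne'
    · exact absurd h hn.ne
    · exact h

/-- The partial sums of the exponents of a monomial. -/
def cuts (m : ℕ → ℕ) : Set ℕ := {p | ∃ v, ∑ u ∈ Finset.range v, m u = p}

/-- Together with its converse this translates between "the first `i` nonzero exponents"
(compositions) and "the exponents of the first `v` variables" (`cuts`), where zero exponents may be
interspersed. -/
lemma take_eq_filter_lt : ∀ l : List ℕ, l.Pairwise (· < ·) → ∀ i, ∃ v, l.take i = l.filter (· < v)
  | [], _, i => ⟨0, by simp⟩
  | a :: l, h, 0 => ⟨a, by
      rw [List.take_zero, eq_comm, List.filter_eq_nil_iff]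
      intro x hx
      rcases List.mem_cons.1 hx with rfl | hx
      · simp
      · simpa using ((List.pairwise_cons.1 h).1 x hx).le⟩
  | a :: l, h, i + 1 => by
      obtain ⟨h1, h2⟩ := List.pairwise_cons.1 h
      obtain ⟨v, hv⟩ := take_eq_filter_lt l h2 i
      -- The threshold has to let `a` pass; raising it to `a + 1` admits nothing new, as all later
      -- entries exceed `a`.
      refine ⟨max v (a + 1), ?_⟩
      rw [List.take_succ_cons, List.filter_cons_of_pos (by simp), hv]
      congr 1
      apply List.filter_congr
      intro x hx
      have := h1 x hx
      simp only [decide_eq_decide]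
      omega

lemma filter_lt_eq_take : ∀ l : List ℕ, l.Pairwise (· < ·) → ∀ v, ∃ i, l.filter (· < v) = l.take i
  | [], _, v => ⟨0, by simp⟩
  | a :: l, h, v => by
      obtain ⟨h1, h2⟩ := List.pairwise_cons.1 h
      by_cases ha : a < v
      · obtain ⟨i, hi⟩ := filter_lt_eq_take l h2 v
        exact ⟨i + 1, by rw [List.filter_cons_of_pos (by simpa using ha), hi, List.take_succ_cons]⟩
      · refine ⟨0, ?_⟩
        rw [List.take_zero, List.filter_eq_nil_iff]
        intro x hx
        rcases List.mem_cons.1 hx with rfl | hx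
        · simpa using ha
        · have := h1 x hx
          simp only [decide_eq_true_eq]
          omega

lemma sum_filter_exponents (m : ℕ →₀ ℕ) (v : ℕ) :
    (((m.support.sort (· ≤ ·)).filter (· < v)).map m).sum = ∑ u ∈ Finset.range v, m u := by
  have hnd : ((m.support.sort (· ≤ ·)).filter (· < v)).Nodup := (Finset.sort_nodup _ _).filter _
  rw [← List.sum_toFinset _ hnd]
  apply Finset.sum_subset_zero_on_sdiff
  · intro x hx
    simp only [List.mem_toFinset, List.mem_filter, decide_eq_true_eq] at hx
    exact Finset.mem_range.2 hx.2
  · intro x hx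
    simp only [Finset.mem_sdiff, Finset.mem_range, List.mem_toFinset, List.mem_filter,
      Finset.mem_sort, Finsupp.mem_support_iff, decide_eq_true_eq, not_and] at hx
    by_contra h
    exact hx.2 h hx.1
  · exact fun _ _ => rfl

lemma sort_pairwise_lt (s : Finset ℕ) : (s.sort (· ≤ ·)).Pairwise (· < ·) :=
  (Finset.sortedLT_sort s).pairwise

lemma mem_descentSet_of_blocks {n : ℕ} (β : Composition n) (m : ℕ →₀ ℕ)
    (h : β.blocks = exponents m) (p : ℕ) :
    p ∈ descentSet β ↔ p ∈ cuts m ∧ 0 < p ∧ p < n := by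
  rw [mem_descentSet]
  refine and_congr_left fun _ => ?_
  have hs : ∀ i, β.sizeUpTo i = (((m.support.sort (· ≤ ·)).take i).map m).sum := by
    intro i
    rw [Composition.sizeUpTo, h, exponents, List.map_take]
  constructor
  · rintro ⟨i, rfl⟩
    obtain ⟨v, hv⟩ := take_eq_filter_lt _ (sort_pairwise_lt m.support) i
    exact ⟨v, by rw [hs, hv, sum_filter_exponents]⟩
  · rintro ⟨v, rfl⟩
    obtain ⟨i, hi⟩ := filter_lt_eq_take _ (sort_pairwise_lt m.support) v
    exact ⟨i, by rw [hs, ← hi, sum_filter_exponents]⟩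

-- At a given monomial only the summand indexed by its own composition of exponents can be nonzero,
-- so F_α is an indicator function: the descents of α must be partial sums of the exponents.
open Classical in
lemma fundamentalQ_apply (α : Comp) (m : ℕ →₀ ℕ) :
    fundamentalQ α m =
      if m.degree = α.1 ∧ ∀ p ∈ descentSet α.2, p ∈ cuts m then 1 else 0 := by
  obtain ⟨n, α⟩ := α
  have h0 : fundamentalQ ⟨n, α⟩ m =
      ∑ β : Composition n with descentSet α ⊆ descentSet β, monomialQ ⟨n, β⟩ m := by
    have h : MvPowerSeries.coeff m (fundamentalQ ⟨n, α⟩) =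
        ∑ β : Composition n with descentSet α ⊆ descentSet β,
          MvPowerSeries.coeff m (monomialQ ⟨n, β⟩) := by
      unfold fundamentalQ
      rw [map_sum]
    exact h
  rw [h0]
  simp only [monomialQ_apply]
  by_cases hn : m.degree = n
  · subst hn
    rw [Finset.sum_filter, Finset.sum_eq_single (expComp m)]
    · rw [if_pos (show exponents m = (expComp m).blocks from rfl)]
      refine if_congr ?_ rfl rfl
      rw [and_iff_right rfl]
      constructor
      · intro h p hp
        exact ((mem_descentSet_of_blocks (expComp m) m rfl p).1 (h hp)).1
      · intro h p hp
        exact (mem_descentSet_of_blocks (expComp m) m rfl p).2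
          ⟨h p hp, ((mem_descentSet _ _).1 hp).2⟩
    · intro β _ hβ
      have h' : ¬ exponents m = β.blocks := fun h => hβ (Composition.ext h.symm)
      rw [if_neg h', ite_self]
    · exact fun h => absurd (Finset.mem_univ _) h
  · rw [if_neg fun h => hn h.1]
    refine Finset.sum_eq_zero fun β _ => if_neg fun h => hn ?_
    rw [← exponents_sum, h, β.blocks_sum]

lemma fundamentalQ_testContent (α β : Comp) :
    fundamentalQ α (testContent β) ≠ 0 ↔
      ∃ _ : β.1 = α.1, descentSet α.2 ⊆ descentSet β.2 := by
  classical
  rw [fundamentalQ_apply, degree_testContent]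
  have hd : ∀ p, p ∈ descentSet β.2 ↔ p ∈ cuts (testContent β) ∧ 0 < p ∧ p < β.1 :=
    mem_descentSet_of_blocks β.2 _ (exponents_testContent β).symm
  constructor
  · intro h
    obtain ⟨h1, h2⟩ := (ite_ne_right_iff.1 h).1
    refine ⟨h1, fun p hp => (hd p).2 ⟨h2 p hp, ?_⟩⟩
    rw [h1]
    exact ((mem_descentSet _ _).1 hp).2
  · rintro ⟨h1, h2⟩
    rw [if_pos ⟨h1, fun p hp => ((hd p).1 (h2 hp)).1⟩]
    exact one_ne_zero

/-- F_j is nonzero at the test monomial of i exactly when S(j) ⊆ S(i), and a proper inclusion lowers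
the cardinality; hence the negative sign in the rank. -/
lemma linearIndependent_fundamentalQ : LinearIndependent ℚ fundamentalQ := by
  refine linearIndependent_of_triangular _ testContent (fun α => -((descentSet α.2).card : ℤ))
    (fun i => (fundamentalQ_testContent _ _).2 ⟨rfl, subset_rfl⟩) fun i j h => ?_
  obtain ⟨h1, h2⟩ := (fundamentalQ_testContent _ _).1 h
  obtain ⟨n, i⟩ := i
  obtain ⟨n', j⟩ := j
  obtain rfl : n = n' := h1
  rcases h2.eq_or_ssubset with h | h
  · have h' : j = i := descentSet_injective h
    exact Or.inl (by rw [h'])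
  · have := Finset.card_lt_card h
    exact Or.inr (neg_lt_neg (Nat.cast_lt.2 this))

open Classical in
/-- The expansion of a fundamental quasisymmetric function in the monomial basis. -/
lemma exists_fundamentalQ_expansion (α : Comp) :
    ∃ e : Comp →₀ ℚ, IsExpansion monomialQ e (fundamentalQ α) ∧ ∀ β, 0 ≤ e β := by
  refine ⟨∑ β : Composition α.1 with descentSet α.2 ⊆ descentSet β, Finsupp.single ⟨α.1, β⟩ 1,
    ?_, fun β => ?_⟩
  · rw [IsExpansion, map_sum, fundamentalQ]
    refine Finset.sum_congr (by congr) fun β _ => ?_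
    rw [Finsupp.linearCombination_single, one_smul]
  · rw [Finsupp.finsetSum_apply]
    refine Finset.sum_nonneg fun γ _ => ?_
    rw [Finsupp.single_apply]
    split_ifs <;> norm_num

end SkewQSym

/-! ### Standardization and the fundamental expansion of skew Schur functions. -/

namespace SkewQSym

/-! ### Fillings and their contents -/

lemma content_apply (cells : Finset (ℕ × ℕ)) (T : ℕ → ℕ → ℕ) (v : ℕ) :
    content cells T v = (cells.filter fun c => T c.1 c.2 = v).card := by
  rw [content, Finsupp.finsetSum_apply, Finset.card_filter]
  exact Finset.sum_congr rfl fun c _ => Finsupp.single_apply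

lemma content_degree (cells : Finset (ℕ × ℕ)) (T : ℕ → ℕ → ℕ) :
    (content cells T).degree = cells.card := by
  rw [content, map_sum]
  simp

lemma mem_support_of_content {cells : Finset (ℕ × ℕ)} {T : ℕ → ℕ → ℕ} {m : ℕ →₀ ℕ}
    (h : content cells T = m) {c : ℕ × ℕ} (hc : c ∈ cells) : T c.1 c.2 ∈ m.support := by
  rw [← h, Finsupp.mem_support_iff, content_apply]
  have h' : c ∈ cells.filter fun d => T d.1 d.2 = T c.1 c.2 := Finset.mem_filter.2 ⟨hc, rfl⟩
  exact (Finset.card_pos.2 ⟨c, h'⟩).ne'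

/-- Finiteness matters because `Nat.card` is 0 on infinite types: only with it does a nonzero
coefficient mean that a filling exists. Fixing the content confines the entries to a finite set. -/
lemma finite_fillings (cells : Finset (ℕ × ℕ)) (s : Finset ℕ) :
    {T : ℕ → ℕ → ℕ | (∀ i j, (i, j) ∉ cells → T i j = 0) ∧
      ∀ c ∈ cells, T c.1 c.2 ∈ s}.Finite := by
  rw [Set.finite_def]
  refine ⟨@Fintype.ofFinite _ ?_⟩
  refine Finite.of_injective (β := cells → s)
    (fun T c => ⟨T.1 c.1.1 c.1.2, T.2.2 c.1 c.2⟩) fun T T' h => ?_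
  ext i j
  by_cases hc : (i, j) ∈ cells
  · exact congrArg Subtype.val (congrFun h ⟨(i, j), hc⟩)
  · rw [T.2.1 i j hc, T'.2.1 i j hc]

lemma finite_fillingSeries (cells : Finset (ℕ × ℕ)) (P : (ℕ → ℕ → ℕ) → Prop) (m : ℕ →₀ ℕ) :
    {T : ℕ → ℕ → ℕ | (∀ i j, (i, j) ∉ cells → T i j = 0) ∧ P T ∧ content cells T = m}.Finite :=
  (finite_fillings cells m.support).subset fun _ hT =>
    ⟨hT.1, fun _ hc => mem_support_of_content hT.2.2 hc⟩

lemma fillingSeries_apply (cells : Finset (ℕ × ℕ)) (P : (ℕ → ℕ → ℕ) → Prop) (m : ℕ →₀ ℕ) :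
    fillingSeries cells P m = ({T : ℕ → ℕ → ℕ |
      (∀ i j, (i, j) ∉ cells → T i j = 0) ∧ P T ∧ content cells T = m}.ncard : ℚ) := rfl

lemma fillingSeries_ne_zero {cells : Finset (ℕ × ℕ)} {P : (ℕ → ℕ → ℕ) → Prop} {m : ℕ →₀ ℕ} :
    fillingSeries cells P m ≠ 0 ↔
      ∃ T : ℕ → ℕ → ℕ, (∀ i j, (i, j) ∉ cells → T i j = 0) ∧ P T ∧ content cells T = m := by
  rw [fillingSeries_apply, Nat.cast_ne_zero, ← Nat.pos_iff_ne_zero,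
    Set.ncard_pos (finite_fillingSeries cells P m)]
  rfl

/-! ### Skew shapes -/

lemma mem_cells {A : SkewShape} {i j : ℕ} :
    (i, j) ∈ A.cells ↔ A.inner.rowLen i ≤ j ∧ j < A.outer.rowLen i := by
  rw [SkewShape.cells, Finset.mem_sdiff, YoungDiagram.mem_cells, YoungDiagram.mem_cells,
    YoungDiagram.mem_iff_lt_rowLen, YoungDiagram.mem_iff_lt_rowLen, not_lt, and_comm]

/-- Skew shapes are convex for the product order. This allows comparing the entries of two boxes
through the corner between them. -/
lemma mem_cells_of_between {A : SkewShape} {i j i' j' i'' j'' : ℕ} (h : (i, j) ∈ A.cells)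
    (h'' : (i'', j'') ∈ A.cells) (hi : i ≤ i') (hi' : i' ≤ i'') (hj : j ≤ j') (hj' : j' ≤ j'') :
    (i', j') ∈ A.cells := by
  rw [mem_cells] at *
  exact ⟨(A.inner.rowLen_anti _ _ hi).trans (h.1.trans hj),
    hj'.trans_lt (h''.2.trans_le (A.outer.rowLen_anti _ _ hi'))⟩

lemma IsSemistandard.le {A : SkewShape} {T : ℕ → ℕ → ℕ} (hT : IsSemistandard A.cells T)
    {i j i' j' : ℕ} (h : (i, j) ∈ A.cells) (h' : (i', j') ∈ A.cells) (hi : i ≤ i') (hj : j ≤ j') :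
    T i j ≤ T i' j' := by
  have h1 : (i, j') ∈ A.cells := mem_cells_of_between h h' le_rfl hi hj le_rfl
  calc T i j ≤ T i j' := by
        rcases hj.eq_or_lt with rfl | hj
        · exact le_rfl
        · exact hT.1 _ _ _ hj h h1
    _ ≤ T i' j' := by
        rcases hi.eq_or_lt with rfl | hi
        · exact le_rfl
        · exact (hT.2 _ _ _ hi h1 h').le

lemma IsSemistandard.lt {A : SkewShape} {T : ℕ → ℕ → ℕ} (hT : IsSemistandard A.cells T)
    {i j i' j' : ℕ} (h : (i, j) ∈ A.cells) (h' : (i', j') ∈ A.cells) (hi : i < i') (hj : j ≤ j') :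
    T i j < T i' j' := by
  have h1 : (i, j') ∈ A.cells := mem_cells_of_between h h' le_rfl hi.le hj le_rfl
  exact (hT.le h h1 le_rfl hj).trans_lt (hT.2 _ _ _ hi h1 h')

/-! ### Ranks with respect to an injective key -/

section Rank

variable {α κ : Type*} [LinearOrder κ]

/-- The number of elements of `s` with smaller key. -/
def keyRank (s : Finset α) (key : α → κ) (x : α) : ℕ := (s.filter fun y => key y < key x).card

lemma keyRank_lt_keyRank {s : Finset α} {key : α → κ} {x y : α} (hx : x ∈ s)
    (h : key x < key y) : keyRank s key x < keyRank s key y := by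
  apply Finset.card_lt_card
  rw [Finset.ssubset_iff_of_subset fun z hz => ?_]
  · exact ⟨x, Finset.mem_filter.2 ⟨hx, h⟩, fun h' => lt_irrefl _ (Finset.mem_filter.1 h').2⟩
  · exact Finset.mem_filter.2 ⟨(Finset.mem_filter.1 hz).1, (Finset.mem_filter.1 hz).2.trans h⟩

lemma keyRank_lt_card {s : Finset α} {key : α → κ} {x : α} (hx : x ∈ s) :
    keyRank s key x < s.card := by
  apply Finset.card_lt_card
  rw [Finset.ssubset_iff_of_subset (Finset.filter_subset _ _)]
  exact ⟨x, hx, fun h' => lt_irrefl _ (Finset.mem_filter.1 h').2⟩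

lemma key_lt_of_keyRank_lt {s : Finset α} {key : α → κ} {x y : α} (hy : y ∈ s)
    (h : keyRank s key x < keyRank s key y) : key x < key y := by
  by_contra h'
  rcases (not_lt.1 h').lt_or_eq with h' | h'
  · exact lt_asymm h (keyRank_lt_keyRank hy h')
  · rw [keyRank, keyRank, h'] at h
    exact lt_irrefl _ h

lemma keyRank_injOn {s : Finset α} {key : α → κ} (hk : Set.InjOn key s) :
    Set.InjOn (keyRank s key) s := by
  intro x hx y hy h
  rcases lt_trichotomy (key x) (key y) with h' | h' | h'
  · exact absurd h (keyRank_lt_keyRank hx h').ne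
  · exact hk hx hy h'
  · exact absurd h (keyRank_lt_keyRank hy h').ne'

end Rank

/-! ### Standard tableaux -/

/-- Standard tableaux of skew shape, with entries `0, …, n - 1`. -/
structure IsStandard (A : SkewShape) (U : ℕ → ℕ → ℕ) : Prop where
  zero : ∀ i j, (i, j) ∉ A.cells → U i j = 0
  semi : IsSemistandard A.cells U
  inj : Set.InjOn (fun c : ℕ × ℕ => U c.1 c.2) A.cells
  lt : ∀ c ∈ A.cells, U c.1 c.2 < A.size

lemma IsStandard.image {A : SkewShape} {U : ℕ → ℕ → ℕ} (hU : IsStandard A U) :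
    A.cells.image (fun c : ℕ × ℕ => U c.1 c.2) = Finset.range A.size := by
  apply Finset.eq_of_subset_of_card_le
  · intro x hx
    obtain ⟨c, hc, rfl⟩ := Finset.mem_image.1 hx
    exact Finset.mem_range.2 (hU.lt c hc)
  · rw [Finset.card_image_of_injOn hU.inj, Finset.card_range]
    exact le_rfl

lemma IsStandard.exists_cell {A : SkewShape} {U : ℕ → ℕ → ℕ} (hU : IsStandard A U) {p : ℕ}
    (hp : p < A.size) : ∃ c ∈ A.cells, U c.1 c.2 = p := by
  have : p ∈ A.cells.image (fun c : ℕ × ℕ => U c.1 c.2) := by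
    rw [hU.image]
    exact Finset.mem_range.2 hp
  exact Finset.mem_image.1 this

open Classical in
/-- The descents of a standard tableau: `p` is a descent if the `p`-th entry lies in a strictly
higher row than the following one. -/
noncomputable def tableauDescents (A : SkewShape) (U : ℕ → ℕ → ℕ) : Finset ℕ :=
  (Finset.Ioo 0 A.size).filter fun p => ∃ c ∈ A.cells, ∃ c' ∈ A.cells,
    U c.1 c.2 + 1 = p ∧ U c'.1 c'.2 = p ∧ c.1 < c'.1

lemma IsStandard.mem_descents {A : SkewShape} {U : ℕ → ℕ → ℕ} (hU : IsStandard A U)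
    {c c' : ℕ × ℕ} (hc : c ∈ A.cells) (hc' : c' ∈ A.cells) (h : U c.1 c.2 + 1 = U c'.1 c'.2) :
    U c'.1 c'.2 ∈ tableauDescents A U ↔ c.1 < c'.1 := by
  rw [tableauDescents, Finset.mem_filter]
  constructor
  · rintro ⟨-, d, hd, d', hd', h1, h2, h3⟩
    have e1 : d = c := hU.inj hd hc (by simp only; omega)
    have e2 : d' = c' := hU.inj hd' hc' h2
    rwa [e1, e2] at h3
  · intro h'
    have := hU.lt c' hc'
    exact ⟨Finset.mem_Ioo.2 ⟨by omega, this⟩, c, hc, c', hc', h, rfl, h'⟩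

/-- Without descents, entries move weakly upwards. -/
lemma IsStandard.row_le {A : SkewShape} {U : ℕ → ℕ → ℕ} (hU : IsStandard A U)
    {c c' : ℕ × ℕ} (hc : c ∈ A.cells) (hc' : c' ∈ A.cells) (h : U c.1 c.2 ≤ U c'.1 c'.2)
    (hd : ∀ p, U c.1 c.2 < p → p ≤ U c'.1 c'.2 → p ∉ tableauDescents A U) : c'.1 ≤ c.1 := by
  generalize hn : U c'.1 c'.2 = n at h hd
  induction n, h using Nat.le_induction generalizing c' with
  | base => rw [hU.inj hc' hc hn]
  | succ n h ih =>
    obtain ⟨d, hd1, hd2⟩ := hU.exists_cell (p := n) (by have := hU.lt c' hc'; omega)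
    have h1 := ih hd1 hd2 fun p h1 h2 => hd p h1 (by omega)
    have h2 := hd (n + 1) (by omega) le_rfl
    rw [← hn, hU.mem_descents hd1 hc' (by omega)] at h2
    omega

/-- If there are only descents, entries move strictly downwards. -/
lemma IsStandard.row_lt {A : SkewShape} {U : ℕ → ℕ → ℕ} (hU : IsStandard A U)
    {c c' : ℕ × ℕ} (hc : c ∈ A.cells) (hc' : c' ∈ A.cells) (h : U c.1 c.2 < U c'.1 c'.2)
    (hd : ∀ p, U c.1 c.2 < p → p ≤ U c'.1 c'.2 → p ∈ tableauDescents A U) : c.1 < c'.1 := by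
  generalize hn : U c'.1 c'.2 = n at h hd
  induction n, Nat.succ_le_iff.2 h using Nat.le_induction generalizing c' with
  | base =>
    have h2 := hd (U c.1 c.2 + 1) (by omega) le_rfl
    rwa [← Nat.succ_eq_add_one, ← hn, hU.mem_descents hc hc' (by omega)] at h2
  | succ n h' ih =>
    obtain ⟨d, hd1, hd2⟩ := hU.exists_cell (p := n) (by have := hU.lt c' hc'; omega)
    have h1 := ih hd1 hd2 (by omega) fun p h1 h2 => hd p h1 (by omega)
    have h2 := hd (n + 1) (by omega) le_rfl
    rw [← hn, hU.mem_descents hd1 hc' (by omega)] at h2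
    omega

lemma finite_standard (A : SkewShape) : {U | IsStandard A U}.Finite :=
  (finite_fillings A.cells (Finset.range A.size)).subset fun _ hU =>
    ⟨hU.zero, fun c hc => Finset.mem_range.2 (hU.lt c hc)⟩

/-! ### Standardization -/

/-- The standardization of a semistandard tableau. -/
def standardize (A : SkewShape) (T : ℕ → ℕ → ℕ) (i j : ℕ) : ℕ :=
  if (i, j) ∈ A.cells then
    keyRank A.cells (fun c : ℕ × ℕ => toLex (T c.1 c.2, c.2)) (i, j) else 0

/-- Two boxes with the same entry cannot share a column, so the column number breaks all ties. -/
lemma IsSemistandard.key_injOn {A : SkewShape} {T : ℕ → ℕ → ℕ} (hT : IsSemistandard A.cells T) :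
    Set.InjOn (fun c : ℕ × ℕ => toLex (T c.1 c.2, c.2)) A.cells := by
  rintro ⟨i, j⟩ hc ⟨i', j'⟩ hc' h
  obtain ⟨h1, h2⟩ := Prod.ext_iff.1 (toLex.injective h)
  simp only at h1 h2
  subst h2
  rcases lt_trichotomy i i' with h | h | h
  · exact absurd h1 (hT.2 _ _ _ h hc hc').ne
  · rw [h]
  · exact absurd h1 (hT.2 _ _ _ h hc' hc).ne'

/-- The tableau of ranks of a key that increases along rows and columns. -/
lemma isStandard_keyRank (A : SkewShape) {κ : Type*} [LinearOrder κ] (key : ℕ × ℕ → κ)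
    (hk : Set.InjOn key A.cells)
    (hrow : ∀ i j₁ j₂, j₁ < j₂ → (i, j₁) ∈ A.cells → (i, j₂) ∈ A.cells → key (i, j₁) < key (i, j₂))
    (hcol : ∀ i₁ i₂ j, i₁ < i₂ → (i₁, j) ∈ A.cells → (i₂, j) ∈ A.cells →
      key (i₁, j) < key (i₂, j)) :
    IsStandard A fun i j => if (i, j) ∈ A.cells then keyRank A.cells key (i, j) else 0 where
  zero i j h := if_neg h
  semi := by
    refine ⟨fun i j₁ j₂ hj h h' => ?_, fun i₁ i₂ j hi h h' => ?_⟩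
    · simp only [if_pos h, if_pos h']
      exact (keyRank_lt_keyRank h (hrow i j₁ j₂ hj h h')).le
    · simp only [if_pos h, if_pos h']
      exact keyRank_lt_keyRank h (hcol i₁ i₂ j hi h h')
  inj := by
    intro c hc c' hc' h
    simp only [Prod.mk.eta, if_pos (Finset.mem_coe.1 hc), if_pos (Finset.mem_coe.1 hc')] at h
    exact keyRank_injOn hk hc hc' h
  lt c hc := by
    simp only [Prod.mk.eta, if_pos hc]
    exact keyRank_lt_card hc

lemma IsSemistandard.isStandard {A : SkewShape} {T : ℕ → ℕ → ℕ} (hT : IsSemistandard A.cells T) :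
    IsStandard A (standardize A T) := by
  refine isStandard_keyRank A _ hT.key_injOn (fun i j₁ j₂ hj h h' => ?_) fun i₁ i₂ j hi h h' => ?_
  · rw [Prod.Lex.toLex_lt_toLex]
    rcases (hT.1 _ _ _ hj h h').lt_or_eq with h1 | h1
    · exact Or.inl h1
    · exact Or.inr ⟨h1, hj⟩
  · rw [Prod.Lex.toLex_lt_toLex]
    exact Or.inl (hT.2 _ _ _ hi h h')

/-- Partial sums of a content. -/
def partialSum (m : ℕ → ℕ) (v : ℕ) : ℕ := ∑ u ∈ Finset.range v, m u

lemma partialSum_mono (m : ℕ → ℕ) : Monotone (partialSum m) := fun _ _ h =>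
  Finset.sum_le_sum_of_subset (Finset.range_mono h)

lemma partialSum_succ (m : ℕ → ℕ) (v : ℕ) : partialSum m (v + 1) = partialSum m v + m v :=
  Finset.sum_range_succ _ _

lemma partialSum_le_degree (m : ℕ →₀ ℕ) (v : ℕ) : partialSum m v ≤ m.degree := by
  rw [partialSum, Finsupp.degree_apply]
  apply Finset.sum_le_sum_of_ne_zero
  intro x _ hx
  exact Finsupp.mem_support_iff.2 hx

lemma exists_partialSum_eq_degree (m : ℕ →₀ ℕ) : ∃ v, partialSum m v = m.degree := by
  refine ⟨m.support.sup id + 1, le_antisymm (partialSum_le_degree _ _) ?_⟩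
  rw [partialSum, Finsupp.degree_apply]
  apply Finset.sum_le_sum_of_subset
  intro x hx
  exact Finset.mem_range.2 (Nat.lt_succ_of_le (Finset.le_sup (f := id) hx))

open Classical in
/-- The letter at a given position of the weakly increasing word of content `m`. -/
noncomputable def letter (m : ℕ → ℕ) (p : ℕ) : ℕ := sInf {v | p < partialSum m (v + 1)}

lemma letter_eq {m : ℕ → ℕ} {p v : ℕ} (h1 : partialSum m v ≤ p) (h2 : p < partialSum m (v + 1)) :
    letter m p = v := by
  have h4 : letter m p ≤ v := Nat.sInf_le (s := {v | p < partialSum m (v + 1)}) h2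
  refine le_antisymm h4 ?_
  by_contra h
  have h3 : p < partialSum m (letter m p + 1) := Nat.sInf_mem (s := {v | p < partialSum m (v + 1)}) ⟨v, h2⟩
  exact absurd (h3.trans_le (partialSum_mono m (not_le.1 h))) (not_lt.2 h1)

lemma letter_spec {m : ℕ →₀ ℕ} {p : ℕ} (hp : p < m.degree) :
    partialSum m (letter m p) ≤ p ∧ p < partialSum m (letter m p + 1) := by
  obtain ⟨v, hv⟩ := exists_partialSum_eq_degree m
  have hne : {v | p < partialSum m (v + 1)}.Nonempty :=
    ⟨v, (hp.trans_eq hv.symm).trans_le (partialSum_mono m (Nat.le_succ v))⟩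
  refine ⟨?_, Nat.sInf_mem hne⟩
  by_contra h
  rcases hl : letter m p with _ | w
  · rw [hl] at h
    simp [partialSum] at h
  · rw [hl] at h
    have : letter m p ≤ w := Nat.sInf_le (not_le.1 h)
    omega

lemma letter_mono {m : ℕ →₀ ℕ} {p q : ℕ} (h : p ≤ q) (hq : q < m.degree) :
    letter m p ≤ letter m q :=
  Nat.sInf_le (h.trans_lt (letter_spec hq).2)

lemma partialSum_content (cells : Finset (ℕ × ℕ)) (T : ℕ → ℕ → ℕ) (v : ℕ) :
    partialSum (content cells T) v = (cells.filter fun c => T c.1 c.2 < v).card := by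
  rw [partialSum, Finset.card_eq_sum_card_fiberwise (f := fun c => T c.1 c.2) (t := Finset.range v)]
  · refine Finset.sum_congr rfl fun u hu => ?_
    rw [content_apply, Finset.filter_filter]
    congr 1
    refine Finset.filter_congr fun c _ => ?_
    have := Finset.mem_range.1 hu
    constructor
    · intro h; exact ⟨by omega, h⟩
    · exact fun h => h.2
  · intro c hc
    simpa using (Finset.mem_filter.1 hc).2

/-- All boxes with smaller entry precede a given box, and no box with larger entry does. So the
boxes with entry `v` receive ranks between the consecutive partial sums at `v` and `v + 1`, from
which `letter` recovers `v`. -/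
lemma IsSemistandard.standardize_bounds {A : SkewShape} {T : ℕ → ℕ → ℕ} {c : ℕ × ℕ}
    (hc : c ∈ A.cells) :
    partialSum (content A.cells T) (T c.1 c.2) ≤ standardize A T c.1 c.2 ∧
      standardize A T c.1 c.2 < partialSum (content A.cells T) (T c.1 c.2 + 1) := by
  rw [standardize, if_pos hc, partialSum_content, partialSum_content, keyRank]
  constructor
  · apply Finset.card_le_card
    intro d hd
    rw [Finset.mem_filter] at *
    exact ⟨hd.1, Prod.Lex.toLex_lt_toLex.2 (Or.inl hd.2)⟩
  · apply Finset.card_lt_card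
    rw [Finset.ssubset_iff_of_subset]
    · refine ⟨c, Finset.mem_filter.2 ⟨hc, Nat.lt_succ_self _⟩, fun h => ?_⟩
      exact lt_irrefl _ (Finset.mem_filter.1 h).2
    · intro d hd
      rw [Finset.mem_filter] at *
      refine ⟨hd.1, ?_⟩
      rcases Prod.Lex.toLex_lt_toLex.1 hd.2 with h | h
      · exact Nat.lt_succ_of_lt h
      · exact Nat.lt_succ_of_le h.1.le

lemma IsSemistandard.letter_standardize {A : SkewShape} {T : ℕ → ℕ → ℕ} {c : ℕ × ℕ}
    (hc : c ∈ A.cells) : letter (content A.cells T) (standardize A T c.1 c.2) = T c.1 c.2 :=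
  letter_eq (standardize_bounds hc).1 (standardize_bounds hc).2

/-- Consecutive boxes with equal entries are ordered left to right; if the second were also strictly
lower, its entry would be strictly larger. So entries jump at a descent, and the descent is a
partial sum of the content. -/
lemma IsSemistandard.descents_standardize {A : SkewShape} {T : ℕ → ℕ → ℕ}
    (hT : IsSemistandard A.cells T) {p : ℕ} (hp : p ∈ tableauDescents A (standardize A T)) :
    p ∈ cuts (content A.cells T) := by
  obtain ⟨-, c, hc, c', hc', h1, h2, h3⟩ := Finset.mem_filter.1 hp
  have hlt : T c.1 c.2 < T c'.1 c'.2 := by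
    by_contra hle
    have hr : keyRank A.cells (fun c : ℕ × ℕ => toLex (T c.1 c.2, c.2)) c <
        keyRank A.cells (fun c : ℕ × ℕ => toLex (T c.1 c.2, c.2)) c' := by
      rw [standardize, if_pos hc] at h1
      rw [standardize, if_pos hc'] at h2
      simp only [Prod.mk.eta] at h1 h2
      omega
    rcases Prod.Lex.toLex_lt_toLex.1 (key_lt_of_keyRank_lt
      (key := fun c : ℕ × ℕ => toLex (T c.1 c.2, c.2)) hc' hr) with h | h
    · exact hle h
    · exact absurd h.1 (hT.lt (i := c.1) (j := c.2) hc hc' h3 h.2.le).ne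
  refine ⟨T c'.1 c'.2, le_antisymm ?_ ?_⟩
  · rw [← h2]
    exact (standardize_bounds hc').1
  · have h4 := (standardize_bounds (T := T) hc).2
    have h5 := partialSum_mono (content A.cells T) (Nat.succ_le_of_lt hlt)
    change p ≤ partialSum _ _
    simp only [Nat.succ_eq_add_one] at h5
    omega

section Destandardize

variable {A : SkewShape} {U : ℕ → ℕ → ℕ} (hU : IsStandard A U) {m : ℕ →₀ ℕ}

/-- The semistandard filling of content `m` obtained from a standard tableau. -/
noncomputable def destandardize (A : SkewShape) (m : ℕ → ℕ) (U : ℕ → ℕ → ℕ) (i j : ℕ) : ℕ :=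
  open Classical in if (i, j) ∈ A.cells then letter m (U i j) else 0

lemma destandardize_apply (m : ℕ → ℕ) (U : ℕ → ℕ → ℕ) {i j : ℕ} (h : (i, j) ∈ A.cells) :
    destandardize A m U i j = letter m (U i j) := if_pos h

/-- Positions with the same letter have no partial sum of `m` separating them, hence no descent
between them, and `IsStandard.row_le` applies. -/
lemma IsStandard.row_le_of_letter_eq (hU : IsStandard A U) (hm : m.degree = A.size)
    (hd : ∀ p ∈ tableauDescents A U, p ∈ cuts m)
    {c c' : ℕ × ℕ} (hc : c ∈ A.cells) (hc' : c' ∈ A.cells) (h : U c.1 c.2 ≤ U c'.1 c'.2)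
    (hl : letter m (U c.1 c.2) = letter m (U c'.1 c'.2)) : c'.1 ≤ c.1 := by
  refine hU.row_le hc hc' h fun p h1 h2 hp => ?_
  obtain ⟨v, hv⟩ := hd p hp
  change partialSum m v = p at hv
  have s1 := letter_spec (m := m) (p := U c.1 c.2) (by rw [hm]; exact hU.lt c hc)
  have s2 := letter_spec (m := m) (p := U c'.1 c'.2) (by rw [hm]; exact hU.lt c' hc')
  rw [← hl] at s2
  rcases le_or_gt v (letter m (U c.1 c.2)) with h3 | h3
  · have := partialSum_mono m h3
    omega
  · have := partialSum_mono m (Nat.succ_le_of_lt h3)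
    simp only [Nat.succ_eq_add_one] at this
    omega

lemma IsStandard.semistandard_destandardize (hU : IsStandard A U) (hm : m.degree = A.size)
    (hd : ∀ p ∈ tableauDescents A U, p ∈ cuts m) :
    IsSemistandard A.cells (destandardize A m U) := by
  have hlt : ∀ i j, (i, j) ∈ A.cells → U i j < m.degree := fun i j h => hm ▸ hU.lt (i, j) h
  refine ⟨fun i j₁ j₂ hj h h' => ?_, fun i₁ i₂ j hi h h' => ?_⟩
  · rw [destandardize_apply _ _ h, destandardize_apply _ _ h']
    exact letter_mono (hU.semi.1 _ _ _ hj h h') (hlt _ _ h')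
  · rw [destandardize_apply _ _ h, destandardize_apply _ _ h']
    have h1 := hU.semi.2 _ _ _ hi h h'
    refine lt_of_le_of_ne (letter_mono h1.le (hlt _ _ h')) fun h2 => ?_
    have := hU.row_le_of_letter_eq hm hd h h' h1.le h2
    simp only at this
    omega

lemma IsStandard.content_destandardize (hU : IsStandard A U) (hm : m.degree = A.size) :
    content A.cells (destandardize A m U) = m := by
  ext v
  rw [content_apply]
  have h1 : (A.cells.filter fun c => destandardize A m U c.1 c.2 = v).card =
      ((A.cells.filter fun c => destandardize A m U c.1 c.2 = v).image
        fun c => U c.1 c.2).card := by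
    rw [Finset.card_image_of_injOn]
    exact hU.inj.mono fun c hc => (Finset.mem_filter.1 hc).1
  have h2 : ((A.cells.filter fun c => destandardize A m U c.1 c.2 = v).image
        fun c => U c.1 c.2) = Finset.Ico (partialSum m v) (partialSum m (v + 1)) := by
    ext p
    rw [Finset.mem_image, Finset.mem_Ico]
    constructor
    · rintro ⟨c, hc, rfl⟩
      obtain ⟨hc, h⟩ := Finset.mem_filter.1 hc
      rw [destandardize_apply _ _ hc] at h
      rw [← h]
      exact letter_spec (hm ▸ hU.lt c hc)
    · intro hp
      obtain ⟨c, hc, rfl⟩ := hU.exists_cell (p := p)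
        (hm ▸ hp.2.trans_le (partialSum_le_degree m _))
      exact ⟨c, Finset.mem_filter.2 ⟨hc, by
        rw [destandardize_apply _ _ hc, letter_eq hp.1 hp.2]⟩, rfl⟩
  rw [h1, h2, Nat.card_Ico, partialSum_succ]
  omega

lemma IsStandard.standardize_destandardize (hU : IsStandard A U) (hm : m.degree = A.size)
    (hd : ∀ p ∈ tableauDescents A U, p ∈ cuts m) :
    standardize A (destandardize A m U) = U := by
  have hlt : ∀ c ∈ A.cells, U c.1 c.2 < m.degree := fun c h => hm ▸ hU.lt c h
  -- Among equal letters the later box lies weakly higher. It must lie strictly to the right, for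
  -- otherwise it would be weakly northwest of the earlier box and carry a smaller entry.
  have key : ∀ c ∈ A.cells, ∀ c' ∈ A.cells, U c.1 c.2 < U c'.1 c'.2 →
      toLex (destandardize A m U c.1 c.2, c.2) < toLex (destandardize A m U c'.1 c'.2, c'.2) := by
    intro c hc c' hc' h
    rw [Prod.Lex.toLex_lt_toLex, destandardize_apply _ _ hc, destandardize_apply _ _ hc']
    rcases (letter_mono h.le (hlt c' hc')).lt_or_eq with h1 | h1
    · exact Or.inl h1
    · refine Or.inr ⟨h1, ?_⟩
      have h2 := hU.row_le_of_letter_eq hm hd hc hc' h.le h1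
      by_contra h3
      exact absurd (hU.semi.le (i := c'.1) (j := c'.2) (i' := c.1) (j' := c.2) hc' hc h2
        (not_lt.1 h3)) (not_le.2 h)
  ext i j
  by_cases hc : (i, j) ∈ A.cells
  · rw [standardize, if_pos hc, keyRank]
    have h1 : (A.cells.filter fun y : ℕ × ℕ => toLex (destandardize A m U y.1 y.2, y.2) <
        toLex (destandardize A m U i j, j)) = A.cells.filter fun y => U y.1 y.2 < U i j := by
      refine Finset.filter_congr fun y hy => ⟨fun h => ?_, fun h => key y hy (i, j) hc h⟩
      by_contra h'
      rcases (not_lt.1 h').lt_or_eq with h2 | h2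
      · exact lt_asymm h (key (i, j) hc y hy h2)
      · have : y = (i, j) := hU.inj hy hc h2.symm
        subst this
        exact lt_irrefl _ h
    simp only
    rw [h1, ← Finset.card_image_of_injOn (f := fun c : ℕ × ℕ => U c.1 c.2)
      (hU.inj.mono fun c hc => (Finset.mem_filter.1 hc).1)]
    have h2 : ((A.cells.filter fun y => U y.1 y.2 < U i j).image fun c : ℕ × ℕ => U c.1 c.2) =
        Finset.range (U i j) := by
      ext p
      rw [Finset.mem_image, Finset.mem_range]
      constructor
      · rintro ⟨c, hc, rfl⟩
        exact (Finset.mem_filter.1 hc).2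
      · intro hp
        obtain ⟨c, hc', rfl⟩ := hU.exists_cell (hp.trans (hU.lt (i, j) hc))
        exact ⟨c, Finset.mem_filter.2 ⟨hc', hp⟩, rfl⟩
    rw [h2, Finset.card_range]
  · rw [standardize, if_neg hc, hU.zero i j hc]

end Destandardize

lemma destandardize_standardize {A : SkewShape} {T : ℕ → ℕ → ℕ}
    (h0 : ∀ i j, (i, j) ∉ A.cells → T i j = 0) :
    destandardize A (content A.cells T) (standardize A T) = T := by
  ext i j
  by_cases hc : (i, j) ∈ A.cells
  · rw [destandardize_apply _ _ hc]
    exact IsSemistandard.letter_standardize hc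
  · rw [h0 i j hc]
    exact if_neg hc

/-- Standardization is a bijection onto the standard tableaux whose descents are cuts of `m`, with
inverse given by reading off letters. Combined with the indicator form of F_α this is the
fundamental expansion. -/
lemma skewSchur_apply (A : SkewShape) (m : ℕ →₀ ℕ) :
    skewSchur A m = ({U | IsStandard A U ∧ m.degree = A.size ∧
      ∀ p ∈ tableauDescents A U, p ∈ cuts m}.ncard : ℚ) := by
  rw [skewSchur, fillingSeries_apply]
  congr 1
  refine Set.ncard_congr (fun T _ => standardize A T) ?_ ?_ ?_
  · rintro T ⟨h0, hT, rfl⟩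
    exact ⟨hT.isStandard, content_degree _ _, fun p hp => hT.descents_standardize hp⟩
  · rintro T T' ⟨h0, hT, hm⟩ ⟨h0', hT', hm'⟩ h
    rw [← destandardize_standardize h0, ← destandardize_standardize h0', h, hm, hm']
  · rintro U ⟨hU, hm, hd⟩
    exact ⟨destandardize A m U, ⟨fun i j h => if_neg h, hU.semistandard_destandardize hm hd,
      hU.content_destandardize hm⟩, hU.standardize_destandardize hm hd⟩

/-! ### The expansion of a skew Schur function in the fundamental basis -/

lemma exists_tableauComp (A : SkewShape) (U : ℕ → ℕ → ℕ) :
    ∃ α : Composition A.size, descentSet α = tableauDescents A U :=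
  exists_descentSet_eq _ fun _ hp => Finset.mem_Ioo.1 (Finset.mem_filter.1 hp).1

/-- The descent composition of a standard tableau. -/
noncomputable def tableauComp (A : SkewShape) (U : ℕ → ℕ → ℕ) : Comp :=
  ⟨A.size, (exists_tableauComp A U).choose⟩

lemma descentSet_tableauComp (A : SkewShape) (U : ℕ → ℕ → ℕ) :
    descentSet (tableauComp A U).2 = tableauDescents A U :=
  (exists_tableauComp A U).choose_spec

/-- The coefficients of a skew Schur function in the fundamental basis: they count standard
tableaux by descent composition. -/
noncomputable def fundamentalCoeff (A : SkewShape) : Comp →₀ ℚ :=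
  ∑ U ∈ (finite_standard A).toFinset, Finsupp.single (tableauComp A U) 1

lemma isExpansion_fundamentalCoeff (A : SkewShape) :
    IsExpansion fundamentalQ (fundamentalCoeff A) (skewSchur A) := by
  classical
  have h : ∀ m, (Finsupp.linearCombination ℚ fundamentalQ (fundamentalCoeff A) : Series) m =
      skewSchur A m := by
    intro m
    have h1 : MvPowerSeries.coeff m
        (Finsupp.linearCombination ℚ fundamentalQ (fundamentalCoeff A)) =
        ∑ U ∈ (finite_standard A).toFinset, fundamentalQ (tableauComp A U) m := by
      rw [fundamentalCoeff, map_sum, map_sum]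
      refine Finset.sum_congr rfl fun U _ => ?_
      rw [Finsupp.linearCombination_single, one_smul]
      rfl
    refine Eq.trans h1 ?_
    simp only [fundamentalQ_apply, descentSet_tableauComp]
    rw [Finset.sum_boole, skewSchur_apply, ← Set.ncard_coe_finset]
    congr 2
    ext U
    simp only [Finset.coe_filter, Set.Finite.mem_toFinset, Set.mem_ofPred_eq]
    rfl
  exact funext h

lemma fundamentalCoeff_apply (A : SkewShape) (α : Comp) : fundamentalCoeff A α =
    ∑ U ∈ (finite_standard A).toFinset, if tableauComp A U = α then 1 else 0 := by
  classical
  rw [fundamentalCoeff, Finsupp.finsetSum_apply]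
  exact Finset.sum_congr rfl fun U _ => by
    rw [Finsupp.single_apply]

lemma fundamentalCoeff_nonneg (A : SkewShape) (α : Comp) : 0 ≤ fundamentalCoeff A α := by
  classical
  rw [fundamentalCoeff_apply]
  exact Finset.sum_nonneg fun U _ => by split_ifs <;> norm_num

lemma fundamentalCoeff_pos_iff (A : SkewShape) (α : Comp) :
    0 < fundamentalCoeff A α ↔ ∃ U, IsStandard A U ∧ tableauComp A U = α := by
  classical
  rw [fundamentalCoeff_apply]
  rw [Finset.sum_boole, Nat.cast_pos, Finset.card_pos]
  simp only [Finset.Nonempty, Finset.mem_filter, Set.Finite.mem_toFinset, Set.mem_ofPred_eq]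

lemma fundamentalQ_eq_of_exponents (α : Comp) {m m' : ℕ →₀ ℕ} (h : exponents m = exponents m') :
    fundamentalQ α m = fundamentalQ α m' := by
  obtain ⟨e, he, -⟩ := exists_fundamentalQ_expansion α
  rw [he.eval, he.eval]
  simp only [monomialQ_apply, h]

lemma skewSchur_eq_of_exponents (A : SkewShape) {m m' : ℕ →₀ ℕ} (h : exponents m = exponents m') :
    skewSchur A m = skewSchur A m' := by
  rw [(isExpansion_fundamentalCoeff A).eval, (isExpansion_fundamentalCoeff A).eval]
  exact Finset.sum_congr rfl fun α _ => by rw [fundamentalQ_eq_of_exponents α h]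

lemma skewSchur_eq_zero_of_degree (A : SkewShape) {m : ℕ →₀ ℕ} (h : m.degree ≠ A.size) :
    skewSchur A m = 0 := by
  have h' : {U | IsStandard A U ∧ m.degree = A.size ∧
      ∀ p ∈ tableauDescents A U, p ∈ cuts m} = ∅ :=
    Set.eq_empty_of_forall_notMem fun U hU => h hU.2.1
  rw [skewSchur_apply, h', Set.ncard_empty, Nat.cast_zero]

end SkewQSym

/-! ### The overlap condition and its necessity for containment of fundamental supports. -/

namespace SkewQSym

/-! ### Overlap partitions and rectangles -/

/-- A rectangle lies in a skew shape as soon as its top left corner avoids the inner diagram and its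
bottom right corner lies in the outer one. -/
lemma forall_mem_cells_iff (A : SkewShape) (k l i j : ℕ) :
    (∀ a < k + 1, ∀ b < l + 1, (i + a, j + b) ∈ A.cells) ↔
      A.inner.rowLen i ≤ j ∧ j + l < A.outer.rowLen (i + k) := by
  constructor
  · intro h
    exact ⟨(mem_cells.1 (h 0 (by omega) 0 (by omega))).1,
      (mem_cells.1 (h k (by omega) l (by omega))).2⟩
  · rintro ⟨h1, h2⟩ a ha b hb
    rw [mem_cells]
    have h3 := A.inner.rowLen_anti i (i + a) (by omega)
    have h4 := A.outer.rowLen_anti (i + a) (i + k) (by omega)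
    omega

lemma rowOverlap_eq (A : SkewShape) (k i : ℕ) :
    rowOverlap A (k + 1) i = A.outer.rowLen (i + k) - A.inner.rowLen i := by
  rw [rowOverlap, ← Nat.card_Ico]
  congr 1
  ext j
  rw [Finset.mem_filter, Finset.mem_range, Finset.mem_Ico]
  have h := forall_mem_cells_iff A k 0 i j
  have h1 := A.outer.rowLen_anti 0 (i + k) (by omega)
  have h2 : (∀ a < k + 1, ∀ b < 0 + 1, (i + a, j + b) ∈ A.cells) ↔
      ∀ t < k + 1, (i + t, j) ∈ A.cells := by
    refine forall₂_congr fun a _ => ⟨fun h => h 0 (by omega), fun h b hb => ?_⟩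
    obtain rfl : b = 0 := by omega
    exact h
  rw [← h2, h]
  omega

lemma rects_eq_sum (A : SkewShape) (k l : ℕ) : rects A (k + 1) (l + 1) =
    ∑ i ∈ Finset.range (A.outer.colLen 0), (rowOverlap A (k + 1) i - l) := by
  rw [rects, Finset.card_eq_sum_card_fiberwise (f := Prod.fst)
    (t := Finset.range (A.outer.colLen 0))]
  · refine Finset.sum_congr rfl fun i _ => ?_
    rw [rowOverlap_eq, Nat.sub_sub, Nat.add_comm (A.inner.rowLen i) l, ← Nat.sub_sub,
      ← Nat.card_Ico]
    refine Finset.card_nbij' Prod.snd (fun j => (i, j)) ?_ ?_ ?_ ?_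
    · rintro ⟨i', j⟩ h
      rw [Finset.mem_coe, Finset.mem_filter, Finset.mem_filter] at h
      obtain ⟨⟨-, h1⟩, rfl⟩ := h
      have := (forall_mem_cells_iff A k l i' j).1 h1
      simp only [Finset.coe_Ico, Set.mem_Ico]
      omega
    · intro j h
      simp only [Finset.coe_Ico, Set.mem_Ico] at h
      have h1 := (forall_mem_cells_iff A k l i j).2 (by omega)
      rw [Finset.mem_coe, Finset.mem_filter, Finset.mem_filter]
      exact ⟨⟨by simpa using h1 0 (by omega) 0 (by omega), h1⟩, rfl⟩
    · rintro ⟨i', j⟩ h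
      rw [Finset.mem_coe, Finset.mem_filter] at h
      rw [← h.2]
    · exact fun _ _ => rfl
  · rintro ⟨i, j⟩ h
    have h1 := (mem_cells.1 (Finset.mem_filter.1 h).1).2
    rw [Finset.coe_range, Set.mem_Iio, ← YoungDiagram.mem_iff_lt_colLen,
      YoungDiagram.mem_iff_lt_rowLen]
    simp only
    omega

/-- Discarded zero overlaps and the windows of rows that run past the bottom of the diagram
contribute `g 0 = 0`, so the sum may run over all rows. -/
lemma sum_map_rowsPartition (A : SkewShape) (k : ℕ) (g : ℕ → ℕ) (hg : g 0 = 0) :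
    ((rowsPartition A (k + 1)).map g).sum =
      ∑ i ∈ Finset.range (A.outer.colLen 0), g (rowOverlap A (k + 1) i) := by
  have h1 : ((rowsPartition A (k + 1)).map g).sum =
      (((Multiset.range (A.outer.colLen 0 + 1 - (k + 1))).map
        fun i => g (rowOverlap A (k + 1) i))).sum := by
    rw [← Multiset.sum_coe, ← Multiset.map_coe, rowsPartition, Multiset.sort_eq]
    generalize Multiset.range (A.outer.colLen 0 + 1 - (k + 1)) = s
    induction s using Multiset.induction_on with
    | empty => simp
    | cons a s ih =>
      rw [Multiset.map_cons, Multiset.map_cons, Multiset.sum_cons, ← ih]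
      rcases Nat.eq_zero_or_pos (rowOverlap A (k + 1) a) with h | h
      · rw [Multiset.filter_cons_of_neg (p := fun x => 0 < x) _ (by omega), h, hg, zero_add]
      · rw [Multiset.filter_cons_of_pos (p := fun x => 0 < x) _ h, Multiset.map_cons, Multiset.sum_cons]
  rw [h1]
  change ∑ i ∈ Finset.range (A.outer.colLen 0 + 1 - (k + 1)), _ = _
  apply Finset.sum_subset
  · intro i hi
    rw [Finset.mem_range] at *
    omega
  · intro i _ hi
    rw [Finset.mem_range] at hi
    rw [rowOverlap_eq]
    have h2 : A.outer.rowLen (i + k) = 0 := by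
      by_contra h
      have := YoungDiagram.mem_iff_lt_colLen.1
        (YoungDiagram.mem_iff_lt_rowLen.2 (Nat.pos_of_ne_zero h))
      omega
    rw [h2, Nat.zero_sub, hg]

lemma rects_eq_rowsPartition (A : SkewShape) (k l : ℕ) : rects A (k + 1) (l + 1) =
    ((rowsPartition A (k + 1)).map (· - l)).sum := by
  rw [rects_eq_sum, sum_map_rowsPartition A k (· - l) (Nat.zero_sub l)]

/-- Each of the first `m` terms is at most its excess over `t` plus `t`, and the remaining excesses
are nonnegative. -/
lemma take_sum_le (l : List ℕ) (m t : ℕ) : (l.take m).sum ≤ (l.map (· - t)).sum + m * t := by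
  induction l generalizing m with
  | nil => simp
  | cons x l ih =>
    cases m with
    | zero => simp
    | succ m =>
      have := ih m
      rw [List.take_succ_cons, List.sum_cons, List.map_cons, List.sum_cons, Nat.succ_mul]
      omega

lemma sum_map_sub_eq_zero {l : List ℕ} {t : ℕ} (h : ∀ x ∈ l, x ≤ t) :
    (l.map (· - t)).sum = 0 := by
  rw [List.sum_eq_zero_iff]
  intro y hy
  obtain ⟨x, hx, rfl⟩ := List.mem_map.1 hy
  exact Nat.sub_eq_zero_of_le (h x hx)

/-- Equality holds for `m` the number of parts exceeding `t`; this `m` is at most the length, as the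
definition of `Dominated` demands. -/
lemma exists_take_sum_eq {l : List ℕ} (hl : l.Pairwise (· ≥ ·)) (t : ℕ) :
    ∃ m ≤ l.length, (l.map (· - t)).sum + m * t = (l.take m).sum := by
  induction l with
  | nil => exact ⟨0, by simp⟩
  | cons x l ih =>
    obtain ⟨h1, h2⟩ := List.pairwise_cons.1 hl
    rcases le_or_gt x t with h | h
    · refine ⟨0, by simp, ?_⟩
      rw [sum_map_sub_eq_zero]
      · simp
      · intro y hy
        rcases List.mem_cons.1 hy with rfl | hy
        · exact h
        · exact (h1 y hy).trans h
    · obtain ⟨m, hm, h3⟩ := ih h2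
      refine ⟨m + 1, by simpa using hm, ?_⟩
      rw [List.take_succ_cons, List.sum_cons, List.map_cons, List.sum_cons, Nat.succ_mul]
      omega

/-- Equality holds for `t` the part that follows the first `m`, or 0 if there is none. -/
lemma exists_threshold {l : List ℕ} (hl : l.Pairwise (· ≥ ·)) (m : ℕ) :
    ∃ t, (t = 0 ∨ t ∈ l) ∧ (l.map (· - t)).sum + m * t = (l.take m).sum := by
  induction l generalizing m with
  | nil => exact ⟨0, by simp⟩
  | cons x l ih =>
    obtain ⟨h1, h2⟩ := List.pairwise_cons.1 hl
    cases m with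
    | zero =>
      refine ⟨x, Or.inr (by simp), ?_⟩
      rw [sum_map_sub_eq_zero]
      · simp
      · intro y hy
        rcases List.mem_cons.1 hy with rfl | hy
        · exact le_rfl
        · exact h1 y hy
    | succ m =>
      obtain ⟨t, ht, h3⟩ := ih h2 m
      have h4 : t ≤ x := by
        rcases ht with rfl | ht
        · exact Nat.zero_le _
        · exact h1 t ht
      refine ⟨t, ht.imp_right (List.mem_cons_of_mem _), ?_⟩
      rw [List.take_succ_cons, List.sum_cons, List.map_cons, List.sum_cons, Nat.succ_mul]
      omega

/-- A discrete Legendre duality: prefix sums and truncated sums determine each other through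
`take_sum_le`, which is sharp for a suitable `m` at every `t` and for a suitable `t` at every `m`.
So inequalities transfer in both directions. -/
lemma dominated_iff {a b : List ℕ} (ha : a.Pairwise (· ≥ ·)) (hb : b.Pairwise (· ≥ ·)) :
    Dominated a b ↔ ∀ t, (a.map (· - t)).sum ≤ (b.map (· - t)).sum := by
  constructor
  · intro h t
    obtain ⟨m, hm, h1⟩ := exists_take_sum_eq ha t
    have h2 := h m hm
    have h3 := take_sum_le b m t
    omega
  · intro h m _
    obtain ⟨t, -, h1⟩ := exists_threshold hb m
    have h2 := h t
    have h3 := take_sum_le a m t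
    omega

lemma rowsPartition_pairwise (A : SkewShape) (k : ℕ) :
    (rowsPartition A k).Pairwise (· ≥ ·) := Multiset.pairwise_sort _ _

lemma dominated_rows_iff (A B : SkewShape) :
    (∀ k, 1 ≤ k → Dominated (rowsPartition A k) (rowsPartition B k)) ↔
      ∀ k l, 1 ≤ k → 1 ≤ l → rects A k l ≤ rects B k l := by
  constructor
  · intro h k l hk hl
    obtain ⟨k, rfl⟩ := Nat.exists_eq_add_of_le' hk
    obtain ⟨l, rfl⟩ := Nat.exists_eq_add_of_le' hl
    rw [rects_eq_rowsPartition, rects_eq_rowsPartition]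
    exact (dominated_iff (rowsPartition_pairwise _ _) (rowsPartition_pairwise _ _)).1 (h _ hk) l
  · intro h k hk
    obtain ⟨k, rfl⟩ := Nat.exists_eq_add_of_le' hk
    rw [dominated_iff (rowsPartition_pairwise _ _) (rowsPartition_pairwise _ _)]
    intro l
    rw [← rects_eq_rowsPartition, ← rects_eq_rowsPartition]
    exact h _ _ hk (by omega)

lemma mem_transpose_cells {A : SkewShape} {i j : ℕ} :
    (i, j) ∈ A.transpose.cells ↔ (j, i) ∈ A.cells := by
  simp only [SkewShape.cells, SkewShape.transpose, Finset.mem_sdiff, YoungDiagram.mem_cells,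
    YoungDiagram.mem_transpose, Prod.swap]

lemma rects_transpose (A : SkewShape) (k l : ℕ) : rects A.transpose k l = rects A l k := by
  refine Finset.card_nbij' Prod.swap Prod.swap ?_ ?_ (fun _ _ => Prod.swap_swap _)
    fun _ _ => Prod.swap_swap _
  · rintro ⟨i, j⟩ h
    rw [Finset.mem_coe, Finset.mem_filter] at *
    exact ⟨mem_transpose_cells.1 h.1, fun a ha b hb => mem_transpose_cells.1 (h.2 b hb a ha)⟩
  · rintro ⟨i, j⟩ h
    rw [Finset.mem_coe, Finset.mem_filter] at *
    exact ⟨mem_transpose_cells.2 h.1, fun a ha b hb => mem_transpose_cells.2 (h.2 b hb a ha)⟩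

lemma dominated_cols_iff (A B : SkewShape) :
    (∀ l, 1 ≤ l → Dominated (colsPartition A l) (colsPartition B l)) ↔
      ∀ k l, 1 ≤ k → 1 ≤ l → rects A k l ≤ rects B k l := by
  refine (dominated_rows_iff A.transpose B.transpose).trans ?_
  simp only [rects_transpose]
  exact ⟨fun h k l hk hl => h l k hl hk, fun h k l hk hl => h l k hl hk⟩

/-! ### The fundamental support bounds the overlaps -/

section Greedy

variable (B : SkewShape) (k l : ℕ)

/-- The class of a box: boxes at depth `d < k` in their column have class `d`; after their removal
boxes at position `p < l` in their row have class `k + p`; the other boxes have class `k + l`. -/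
def greedyClass (c : ℕ × ℕ) : ℕ :=
  if c.1 - B.inner.colLen c.2 < k then c.1 - B.inner.colLen c.2
  else if c.2 - B.inner.rowLen (c.1 - k) < l then k + (c.2 - B.inner.rowLen (c.1 - k))
  else k + l

/-- The key that orders the boxes by class, from left to right in the first `k` classes and from
top to bottom in the others. -/
def greedyKey (c : ℕ × ℕ) : ℕ ×ₗ ℕ ×ₗ ℕ :=
  toLex (greedyClass B k l c, toLex (if greedyClass B k l c < k then c.2 else c.1, c.2))

variable {B k l}

lemma greedyKey_lt {c c' : ℕ × ℕ} : greedyKey B k l c < greedyKey B k l c' ↔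
    greedyClass B k l c < greedyClass B k l c' ∨ greedyClass B k l c = greedyClass B k l c' ∧
      ((if greedyClass B k l c < k then c.2 else c.1) <
        (if greedyClass B k l c' < k then c'.2 else c'.1) ∨
      (if greedyClass B k l c < k then c.2 else c.1) =
        (if greedyClass B k l c' < k then c'.2 else c'.1) ∧ c.2 < c'.2) := by
  rw [greedyKey, greedyKey, Prod.Lex.toLex_lt_toLex, Prod.Lex.toLex_lt_toLex]

lemma colLen_le_of_mem {i j : ℕ} (h : (i, j) ∈ B.cells) : B.inner.colLen j ≤ i := by
  by_contra h'
  have := YoungDiagram.mem_iff_lt_rowLen.1 (YoungDiagram.mem_iff_lt_colLen.2 (not_le.1 h'))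
  have := (mem_cells.1 h).1
  omega

lemma rowLen_le_of_colLen_le {μ : YoungDiagram} {i j : ℕ} (h : μ.colLen j ≤ i) :
    μ.rowLen i ≤ j := by
  by_contra h'
  have := YoungDiagram.mem_iff_lt_colLen.1 (YoungDiagram.mem_iff_lt_rowLen.2 (not_le.1 h'))
  omega

/-- A box at depth at least `k` still lies outside the inner diagram after being moved up by `k`
rows. Hence what is left after peeling `k` boxes off each column starts, in row `i`, at the inner
row length of row `i - k`. -/
lemma rowLen_le_of_depth {i j : ℕ} (hd : ¬ i - B.inner.colLen j < k) (h : (i, j) ∈ B.cells) :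
    k ≤ i ∧ B.inner.rowLen (i - k) ≤ j := by
  have := colLen_le_of_mem h
  exact ⟨by omega, rowLen_le_of_colLen_le (by omega)⟩

lemma greedyKey_injOn : Set.InjOn (greedyKey B k l) B.cells := by
  rintro ⟨i, j⟩ hc ⟨i', j'⟩ hc' h
  obtain ⟨h1, h2⟩ := Prod.ext_iff.1 (toLex.injective h)
  obtain ⟨h3, h4⟩ := Prod.ext_iff.1 (toLex.injective h2)
  simp only at h1 h3 h4
  subst h4
  have e1 := colLen_le_of_mem hc
  have e2 := colLen_le_of_mem hc'
  rw [← h1] at h3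
  by_cases hk : greedyClass B k l (i, j) < k
  · have hk' := h1 ▸ hk
    unfold greedyClass at h1 hk hk'
    simp only at h1 hk hk'
    rw [Prod.mk.injEq]
    refine ⟨?_, rfl⟩
    split_ifs at h1 hk hk' <;> omega
  · rw [if_neg hk, if_neg hk] at h3
    rw [h3]

/-- Along a row the depth weakly increases, since inner columns get shorter, and so does the
distance from the left end; the tie break by column makes the key strict. -/
lemma greedyKey_row (i j₁ j₂ : ℕ) (hj : j₁ < j₂) (_ : (i, j₁) ∈ B.cells) (_ : (i, j₂) ∈ B.cells) :
    greedyKey B k l (i, j₁) < greedyKey B k l (i, j₂) := by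
  rw [greedyKey_lt]
  have hle : greedyClass B k l (i, j₁) ≤ greedyClass B k l (i, j₂) := by
    have := B.inner.colLen_anti j₁ j₂ hj.le
    unfold greedyClass
    simp only
    split_ifs <;> omega
  rcases hle.lt_or_eq with h1 | h1
  · exact Or.inl h1
  · refine Or.inr ⟨h1, ?_⟩
    rw [← h1]
    simp only
    split_ifs <;> omega

/-- Down a column the depth strictly increases while it is less than `k`; afterwards the class may
stay constant, and then the row breaks the tie. -/
lemma greedyKey_col (i₁ i₂ j : ℕ) (hi : i₁ < i₂) (h : (i₁, j) ∈ B.cells) (h' : (i₂, j) ∈ B.cells) :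
    greedyKey B k l (i₁, j) < greedyKey B k l (i₂, j) := by
  rw [greedyKey_lt]
  have e1 := colLen_le_of_mem h
  have e2 := colLen_le_of_mem h'
  have e3 := B.inner.rowLen_anti (i₁ - k) (i₂ - k) (by omega)
  have hle : greedyClass B k l (i₁, j) < greedyClass B k l (i₂, j) ∨
      greedyClass B k l (i₁, j) = greedyClass B k l (i₂, j) ∧ k ≤ greedyClass B k l (i₁, j) := by
    unfold greedyClass
    simp only
    split_ifs <;> omega
  rcases hle with h1 | ⟨h1, h2⟩
  · exact Or.inl h1
  · refine Or.inr ⟨h1, ?_⟩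
    rw [← h1, if_neg (not_lt.2 h2), if_neg (not_lt.2 h2)]
    exact Or.inl hi

variable (B k l) in
/-- The standard tableau that orders the boxes by their keys. -/
def greedyTableau (i j : ℕ) : ℕ :=
  if (i, j) ∈ B.cells then keyRank B.cells (greedyKey B k l) (i, j) else 0

lemma isStandard_greedyTableau : IsStandard B (greedyTableau B k l) :=
  isStandard_keyRank B _ greedyKey_injOn greedyKey_row greedyKey_col

variable (B k l) in
/-- The number of boxes of class less than `t`. -/
def greedyThreshold (t : ℕ) : ℕ := (B.cells.filter fun c => greedyClass B k l c < t).card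

lemma greedyTableau_lt_iff {c : ℕ × ℕ} (hc : c ∈ B.cells) (t : ℕ) :
    greedyTableau B k l c.1 c.2 < greedyThreshold B k l t ↔ greedyClass B k l c < t := by
  rw [greedyTableau, if_pos hc, keyRank, greedyThreshold]
  constructor
  · intro h
    by_contra h'
    refine absurd h (not_lt.2 (Finset.card_le_card fun d hd => ?_))
    rw [Finset.mem_filter] at *
    exact ⟨hd.1, greedyKey_lt.2 (Or.inl (hd.2.trans_le (not_lt.1 h')))⟩
  · intro h
    apply Finset.card_lt_card
    rw [Finset.ssubset_iff_of_subset]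
    · exact ⟨c, Finset.mem_filter.2 ⟨hc, h⟩, fun h' => lt_irrefl _ (Finset.mem_filter.1 h').2⟩
    · intro d hd
      rw [Finset.mem_filter] at *
      refine ⟨hd.1, lt_of_le_of_lt ?_ h⟩
      rcases greedyKey_lt.1 hd.2 with h' | h'
      · exact h'.le
      · exact h'.1.le

lemma greedyThreshold_le (t : ℕ) : greedyThreshold B k l t ≤ B.size :=
  Finset.card_filter_le _ _

lemma greedy_consecutive {t p : ℕ} (h1 : greedyThreshold B k l t < p)
    (h2 : p < greedyThreshold B k l (t + 1)) : ∃ c ∈ B.cells, ∃ c' ∈ B.cells,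
      greedyTableau B k l c.1 c.2 + 1 = p ∧ greedyTableau B k l c'.1 c'.2 = p ∧
      greedyClass B k l c = t ∧ greedyClass B k l c' = t ∧
      greedyKey B k l c < greedyKey B k l c' := by
  have hs := greedyThreshold_le (B := B) (k := k) (l := l) (t + 1)
  have hU := isStandard_greedyTableau (B := B) (k := k) (l := l)
  obtain ⟨c, hc, e1⟩ := hU.exists_cell (p := p - 1) (by omega)
  obtain ⟨c', hc', e2⟩ := hU.exists_cell (p := p) (by omega)
  have i1 := greedyTableau_lt_iff (k := k) (l := l) hc t
  have i2 := greedyTableau_lt_iff (k := k) (l := l) hc (t + 1)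
  have i3 := greedyTableau_lt_iff (k := k) (l := l) hc' t
  have i4 := greedyTableau_lt_iff (k := k) (l := l) hc' (t + 1)
  refine ⟨c, hc, c', hc', by omega, e2, by omega, by omega, ?_⟩
  have h3 : greedyTableau B k l c.1 c.2 < greedyTableau B k l c'.1 c'.2 := by omega
  rw [greedyTableau, if_pos hc, greedyTableau, if_pos hc'] at h3
  exact key_lt_of_keyRank_lt hc' h3

/-- A class `t < k` has one box per column at the same depth. Read from left to right these boxes
move weakly upwards, because inner columns get shorter. -/
lemma greedy_not_descent {t p : ℕ} (ht : t < k) (h1 : greedyThreshold B k l t < p)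
    (h2 : p < greedyThreshold B k l (t + 1)) :
    p ∉ tableauDescents B (greedyTableau B k l) := by
  obtain ⟨⟨i, j⟩, hc, ⟨i', j'⟩, hc', e1, e2, t1, t2, hk⟩ := greedy_consecutive h1 h2
  rw [← e2, isStandard_greedyTableau.mem_descents hc hc' (e1.trans e2.symm), not_lt]
  rw [greedyKey_lt, t1, t2, if_pos ht, if_pos ht] at hk
  have h3 := colLen_le_of_mem hc
  have h4 := colLen_le_of_mem hc'
  have h5 := B.inner.colLen_anti j j' (by simp only at hk; omega)
  unfold greedyClass at t1 t2
  simp only at t1 t2 ⊢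
  split_ifs at t1 t2 <;> omega

/-- A class `t` with `k ≤ t < k + l` has at most one box in each row and is read from top to bottom,
so every position inside it is a descent. -/
lemma greedy_descent {t p : ℕ} (ht : k ≤ t) (ht' : t < k + l) (h1 : greedyThreshold B k l t < p)
    (h2 : p < greedyThreshold B k l (t + 1)) :
    p ∈ tableauDescents B (greedyTableau B k l) := by
  obtain ⟨⟨i, j⟩, hc, ⟨i', j'⟩, hc', e1, e2, t1, t2, hk⟩ := greedy_consecutive h1 h2
  rw [← e2, isStandard_greedyTableau.mem_descents hc hc' (e1.trans e2.symm)]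
  rw [greedyKey_lt, t1, t2, if_neg (not_lt.2 ht), if_neg (not_lt.2 ht)] at hk
  rcases hk with hk | ⟨-, hk | ⟨hk, hj⟩⟩
  · exact absurd hk (lt_irrefl _)
  · exact hk
  · exfalso
    simp only at hk hj
    subst hk
    unfold greedyClass at t1 t2
    simp only at t1 t2
    split_ifs at t1 t2 with d1 d2 d3 d4
    all_goals try omega
    have := (rowLen_le_of_depth d1 hc).2
    omega

/-- A box in the last class, moved up by `k` and left by `l`, becomes the top left box of a
rectangle with `k + 1` rows and `l + 1` columns inside `B`. -/
lemma size_le_rects_add : B.size ≤ rects B (k + 1) (l + 1) + greedyThreshold B k l (k + l) := by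
  have h1 : B.size = (B.cells.filter fun c => greedyClass B k l c < k + l).card +
      (B.cells.filter fun c => ¬ greedyClass B k l c < k + l).card :=
    (Finset.card_filter_add_card_filter_not _).symm
  rw [h1, add_comm, greedyThreshold]
  refine Nat.add_le_add_right ?_ _
  have hprop : ∀ i j, (i, j) ∈ B.cells → ¬ greedyClass B k l (i, j) < k + l →
      k ≤ i ∧ l ≤ j ∧ B.inner.rowLen (i - k) ≤ j - l := by
    intro i j hc h
    unfold greedyClass at h
    simp only at h
    split_ifs at h with d1 d2
    all_goals try omega
    have := rowLen_le_of_depth d1 hc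
    omega
  refine Finset.card_le_card_of_injOn (fun c => (c.1 - k, c.2 - l)) ?_ ?_
  · rintro ⟨i, j⟩ h
    rw [Finset.mem_coe, Finset.mem_filter] at h
    obtain ⟨hc, h⟩ := h
    obtain ⟨hk, hl, hr⟩ := hprop i j hc h
    have h2 := (forall_mem_cells_iff B k l (i - k) (j - l)).2 ⟨hr, by
      rw [Nat.sub_add_cancel hk, Nat.sub_add_cancel hl]
      exact (mem_cells.1 hc).2⟩
    rw [Finset.mem_coe, Finset.mem_filter]
    exact ⟨by simpa using h2 0 (by omega) 0 (by omega), h2⟩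
  · rintro ⟨i, j⟩ h ⟨i', j'⟩ h' he
    rw [Finset.mem_coe, Finset.mem_filter] at h h'
    have := hprop i j h.1 h.2
    have := hprop i' j' h'.1 h'.2
    rw [Prod.mk.injEq] at *
    omega

end Greedy

/-- The descent set of the greedy tableau of `B` constrains any tableau of `A` that shares it:
within a rectangle of `A`, each step down leaves one run without descents and each step right leaves
one run of descents. So the bottom right corners, which are distinct, carry entries beyond the last
threshold, and by `size_le_rects_add` there are at most as many such entries as rectangles in `B`.
-/
lemma rects_le_of_tableauComp {A B : SkewShape}
    (h : ∀ U, IsStandard B U → ∃ U', IsStandard A U' ∧ tableauComp A U' = tableauComp B U)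
    (k l : ℕ) : rects A (k + 1) (l + 1) ≤ rects B (k + 1) (l + 1) := by
  obtain ⟨U, hU, hc⟩ := h _ (isStandard_greedyTableau (B := B) (k := k) (l := l))
  have hsize : A.size = B.size := congrArg Sigma.fst hc
  have hdes : tableauDescents A U = tableauDescents B (greedyTableau B k l) := by
    rw [← descentSet_tableauComp, ← descentSet_tableauComp, hc]
  have main : ∀ i j, (∀ a < k + 1, ∀ b < l + 1, (i + a, j + b) ∈ A.cells) →
      greedyThreshold B k l (k + l) ≤ U (i + k) (j + l) := by
    intro i j hr
    -- If a step down stayed inside the run of class `s`, no descent would separate the two entries,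
    -- and the lower box would have to lie weakly above the upper one.
    have s1 : ∀ s ≤ k, greedyThreshold B k l s ≤ U (i + s) j := by
      intro s hs
      induction s with
      | zero => simp [greedyThreshold]
      | succ s ih =>
        have c1 : (i + s, j) ∈ A.cells := hr s (by omega) 0 (by omega)
        have c2 : (i + (s + 1), j) ∈ A.cells := hr (s + 1) (by omega) 0 (by omega)
        have lt := hU.semi.2 _ _ _ (show i + s < i + (s + 1) by omega) c1 c2
        have ih := ih (by omega)
        by_contra hlt
        have := hU.row_le c1 c2 lt.le fun p p1 p2 => by
          rw [hdes]
          simp only at p1 p2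
          exact greedy_not_descent (t := s) (by omega) (by omega) (by omega)
        simp only at this
        omega
    -- If a step right stayed inside the run of class `k + s`, only descents would separate the two
    -- entries, and the boxes could not share a row.
    have s2 : ∀ s ≤ l, greedyThreshold B k l (k + s) ≤ U (i + k) (j + s) := by
      intro s hs
      induction s with
      | zero => exact s1 k le_rfl
      | succ s ih =>
        have c1 : (i + k, j + s) ∈ A.cells := hr k (by omega) s (by omega)
        have c2 : (i + k, j + (s + 1)) ∈ A.cells := hr k (by omega) (s + 1) (by omega)
        have le := hU.semi.1 _ _ _ (show j + s < j + (s + 1) by omega) c1 c2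
        have ne : U (i + k) (j + s) ≠ U (i + k) (j + (s + 1)) := fun e => by
          have := hU.inj c1 c2 e
          simp only [Prod.mk.injEq] at this
          omega
        have ih := ih (by omega)
        by_contra hlt
        have := hU.row_lt c1 c2 (lt_of_le_of_ne le ne) fun p p1 p2 => by
          rw [hdes]
          simp only at p1 p2
          exact greedy_descent (t := k + s) (by omega) (by omega) (by omega)
            (by rw [← Nat.add_assoc] at hlt; omega)
        simp only at this
        omega
    exact s2 l le_rfl
  have h1 : rects A (k + 1) (l + 1) ≤
      (Finset.Ico (greedyThreshold B k l (k + l)) B.size).card := by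
    refine Finset.card_le_card_of_injOn (fun c => U (c.1 + k) (c.2 + l)) ?_ ?_
    · rintro ⟨i, j⟩ hc
      rw [Finset.mem_coe, Finset.mem_filter] at hc
      rw [Finset.mem_coe, Finset.mem_Ico]
      exact ⟨main i j hc.2, hsize ▸ hU.lt (i + k, j + l) (hc.2 k (by omega) l (by omega))⟩
    · rintro ⟨i, j⟩ hc ⟨i', j'⟩ hc' he
      rw [Finset.mem_coe, Finset.mem_filter] at hc hc'
      have := hU.inj (hc.2 k (by omega) l (by omega)) (hc'.2 k (by omega) l (by omega)) he
      rw [Prod.mk.injEq] at *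
      omega
  rw [Nat.card_Ico] at h1
  have h2 := size_le_rects_add (B := B) (k := k) (l := l)
  omega

lemma fSupp_overlaps {A B : SkewShape}
    (h : posSupport fundamentalQ (skewSchur B) ⊆ posSupport fundamentalQ (skewSchur A)) :
    ∀ k, 1 ≤ k → Dominated (rowsPartition A k) (rowsPartition B k) := by
  rw [dominated_rows_iff]
  intro k l hk hl
  obtain ⟨k, rfl⟩ := Nat.exists_eq_add_of_le' hk
  obtain ⟨l, rfl⟩ := Nat.exists_eq_add_of_le' hl
  refine rects_le_of_tableauComp (fun U hU => ?_) k l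
  have h1 : tableauComp B U ∈ posSupport fundamentalQ (skewSchur B) :=
    ((isExpansion_fundamentalCoeff B).mem_posSupport_iff linearIndependent_fundamentalQ _).2
      ((fundamentalCoeff_pos_iff B _).2 ⟨U, hU, rfl⟩)
  exact (fundamentalCoeff_pos_iff A _).1
    (((isExpansion_fundamentalCoeff A).mem_posSupport_iff linearIndependent_fundamentalQ _).1 (h h1))

end SkewQSym

/-! ### Tableaux as chains of row length functions. -/

namespace SkewQSym

/-! ### Chains of row length functions -/

/-- `G` is a chain from `μ` to `lam` in `N` steps with steps in `R` and step sizes `e`, where sizes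
are counted in the first `L` rows. -/
structure IsChain (R : (ℕ → ℕ) → (ℕ → ℕ) → Prop) (L N : ℕ) (e : ℕ → ℤ) (μ lam : ℕ → ℕ)
    (G : ℕ → ℕ → ℕ) : Prop where
  bot : G 0 = μ
  top : ∀ k, N ≤ k → G k = lam
  rel : ∀ k, k < N → R (G k) (G (k + 1))
  weight : ∀ k, k < N →
    (∑ i ∈ Finset.range L, (G (k + 1) i : ℤ)) - ∑ i ∈ Finset.range L, (G k i : ℤ) = e k

/-- The set of chains. -/
def chains (R : (ℕ → ℕ) → (ℕ → ℕ) → Prop) (L N : ℕ) (e : ℕ → ℤ) (μ lam : ℕ → ℕ) :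
    Set (ℕ → ℕ → ℕ) := {G | IsChain R L N e μ lam G}

section Chains

variable {R : (ℕ → ℕ) → (ℕ → ℕ) → Prop} {L N : ℕ} {e : ℕ → ℤ} {μ lam : ℕ → ℕ}
  {G : ℕ → ℕ → ℕ}

lemma IsChain.mono (hR : ∀ α β, R α β → α ≤ β) (h : IsChain R L N e μ lam G) : Monotone G := by
  refine monotone_nat_of_le_succ fun k => ?_
  rcases lt_or_ge k N with hk | hk
  · exact hR _ _ (h.rel k hk)
  · rw [h.top k hk, h.top (k + 1) (by omega)]

lemma IsChain.le_top (hR : ∀ α β, R α β → α ≤ β) (h : IsChain R L N e μ lam G) (k : ℕ) :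
    G k ≤ lam :=
  (h.mono hR (le_max_left k N)).trans (h.top _ (le_max_right k N)).le

lemma IsChain.bot_le (hR : ∀ α β, R α β → α ≤ β) (h : IsChain R L N e μ lam G) (k : ℕ) :
    μ ≤ G k := h.bot.symm.le.trans (h.mono hR (Nat.zero_le k))

lemma finite_le (hlam : ∀ i, L ≤ i → lam i = 0) : {γ : ℕ → ℕ | γ ≤ lam}.Finite := by
  rw [Set.finite_def]
  refine ⟨@Fintype.ofFinite _ ?_⟩
  refine Finite.of_injective (β := (i : Fin L) → Fin (lam i + 1))
    (fun γ i => ⟨γ.1 i, Nat.lt_succ_of_le (γ.2 i)⟩) fun γ γ' h => ?_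
  ext i
  rcases lt_or_ge i L with hi | hi
  · exact congrArg Fin.val (congrFun h ⟨i, hi⟩)
  · have h1 : γ.1 i ≤ lam i := γ.2 i
    have h2 : γ'.1 i ≤ lam i := γ'.2 i
    rw [hlam i hi] at h1 h2
    omega

lemma finite_towers (N : ℕ) (hlam : ∀ i, L ≤ i → lam i = 0) :
    {G : ℕ → ℕ → ℕ | (∀ k, G k ≤ lam) ∧ ∀ k, N ≤ k → G k = lam}.Finite := by
  have : Finite {γ : ℕ → ℕ | γ ≤ lam} := finite_le hlam
  rw [Set.finite_def]
  refine ⟨@Fintype.ofFinite _ ?_⟩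
  refine Finite.of_injective (β := Fin N → {γ : ℕ → ℕ | γ ≤ lam})
    (fun G k => ⟨G.1 k, G.2.1 k⟩) fun G G' h => ?_
  ext k i
  rcases lt_or_ge k N with hk | hk
  · exact congrFun (congrArg Subtype.val (congrFun h ⟨k, hk⟩)) i
  · rw [G.2.2 k hk, G'.2.2 k hk]

lemma finite_chains (hR : ∀ α β, R α β → α ≤ β) (hlam : ∀ i, L ≤ i → lam i = 0) :
    (chains R L N e μ lam).Finite :=
  (finite_towers N hlam).subset fun _ hG => ⟨fun k => IsChain.le_top hR hG k, hG.top⟩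

lemma chains_congr {e' : ℕ → ℤ} (h : ∀ k < N, e k = e' k) :
    chains R L N e μ lam = chains R L N e' μ lam := by
  ext G
  exact ⟨fun hG => ⟨hG.bot, hG.top, hG.rel, fun k hk => (hG.weight k hk).trans (h k hk)⟩,
    fun hG => ⟨hG.bot, hG.top, hG.rel, fun k hk => (hG.weight k hk).trans (h k hk).symm⟩⟩

lemma ncard_chains_zero [Decidable (μ = lam)] :
    (chains R L 0 e μ lam).ncard = if μ = lam then 1 else 0 := by
  split_ifs with h
  · rw [Set.ncard_eq_one]
    refine ⟨fun _ => lam, Set.eq_singleton_iff_unique_mem.2 ⟨?_, ?_⟩⟩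
    · exact ⟨h.symm, fun _ _ => rfl, fun k hk => absurd hk (Nat.not_lt_zero k),
        fun k hk => absurd hk (Nat.not_lt_zero k)⟩
    · exact fun G hG => funext fun k => hG.top k (Nat.zero_le k)
  · have h' : chains R L 0 e μ lam = ∅ :=
      Set.eq_empty_of_forall_notMem fun G hG => h (hG.bot.symm.trans (hG.top 0 le_rfl))
    rw [h', Set.ncard_empty]

open Classical in
/-- Recursion on the last step. -/
lemma ncard_chains_succ (hR : ∀ α β, R α β → α ≤ β) (hlam : ∀ i, L ≤ i → lam i = 0)
    (S : Finset (ℕ → ℕ)) (hS : ∀ γ, R γ lam → γ ∈ S) :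
    (chains R L (N + 1) e μ lam).ncard = ∑ γ ∈ S,
      if R γ lam ∧ (∑ i ∈ Finset.range L, (lam i : ℤ)) - ∑ i ∈ Finset.range L, (γ i : ℤ) = e N
      then (chains R L N e μ γ).ncard else 0 := by
  have hfin := finite_chains (N := N + 1) (e := e) (μ := μ) hR hlam
  rw [Set.ncard_eq_toFinset_card _ hfin,
    Finset.card_eq_sum_card_fiberwise (f := fun G => G N) (t := S)]
  · refine Finset.sum_congr rfl fun γ _ => ?_
    split_ifs with h
    · have hγ : ∀ i, L ≤ i → γ i = 0 := fun i hi =>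
        Nat.le_zero.1 ((hR _ _ h.1 i).trans (hlam i hi).le)
      rw [Set.ncard_eq_toFinset_card _ (finite_chains (N := N) (e := e) (μ := μ) hR hγ)]
      refine Finset.card_nbij' (fun G k => G (min k N)) (fun G k => if k ≤ N then G k else lam)
        ?_ ?_ ?_ ?_
      · intro G hG
        simp only [Finset.coe_filter, Set.Finite.mem_toFinset, Set.mem_ofPred_eq] at hG
        obtain ⟨hG, rfl⟩ := hG
        simp only [Finset.mem_coe, Set.Finite.mem_toFinset]
        refine ⟨by simpa using hG.bot, fun k hk => by simp [hk], fun k hk => ?_, fun k hk => ?_⟩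
        · rw [min_eq_left hk.le, min_eq_left (Nat.succ_le_of_lt hk)]
          exact hG.rel k (by omega)
        · rw [min_eq_left hk.le, min_eq_left (Nat.succ_le_of_lt hk)]
          exact hG.weight k (by omega)
      · intro G hG
        simp only [Finset.mem_coe, Set.Finite.mem_toFinset] at hG
        simp only [Finset.coe_filter, Set.Finite.mem_toFinset, Set.mem_ofPred_eq, le_refl, if_true]
        refine ⟨⟨by simpa using hG.bot, fun k hk => if_neg (by omega), fun k hk => ?_,
          fun k hk => ?_⟩, hG.top N le_rfl⟩
        · rcases Nat.lt_succ_iff_lt_or_eq.1 hk with hk' | rfl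
          · rw [if_pos (by omega), if_pos (by omega)]
            exact hG.rel k hk'
          · rw [if_pos le_rfl, if_neg (by omega), hG.top k le_rfl]
            exact h.1
        · rcases Nat.lt_succ_iff_lt_or_eq.1 hk with hk' | rfl
          · rw [if_pos (by omega), if_pos (by omega)]
            exact hG.weight k hk'
          · rw [if_pos le_rfl, if_neg (by omega), hG.top k le_rfl]
            exact h.2
      · intro G hG
        simp only [Finset.coe_filter, Set.Finite.mem_toFinset, Set.mem_ofPred_eq] at hG
        funext k
        simp only
        split_ifs with hk
        · rw [min_eq_left hk]
        · exact (hG.1.top k (by omega)).symm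
      · intro G hG
        simp only [Finset.mem_coe, Set.Finite.mem_toFinset] at hG
        funext k
        simp only
        rw [if_pos (min_le_right _ _)]
        rcases le_total k N with hk | hk
        · rw [min_eq_left hk]
        · rw [min_eq_right hk, hG.top N le_rfl, hG.top k hk]
    · rw [Finset.card_eq_zero, Finset.filter_eq_empty_iff]
      rintro G hG rfl
      rw [Set.Finite.mem_toFinset] at hG
      refine h ⟨?_, ?_⟩
      · have := hG.rel N (by omega)
        rwa [hG.top (N + 1) le_rfl] at this
      · have := hG.weight N (by omega)
        rwa [hG.top (N + 1) le_rfl] at this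
  · intro G hG
    simp only [Set.Finite.coe_toFinset] at hG
    have := hG.rel N (by omega)
    rw [hG.top (N + 1) le_rfl] at this
    exact hS _ this

end Chains

/-! ### Fillings and chains -/

/-- A predicate closed under passing to the left cuts out an initial segment of the interval, whose
end is found by counting. -/
lemma lt_add_card_filter_iff {a b : ℕ} (p : ℕ → Prop) [DecidablePred p]
    (hp : ∀ j j', a ≤ j → j < j' → j' < b → p j' → p j) {j : ℕ} (hj : a ≤ j) (hj' : j < b) :
    j < a + ((Finset.Ico a b).filter p).card ↔ p j := by
  constructor
  · intro h
    by_contra hn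
    have h1 : (Finset.Ico a b).filter p ⊆ Finset.Ico a j := by
      intro x hx
      rw [Finset.mem_filter, Finset.mem_Ico] at hx
      rw [Finset.mem_Ico]
      refine ⟨hx.1.1, ?_⟩
      by_contra hxj
      rcases (not_lt.1 hxj).eq_or_lt with rfl | h'
      · exact hn hx.2
      · exact hn (hp j x hj h' hx.1.2 hx.2)
    have := Finset.card_le_card h1
    rw [Nat.card_Ico] at this
    omega
  · intro h
    have h1 : Finset.Ico a (j + 1) ⊆ (Finset.Ico a b).filter p := by
      intro x hx
      rw [Finset.mem_Ico] at hx
      rw [Finset.mem_filter, Finset.mem_Ico]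
      refine ⟨⟨hx.1, by omega⟩, ?_⟩
      rcases (Nat.lt_succ_iff.1 hx.2).eq_or_lt with rfl | h'
      · exact h
      · exact hp x j hx.1 h' hj' h
    have := Finset.card_le_card h1
    rw [Nat.card_Ico] at this
    omega

/-- The chain of a filling of the boxes `(i, j)` with `μ i ≤ j < lam i`. -/
def fillingChain (μ lam : ℕ → ℕ) (T : ℕ → ℕ → ℕ) (k i : ℕ) : ℕ :=
  μ i + ((Finset.Ico (μ i) (lam i)).filter fun j => T i j < k).card

/-- The filling of a chain. -/
def chainFilling (N : ℕ) (cells : Finset (ℕ × ℕ)) (G : ℕ → ℕ → ℕ) (i j : ℕ) : ℕ :=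
  if (i, j) ∈ cells then ((Finset.range N).filter fun k => G (k + 1) i ≤ j).card else 0

/-- The chain `G` records the filling `T`. -/
def Compatible (cells : Finset (ℕ × ℕ)) (T G : ℕ → ℕ → ℕ) : Prop :=
  ∀ i j, (i, j) ∈ cells → ∀ k, T i j < k ↔ j < G k i

section Fillings

variable {cells : Finset (ℕ × ℕ)} {μ lam : ℕ → ℕ} {T G : ℕ → ℕ → ℕ} {L N : ℕ}

lemma compatible_fillingChain (hc : ∀ i j, (i, j) ∈ cells ↔ μ i ≤ j ∧ j < lam i)
    (hT : ∀ i j₁ j₂, j₁ < j₂ → (i, j₁) ∈ cells → (i, j₂) ∈ cells → T i j₁ ≤ T i j₂) :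
    Compatible cells T (fillingChain μ lam T) := by
  intro i j h k
  obtain ⟨h1, h2⟩ := (hc i j).1 h
  refine (lt_add_card_filter_iff (fun j => T i j < k) ?_ h1 h2).symm
  intro j j' hj hjj' hj' h
  exact (hT i j j' hjj' ((hc i j).2 ⟨hj, by omega⟩) ((hc i j').2 ⟨by omega, hj'⟩)).trans_lt h

lemma fillingChain_bounds (hμ : μ ≤ lam) (k i : ℕ) :
    μ i ≤ fillingChain μ lam T k i ∧ fillingChain μ lam T k i ≤ lam i := by
  refine ⟨Nat.le_add_right _ _, ?_⟩
  have h := Finset.card_filter_le (Finset.Ico (μ i) (lam i)) fun j => T i j < k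
  rw [Nat.card_Ico] at h
  have : μ i ≤ lam i := hμ i
  unfold fillingChain
  omega

lemma Compatible.chain_unique (hc : ∀ i j, (i, j) ∈ cells ↔ μ i ≤ j ∧ j < lam i)
    {G' : ℕ → ℕ → ℕ} (h : Compatible cells T G) (h' : Compatible cells T G')
    (hb : ∀ k i, μ i ≤ G k i ∧ G k i ≤ lam i) (hb' : ∀ k i, μ i ≤ G' k i ∧ G' k i ≤ lam i) :
    G = G' := by
  have key : ∀ (G G' : ℕ → ℕ → ℕ), Compatible cells T G → Compatible cells T G' →
      (∀ k i, μ i ≤ G k i ∧ G k i ≤ lam i) → (∀ k i, μ i ≤ G' k i ∧ G' k i ≤ lam i) →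
      ∀ k i, G k i ≤ G' k i := by
    intro G G' h h' hb hb' k i
    by_contra hlt
    have h1 := hb k i
    have h2 := hb' k i
    have hmem : (i, G' k i) ∈ cells := (hc _ _).2 ⟨h2.1, by omega⟩
    have := (h i _ hmem k).symm.trans (h' i _ hmem k)
    omega
  funext k i
  exact le_antisymm (key _ _ h h' hb hb' k i) (key _ _ h' h hb' hb k i)

lemma Compatible.filling_unique {T' : ℕ → ℕ → ℕ} (h : Compatible cells T G)
    (h' : Compatible cells T' G) (h0 : ∀ i j, (i, j) ∉ cells → T i j = 0)
    (h0' : ∀ i j, (i, j) ∉ cells → T' i j = 0) : T = T' := by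
  funext i j
  by_cases hc : (i, j) ∈ cells
  · have h1 := fun k => (h i j hc k).trans (h' i j hc k).symm
    have h2 := h1 (T i j)
    have h3 := h1 (T' i j)
    omega
  · rw [h0 i j hc, h0' i j hc]

lemma compatible_chainFilling (hc : ∀ i j, (i, j) ∈ cells ↔ μ i ≤ j ∧ j < lam i)
    (hG : Monotone G) (h0 : G 0 = μ) (hN : G N = lam) :
    Compatible cells (chainFilling N cells G) G := by
  intro i j h k
  obtain ⟨h1, h2⟩ := (hc i j).1 h
  rw [chainFilling, if_pos h]
  have hm : ∀ a b, a ≤ b → G a i ≤ G b i := fun a b hab => hG hab i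
  constructor
  · intro hlt
    by_contra hle
    have hkN : k < N := by
      by_contra hNk
      have := hm N k (by omega)
      rw [hN] at this
      omega
    have hsub : Finset.range k ⊆ (Finset.range N).filter fun k => G (k + 1) i ≤ j := by
      intro x hx
      rw [Finset.mem_range] at hx
      rw [Finset.mem_filter, Finset.mem_range]
      have := hm (x + 1) k (by omega)
      omega
    have := Finset.card_le_card hsub
    rw [Finset.card_range] at this
    omega
  · intro hlt
    have hk : k ≠ 0 := by
      rintro rfl
      rw [h0] at hlt
      omega
    have hsub : (Finset.range N).filter (fun k => G (k + 1) i ≤ j) ⊆ Finset.range (k - 1) := by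
      intro x hx
      rw [Finset.mem_filter] at hx
      rw [Finset.mem_range]
      by_contra hx'
      have := hm k (x + 1) (by omega)
      omega
    have := Finset.card_le_card hsub
    rw [Finset.card_range] at this
    omega

/-- The boxes with entry less than `k` are counted by the chain. -/
lemma Compatible.card_lt (hc : ∀ i j, (i, j) ∈ cells ↔ μ i ≤ j ∧ j < lam i)
    (hL : ∀ i, L ≤ i → lam i = 0) (h : Compatible cells T G)
    (hb : ∀ k i, μ i ≤ G k i ∧ G k i ≤ lam i) (k : ℕ) :
    (partialSum (content cells T) k : ℤ) =
      ∑ i ∈ Finset.range L, (G k i : ℤ) - ∑ i ∈ Finset.range L, (μ i : ℤ) := by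
  rw [partialSum_content, Finset.card_eq_sum_card_fiberwise (f := Prod.fst) (t := Finset.range L),
    ← Finset.sum_sub_distrib, Nat.cast_sum]
  · refine Finset.sum_congr rfl fun i _ => ?_
    rw [← Nat.cast_sub (hb k i).1, ← Nat.card_Ico]
    congr 1
    refine Finset.card_nbij' Prod.snd (fun j => (i, j)) ?_ ?_ ?_ ?_
    · rintro ⟨i', j⟩ h'
      rw [Finset.mem_coe, Finset.mem_filter, Finset.mem_filter] at h'
      obtain ⟨⟨h1, h2⟩, rfl⟩ := h'
      rw [Finset.mem_coe, Finset.mem_Ico]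
      exact ⟨((hc _ _).1 h1).1, (h _ _ h1 k).1 h2⟩
    · intro j hj
      rw [Finset.mem_coe, Finset.mem_Ico] at hj
      have hm : (i, j) ∈ cells := (hc _ _).2 ⟨hj.1, hj.2.trans_le (hb k i).2⟩
      rw [Finset.mem_coe, Finset.mem_filter, Finset.mem_filter]
      exact ⟨⟨hm, (h _ _ hm k).2 hj.2⟩, rfl⟩
    · rintro ⟨i', j⟩ h'
      rw [Finset.mem_coe, Finset.mem_filter] at h'
      rw [← h'.2]
    · exact fun _ _ => rfl
  · rintro ⟨i, j⟩ h'
    rw [Finset.mem_coe, Finset.mem_filter] at h'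
    have := (hc _ _).1 h'.1
    rw [Finset.coe_range, Set.mem_Iio]
    by_contra hi
    rw [hL i (not_lt.1 hi)] at this
    omega

/-- Fillings with weakly increasing rows correspond to chains. -/
lemma fillingSeries_eq_ncard_chains {P : (ℕ → ℕ → ℕ) → Prop} {R : (ℕ → ℕ) → (ℕ → ℕ) → Prop}
    {m : ℕ →₀ ℕ} (hR : ∀ α β, R α β → α ≤ β)
    (hc : ∀ i j, (i, j) ∈ cells ↔ μ i ≤ j ∧ j < lam i) (hμ : μ ≤ lam)
    (hrefl : R lam lam) (hL : ∀ i, L ≤ i → lam i = 0) (hm : ∀ i, N ≤ i → m i = 0)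
    (hrow : ∀ T, P T → ∀ i j₁ j₂, j₁ < j₂ → (i, j₁) ∈ cells → (i, j₂) ∈ cells → T i j₁ ≤ T i j₂)
    (hP : ∀ T G, Compatible cells T G → Monotone G → (∀ k i, μ i ≤ G k i ∧ G k i ≤ lam i) →
      (P T ↔ ∀ k, R (G k) (G (k + 1)))) :
    fillingSeries cells P m = ((chains R L N (fun k => m k) μ lam).ncard : ℚ) := by
  rw [fillingSeries_apply]
  congr 1
  have hmonoC : ∀ T, Monotone (fillingChain μ lam T) := by
    intro T a b hab i
    refine Nat.add_le_add_left (Finset.card_le_card fun j hj => ?_) _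
    rw [Finset.mem_filter] at *
    exact ⟨hj.1, hj.2.trans_le hab⟩
  refine Set.ncard_congr (fun T _ => fillingChain μ lam T) ?_ ?_ ?_
  · rintro T ⟨h0, hT, rfl⟩
    have hcomp := compatible_fillingChain hc (hrow T hT)
    have hb := fun k i => fillingChain_bounds (T := T) hμ k i
    refine ⟨?_, fun k hk => ?_, fun k _ => (hP T _ hcomp (hmonoC T) hb).1 hT k, fun k _ => ?_⟩
    · funext i
      simp [fillingChain]
    · funext i
      rw [fillingChain, Finset.filter_true_of_mem, Nat.card_Ico]
      · have : μ i ≤ lam i := hμ i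
        omega
      · intro j hj
        rw [Finset.mem_Ico] at hj
        -- Every entry lies in the support of `m`, hence below `N`, so the shape is complete from
        -- stage `N` on.
        have h1 := mem_support_of_content rfl ((hc i j).2 hj) (T := T)
        by_contra h2
        exact (Finsupp.mem_support_iff.1 h1) (hm _ (hk.trans (not_lt.1 h2)))
    · have h1 := hcomp.card_lt hc hL hb (k + 1)
      have h2 := hcomp.card_lt hc hL hb k
      rw [partialSum_succ] at h1
      push_cast at h1
      omega
  · rintro T T' ⟨h0, hT, -⟩ ⟨h0', hT', -⟩ h
    have hcomp := compatible_fillingChain hc (hrow T hT)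
    have hcomp' := compatible_fillingChain hc (hrow T' hT')
    rw [← h] at hcomp'
    exact hcomp.filling_unique hcomp' h0 h0'
  · intro G hG
    have hmono := hG.mono hR
    have hb : ∀ k i, μ i ≤ G k i ∧ G k i ≤ lam i := fun k i => ⟨hG.bot_le hR k i, hG.le_top hR k i⟩
    have hcomp := compatible_chainFilling (N := N) hc hmono hG.bot (hG.top N le_rfl)
    have hstep : ∀ k, R (G k) (G (k + 1)) := by
      intro k
      rcases lt_or_ge k N with hk | hk
      · exact hG.rel k hk
      · rw [hG.top k hk, hG.top (k + 1) (by omega)]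
        exact hrefl
    have hT : P (chainFilling N cells G) := (hP _ _ hcomp hmono hb).2 hstep
    refine ⟨chainFilling N cells G, ⟨fun i j h => if_neg h, hT, ?_⟩, ?_⟩
    · ext k
      have h1 := hcomp.card_lt hc hL hb (k + 1)
      have h2 := hcomp.card_lt hc hL hb k
      rw [partialSum_succ] at h1
      push_cast at h1
      rcases lt_or_ge k N with hk | hk
      · have := hG.weight k hk
        omega
      · rw [hG.top k hk] at h2
        rw [hG.top (k + 1) (by omega)] at h1
        have := hm k hk
        omega
    · exact Compatible.chain_unique hc (compatible_fillingChain hc (hrow _ hT)) hcomp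
        (fun k i => fillingChain_bounds hμ k i) hb

end Fillings


/-! ### Semistandard and immaculate tableaux as chains -/

/-- Horizontal strips. -/
def Strip (α β : ℕ → ℕ) : Prop := α ≤ β ∧ ∀ i, β (i + 1) ≤ α i

/-- Steps of immaculate tableaux: rows grow, and a row is nonempty after the step only if all
higher rows were nonempty before. -/
def ImmaculateStep (α β : ℕ → ℕ) : Prop := α ≤ β ∧ ∀ i j, i < j → 0 < β j → 0 < α i

lemma Strip.le {α β : ℕ → ℕ} (h : Strip α β) : α ≤ β := h.1

lemma ImmaculateStep.le {α β : ℕ → ℕ} (h : ImmaculateStep α β) : α ≤ β := h.1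

lemma SkewShape.rowLen_le (A : SkewShape) : A.inner.rowLen ≤ A.outer.rowLen := by
  intro i
  by_contra h
  exact lt_irrefl _ (YoungDiagram.mem_iff_lt_rowLen.1
    (A.le (YoungDiagram.mem_iff_lt_rowLen.2 (not_le.1 h))))

/-- Strict columns mean that a box with entry at most `k` has an entry less than `k` directly above
it, which is the second condition of `Strip` for the stages `k` and `k + 1`. Comparisons of
non-adjacent rows follow by induction through the intermediate boxes. -/
lemma skewSchur_eq_ncard_chains (A : SkewShape) {L N : ℕ} {m : ℕ →₀ ℕ}
    (hL : ∀ i, L ≤ i → A.outer.rowLen i = 0) (hm : ∀ i, N ≤ i → m i = 0) :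
    skewSchur A m =
      ((chains Strip L N (fun k => m k) A.inner.rowLen A.outer.rowLen).ncard : ℚ) := by
  refine fillingSeries_eq_ncard_chains (fun _ _ h => h.le) (fun i j => mem_cells) A.rowLen_le
    ⟨le_rfl, fun i => A.outer.rowLen_anti _ _ (Nat.le_succ i)⟩ hL hm (fun T hT => hT.1) ?_
  intro T G hcomp hmono hb
  constructor
  · intro hT k
    refine ⟨hmono (Nat.le_succ k), fun i => ?_⟩
    by_contra hlt
    have hb1 := hb k i
    have hb2 := hb (k + 1) (i + 1)
    have a1 := A.outer.rowLen_anti i (i + 1) (Nat.le_succ i)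
    have a2 := A.inner.rowLen_anti i (i + 1) (Nat.le_succ i)
    have c1 : (i, G k i) ∈ A.cells := mem_cells.2 (by omega)
    have c2 : (i + 1, G k i) ∈ A.cells := mem_cells.2 (by omega)
    have h1 := hT.2 _ _ _ (Nat.lt_succ_self i) c1 c2
    have h2 := hcomp _ _ c1 k
    have h3 := hcomp _ _ c2 (k + 1)
    simp only [Nat.succ_eq_add_one] at h1
    omega
  · intro hR
    refine ⟨fun i j₁ j₂ hj h h' => ?_, fun i₁ i₂ j hi h h' => ?_⟩
    · have h0 := hcomp _ _ h (T i j₂ + 1)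
      have h2 := hcomp _ _ h' (T i j₂ + 1)
      omega
    · induction i₂, Nat.succ_le_of_lt hi using Nat.le_induction with
      | base =>
        have h1 := hcomp _ _ h (T (i₁ + 1) j)
        have h2 := hcomp _ _ h' (T (i₁ + 1) j + 1)
        have h3 := (hR (T (i₁ + 1) j)).2 i₁
        simp only [Nat.succ_eq_add_one] at *
        omega
      | succ n hn ih =>
        have c : (n, j) ∈ A.cells := mem_cells_of_between h h' (by omega) (by omega) le_rfl le_rfl
        have h0 := ih (by omega) c
        have h1 := hcomp _ _ c (T (n + 1) j)
        have h2 := hcomp _ _ h' (T (n + 1) j + 1)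
        have h3 := (hR (T (n + 1) j)).2 n
        omega

/-- Row lengths of the diagram of a composition. -/
def compRow (α : Comp) (i : ℕ) : ℕ := α.2.blocks.getD i 0

lemma compRow_pos {α : Comp} {i : ℕ} : 0 < compRow α i ↔ i < α.2.length := by
  rw [compRow, ← Composition.blocks_length]
  constructor
  · intro h
    by_contra h'
    rw [List.getD_eq_default _ _ (not_lt.1 h')] at h
    exact lt_irrefl _ h
  · intro h
    rw [List.getD_eq_getElem _ _ h]
    exact α.2.blocks_pos (List.getElem_mem h)

lemma compRow_le (α : Comp) (i : ℕ) : compRow α i ≤ α.1 := by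
  rw [compRow]
  rcases lt_or_ge i α.2.blocks.length with h | h
  · rw [List.getD_eq_getElem _ _ h]
    exact α.2.blocks_le (List.getElem_mem h)
  · rw [List.getD_eq_default _ _ h]
    exact Nat.zero_le _

lemma mem_compCells {α : Comp} {i j : ℕ} : (i, j) ∈ compCells α ↔ j < compRow α i := by
  rw [compCells, Finset.mem_filter, Finset.mem_product, Finset.mem_range, Finset.mem_range]
  change (_ ∧ _) ∧ j < compRow α i ↔ _
  refine ⟨fun h => h.2, fun h => ⟨⟨compRow_pos.1 (Nat.zero_lt_of_lt h), ?_⟩, h⟩⟩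
  exact h.trans_le (compRow_le α i)

/-- Only the first box of each row is subject to a column condition: when row `j` starts with an
entry at most `k`, every higher row must have started with a smaller one, that is, must be nonempty
at stage `k`. -/
lemma dualImmaculate_eq_ncard_chains (α : Comp) {L N : ℕ} {m : ℕ →₀ ℕ}
    (hL : α.2.length ≤ L) (hm : ∀ i, N ≤ i → m i = 0) :
    dualImmaculate α m =
      ((chains ImmaculateStep L N (fun k => m k) 0 (compRow α)).ncard : ℚ) := by
  refine fillingSeries_eq_ncard_chains (fun _ _ h => h.le)
    (fun i j => mem_compCells.trans (by simp)) (fun i => Nat.zero_le _) ⟨le_rfl, ?_⟩ ?_ hm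
    (fun T hT => hT.1) ?_
  · intro i j hij hj
    rw [compRow_pos] at *
    omega
  · intro i hi
    by_contra h
    have := compRow_pos.1 (Nat.pos_of_ne_zero h)
    omega
  intro T G hcomp hmono hb
  constructor
  · intro hT k
    refine ⟨hmono (Nat.le_succ k), fun i j hij hj => ?_⟩
    have hb2 := hb (k + 1) j
    have p2 : 0 < compRow α j := by omega
    have p1 : 0 < compRow α i := compRow_pos.2 (hij.trans (compRow_pos.1 p2))
    have h1 := hT.2 i j hij (mem_compCells.2 p1) (mem_compCells.2 p2)
    have h2 := hcomp _ _ (mem_compCells.2 p1) k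
    have h3 := hcomp _ _ (mem_compCells.2 p2) (k + 1)
    omega
  · intro hR
    refine ⟨fun i j₁ j₂ hj h h' => ?_, fun i₁ i₂ hi h h' => ?_⟩
    · have h1 := hcomp _ _ h (T i j₂ + 1)
      have h2 := hcomp _ _ h' (T i j₂ + 1)
      omega
    · have h1 := hcomp _ _ h (T i₂ 0)
      have h2 := hcomp _ _ h' (T i₂ 0 + 1)
      have h3 := (hR (T i₂ 0)).2 i₁ i₂ hi
      omega

end SkewQSym

/-! ### Bender–Knuth moves, their restriction to initial columns, and symmetry. -/

namespace SkewQSym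

/-! ### Bender–Knuth moves on interlacing row functions -/

/-- The largest `γ` between `α` and `β` (for horizontal strips). -/
def stripMax (α β : ℕ → ℕ) : ℕ → ℕ
  | 0 => β 0
  | i + 1 => min (β (i + 1)) (α i)

/-- The smallest `γ` between `α` and `β` (for horizontal strips). -/
def stripMin (α β : ℕ → ℕ) (i : ℕ) : ℕ := max (α i) (β (i + 1))

/-- The interlacing conditions on `γ` decouple into one interval per row, with ends depending only
on `α` and `β`. Reflecting every interval is therefore an involution on the admissible `γ`. -/
lemma strips_iff {α γ β : ℕ → ℕ} :
    Strip α γ ∧ Strip γ β ↔ ∀ i, stripMin α β i ≤ γ i ∧ γ i ≤ stripMax α β i := by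
  constructor
  · rintro ⟨⟨h1, h2⟩, ⟨h3, h4⟩⟩ i
    refine ⟨max_le (h1 i) (h4 i), ?_⟩
    cases i with
    | zero => exact h3 0
    | succ i => exact le_min (h3 _) (h2 _)
  · intro h
    refine ⟨⟨fun i => (le_max_left _ _).trans (h i).1, fun i => ?_⟩,
      ⟨fun i => ?_, fun i => (le_max_right _ _).trans (h i).1⟩⟩
    · exact (h (i + 1)).2.trans (min_le_right _ _)
    · cases i with
      | zero => exact (h 0).2
      | succ i => exact (h (i + 1)).2.trans (min_le_left _ _)

/-- The Bender–Knuth move. -/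
def benderKnuth (α γ β : ℕ → ℕ) (i : ℕ) : ℕ := stripMin α β i + stripMax α β i - γ i

/-- The size of the first `L` rows. -/
def rowSum (L : ℕ) (γ : ℕ → ℕ) : ℤ := ∑ i ∈ Finset.range L, (γ i : ℤ)

/-- The number of boxes in the first `L` rows and in columns `≥ h`. -/
def excess (L h : ℕ) (γ : ℕ → ℕ) : ℤ := ∑ i ∈ Finset.range L, ((γ i - h : ℕ) : ℤ)

section Moves

variable {α γ β : ℕ → ℕ} {L h : ℕ}

lemma benderKnuth_bounds (h : Strip α γ ∧ Strip γ β) :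
    Strip α (benderKnuth α γ β) ∧ Strip (benderKnuth α γ β) β := by
  rw [strips_iff] at *
  intro i
  have := h i
  unfold benderKnuth
  omega

lemma benderKnuth_involutive (h : Strip α γ ∧ Strip γ β) :
    benderKnuth α (benderKnuth α γ β) β = γ := by
  rw [strips_iff] at h
  funext i
  have := h i
  unfold benderKnuth
  omega

/-- The lower end in row `i` and the upper end in row `i + 1` are the maximum and the minimum of the
same two numbers, `α i` and `β (i + 1)`; so the sum telescopes. -/
lemma sum_stripMin_add_stripMax (α β : ℕ → ℕ) (n : ℕ) :
    (∑ i ∈ Finset.range n, (stripMin α β i + stripMax α β i)) + stripMax α β n =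
      (∑ i ∈ Finset.range n, α i) + ∑ i ∈ Finset.range (n + 1), β i := by
  induction n with
  | zero => simp [stripMax]
  | succ n ih =>
    rw [Finset.sum_range_succ, Finset.sum_range_succ α, Finset.sum_range_succ β]
    have : stripMin α β n + stripMax α β (n + 1) = α n + β (n + 1) := by
      simp only [stripMin, stripMax]
      omega
    omega

/-- Reflection exchanges the sizes of the two strips. The row `L` must be empty for the boundary
term of `sum_stripMin_add_stripMax` to vanish. -/
lemma rowSum_benderKnuth (h : Strip α γ ∧ Strip γ β) (hβ : β L = 0) :
    rowSum L (benderKnuth α γ β) = rowSum L α + rowSum L β - rowSum L γ := by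
  rw [strips_iff] at h
  have h1 := sum_stripMin_add_stripMax α β L
  have h2 : stripMax α β L = 0 := by
    cases L with
    | zero => exact hβ
    | succ n => simp [stripMax, hβ]
  rw [h2, Finset.sum_range_succ, hβ, add_zero, add_zero] at h1
  have h3 : rowSum L (benderKnuth α γ β) + rowSum L γ =
      ((∑ i ∈ Finset.range L, (stripMin α β i + stripMax α β i) : ℕ) : ℤ) := by
    rw [rowSum, rowSum, ← Finset.sum_add_distrib, Nat.cast_sum]
    refine Finset.sum_congr rfl fun i _ => ?_
    have := h i
    unfold benderKnuth
    omega
  rw [h1] at h3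
  push_cast at h3
  simp only [rowSum] at *
  omega

/-- The Bender–Knuth move restricted to the columns `< h`. -/
def cutMove (h : ℕ) (α γ β : ℕ → ℕ) (i : ℕ) : ℕ :=
  if γ i ≤ h then stripMin α β i + min (stripMax α β i) h - γ i else γ i

lemma cutMove_bounds (hs : Strip α γ ∧ Strip γ β) :
    Strip α (cutMove h α γ β) ∧ Strip (cutMove h α γ β) β := by
  rw [strips_iff] at *
  intro i
  have := hs i
  unfold cutMove
  split_ifs <;> omega

lemma cutMove_le_iff (hs : Strip α γ ∧ Strip γ β) (i : ℕ) : cutMove h α γ β i ≤ h ↔ γ i ≤ h := by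
  rw [strips_iff] at hs
  have := hs i
  unfold cutMove
  split_ifs <;> omega

lemma cutMove_involutive (hs : Strip α γ ∧ Strip γ β) :
    cutMove h α (cutMove h α γ β) β = γ := by
  funext i
  have h1 := cutMove_le_iff (h := h) hs i
  rw [strips_iff] at hs
  have := hs i
  rw [cutMove]
  split_ifs with h2
  · rw [h1] at h2
    rw [cutMove, if_pos h2]
    omega
  · rw [h1] at h2
    rw [cutMove, if_neg h2]

/-- A row either stays within the columns left of `h` before and after the move, or is not moved at
all; so nothing changes in the columns from `h` on. -/
lemma excess_cutMove (hs : Strip α γ ∧ Strip γ β) {h' : ℕ} (hh : h ≤ h') :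
    excess L h' (cutMove h α γ β) = excess L h' γ := by
  refine Finset.sum_congr rfl fun i _ => ?_
  have h1 := cutMove_le_iff (h := h) hs i
  by_cases h2 : γ i ≤ h
  · have := h1.2 h2
    congr 1
    omega
  · rw [cutMove, if_neg h2]

lemma strip_truncate (hs : Strip α γ) : Strip (fun i => min (α i) h) fun i => min (γ i) h :=
  ⟨fun i => min_le_min_right _ (hs.1 i), fun i => min_le_min_right _ (hs.2 i)⟩

lemma stripMin_truncate (i : ℕ) :
    stripMin (fun i => min (α i) h) (fun i => min (β i) h) i = min (stripMin α β i) h :=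
  (min_max_distrib_right _ _ _).symm

lemma stripMax_truncate (i : ℕ) :
    stripMax (fun i => min (α i) h) (fun i => min (β i) h) i = min (stripMax α β i) h := by
  cases i with
  | zero => rfl
  | succ i => exact (inf_inf_distrib_right _ _ _).symm

lemma rowSum_truncate (γ : ℕ → ℕ) :
    rowSum L (fun i => min (γ i) h) = rowSum L γ - excess L h γ := by
  rw [rowSum, rowSum, excess, ← Finset.sum_sub_distrib]
  refine Finset.sum_congr rfl fun i _ => ?_
  omega

/-- In columns left of `h` this is an ordinary Bender–Knuth move of the truncated shapes: by `hcol`,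
a row of `γ` longer than `h` has a truncated interval reduced to the point `h`. The columns from `h`
on do not take part, and their imbalance of exactly one box, `hex`, is the correction `-1`. -/
lemma rowSum_cutMove (hs : Strip α γ ∧ Strip γ β) (hβ : β L = 0)
    (hcol : ∀ i, h < γ i → h < α i)
    (hex : excess L h α + excess L h β = 2 * excess L h γ + 1) :
    rowSum L (cutMove h α γ β) = rowSum L α + rowSum L β - rowSum L γ - 1 := by
  have hs' : Strip (fun i => min (α i) h) (fun i => min (γ i) h) ∧
      Strip (fun i => min (γ i) h) (fun i => min (β i) h) :=
    ⟨strip_truncate hs.1, strip_truncate hs.2⟩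
  have h1 := rowSum_benderKnuth (L := L) hs' (by simp [hβ])
  have h2 : rowSum L (cutMove h α γ β) = rowSum L (benderKnuth (fun i => min (α i) h)
      (fun i => min (γ i) h) (fun i => min (β i) h)) + excess L h γ := by
    rw [rowSum, rowSum, excess, ← Finset.sum_add_distrib]
    refine Finset.sum_congr rfl fun i _ => ?_
    have h3 := strips_iff.1 hs i
    have h4 : h < γ i → h < stripMin α β i := fun h4 => lt_max_of_lt_left (hcol i h4)
    rw [cutMove, benderKnuth, stripMin_truncate, stripMax_truncate]
    split_ifs <;> omega
  rw [h2, h1, rowSum_truncate, rowSum_truncate, rowSum_truncate]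
  omega

/-- The length of column `h`. -/
def columnCount (L h : ℕ) (γ : ℕ → ℕ) : ℕ := ((Finset.range L).filter fun i => h < γ i).card

lemma excess_succ (γ : ℕ → ℕ) : excess L h γ = excess L (h + 1) γ + columnCount L h γ := by
  rw [excess, excess, columnCount, Finset.card_filter, Nat.cast_sum, ← Finset.sum_add_distrib]
  refine Finset.sum_congr rfl fun i _ => ?_
  split_ifs <;> omega

lemma columnCount_mono (hs : α ≤ γ) : columnCount L h α ≤ columnCount L h γ := by
  refine Finset.card_le_card fun i hi => ?_
  rw [Finset.mem_filter] at *
  exact ⟨hi.1, hi.2.trans_le (hs i)⟩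

/-- Each box of `β` in column `h` below the first row lies under a box of `γ`. -/
lemma columnCount_le_succ (hs : Strip γ β) : columnCount L h β ≤ columnCount L h γ + 1 := by
  have h1 : (Finset.range L).filter (fun i => h < β i) ⊆
      insert 0 (((Finset.range L).filter fun i => h < γ i).image (· + 1)) := by
    intro i hi
    rw [Finset.mem_filter, Finset.mem_range] at hi
    cases i with
    | zero => exact Finset.mem_insert_self _ _
    | succ i =>
      refine Finset.mem_insert_of_mem (Finset.mem_image.2 ⟨i, ?_, rfl⟩)
      rw [Finset.mem_filter, Finset.mem_range]
      exact ⟨by omega, hi.2.trans_le (hs.2 i)⟩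
  exact (Finset.card_le_card h1).trans ((Finset.card_insert_le _ _).trans
    (Nat.add_le_add_right Finset.card_image_le 1))

/-- Passing from `h + 1` to `h` changes the defect of concavity by the column lengths of `α` and `β`
minus twice that of `γ`, which is at most 1 for two horizontal strips. A defect that turns from
nonpositive to positive thus equals 1, and forces `α` and `γ` to have the same column `h`. -/
lemma critical_cut (hs : Strip α γ ∧ Strip γ β) (hγ : ∀ i, L ≤ i → γ i = 0)
    (h1 : 2 * excess L h γ < excess L h α + excess L h β)
    (h2 : excess L (h + 1) α + excess L (h + 1) β ≤ 2 * excess L (h + 1) γ) :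
    (∀ i, h < γ i → h < α i) ∧ excess L h α + excess L h β = 2 * excess L h γ + 1 := by
  have c1 := columnCount_mono (L := L) (h := h) hs.1.1
  have c2 := columnCount_le_succ (L := L) (h := h) hs.2
  have e1 := excess_succ (L := L) (h := h) α
  have e2 := excess_succ (L := L) (h := h) β
  have e3 := excess_succ (L := L) (h := h) γ
  refine ⟨fun i hi => ?_, by omega⟩
  have h3 : (Finset.range L).filter (fun i => h < α i) =
      (Finset.range L).filter (fun i => h < γ i) := by
    apply Finset.eq_of_subset_of_card_le
    · intro j hj
      rw [Finset.mem_filter] at *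
      exact ⟨hj.1, hj.2.trans_le (hs.1.1 j)⟩
    · change columnCount L h γ ≤ columnCount L h α
      omega
  have h4 : i ∈ (Finset.range L).filter (fun i => h < γ i) := by
    rw [Finset.mem_filter, Finset.mem_range]
    refine ⟨?_, hi⟩
    by_contra h'
    rw [hγ i (not_lt.1 h')] at hi
    omega
  rw [← h3] at h4
  exact (Finset.mem_filter.1 h4).2

end Moves

/-! ### Towers of horizontal strips -/

/-- A tower of `N` horizontal strips from `μ` to `lam`. -/
structure IsTower (N : ℕ) (μ lam : ℕ → ℕ) (G : ℕ → ℕ → ℕ) : Prop where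
  bot : G 0 = μ
  top : ∀ k, N ≤ k → G k = lam
  rel : ∀ k, k < N → Strip (G k) (G (k + 1))

section Towers

variable {L N : ℕ} {μ lam : ℕ → ℕ} {G : ℕ → ℕ → ℕ} {e : ℕ → ℤ}

/-- The size of the `k`-th strip of a tower. -/
def towerWeight (L : ℕ) (G : ℕ → ℕ → ℕ) (k : ℕ) : ℤ := rowSum L (G (k + 1)) - rowSum L (G k)

lemma isChain_strip_iff :
    IsChain Strip L N e μ lam G ↔ IsTower N μ lam G ∧ ∀ k < N, towerWeight L G k = e k :=
  ⟨fun h => ⟨⟨h.bot, h.top, h.rel⟩, h.weight⟩, fun h => ⟨h.1.bot, h.1.top, h.1.rel, h.2⟩⟩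

lemma IsTower.isChain (h : IsTower N μ lam G) :
    IsChain Strip L N (towerWeight L G) μ lam G := isChain_strip_iff.2 ⟨h, fun _ _ => rfl⟩

lemma IsTower.le_top (h : IsTower N μ lam G) (k : ℕ) : G k ≤ lam :=
  (h.isChain (L := 0)).le_top (fun _ _ h => h.le) k

lemma finite_isTower (hlam : ∀ i, L ≤ i → lam i = 0) : {G | IsTower N μ lam G}.Finite :=
  (finite_towers N hlam).subset fun _ hG => ⟨hG.le_top, hG.top⟩

lemma IsTower.update (h : IsTower N μ lam G) {k : ℕ} (hk : k + 1 < N) {γ : ℕ → ℕ}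
    (hγ : Strip (G k) γ ∧ Strip γ (G (k + 2))) :
    IsTower N μ lam (Function.update G (k + 1) γ) where
  bot := by rw [Function.update_of_ne (by omega), h.bot]
  top j hj := by rw [Function.update_of_ne (by omega), h.top j hj]
  rel j hj := by
    by_cases h1 : j = k + 1
    · subst h1
      rw [Function.update_self, Function.update_of_ne (by omega)]
      exact hγ.2
    · rw [Function.update_of_ne h1]
      by_cases h2 : j = k
      · subst h2
        rw [Function.update_self]
        exact hγ.1
      · rw [Function.update_of_ne (by omega)]
        exact h.rel j hj

lemma IsTower.strips (h : IsTower N μ lam G) {k : ℕ} (hk : k + 1 < N) :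
    Strip (G k) (G (k + 1)) ∧ Strip (G (k + 1)) (G (k + 2)) :=
  ⟨h.rel k (by omega), h.rel (k + 1) hk⟩

lemma towerWeight_update (k : ℕ) (γ : ℕ → ℕ) (j : ℕ) :
    towerWeight L (Function.update G (k + 1) γ) j =
      if j = k then rowSum L γ - rowSum L (G k)
      else if j = k + 1 then rowSum L (G (k + 2)) - rowSum L γ else towerWeight L G j := by
  unfold towerWeight
  split_ifs with h1 h2
  · subst h1
    rw [Function.update_self, Function.update_of_ne (by omega)]
  · subst h2
    rw [Function.update_self, Function.update_of_ne (by omega)]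
  · rw [Function.update_of_ne (by omega), Function.update_of_ne (by omega)]

/-- The number of chains does not change if two adjacent step sizes are exchanged. -/
lemma ncard_chains_swap_le (hlam : ∀ i, L ≤ i → lam i = 0) {k : ℕ} (hk : k + 1 < N) :
    (chains Strip L N e μ lam).ncard ≤
      (chains Strip L N (e ∘ Equiv.swap k (k + 1)) μ lam).ncard := by
  refine Set.ncard_le_ncard_of_injOn
    (fun G => Function.update G (k + 1) (benderKnuth (G k) (G (k + 1)) (G (k + 2)))) ?_ ?_
    (finite_chains (fun _ _ h => h.le) hlam)
  · intro G hG
    obtain ⟨hT, hw⟩ := isChain_strip_iff.1 hG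
    refine isChain_strip_iff.2 ⟨hT.update hk (benderKnuth_bounds (hT.strips hk)), fun j hj => ?_⟩
    have h1 := rowSum_benderKnuth (L := L) (hT.strips hk)
      (Nat.le_zero.1 ((hT.le_top (k + 2) L).trans (hlam L le_rfl).le))
    have h2 := hw k (by omega)
    have h3 := hw (k + 1) hk
    rw [towerWeight_update, Function.comp_apply]
    unfold towerWeight at h2 h3
    split_ifs with h4 h5
    · rw [h4, Equiv.swap_apply_left, ← h3, h1]
      ring
    · rw [h5, Equiv.swap_apply_right, ← h2, h1]
      ring
    · rw [Equiv.swap_apply_of_ne_of_ne h4 h5, hw j hj]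
  · intro G hG G' hG' hGG
    -- The old chain is the result of a second move, computed from the new chain alone; this gives
    -- injectivity.
    have key : ∀ G ∈ chains Strip L N e μ lam, ∀ j, G j =
        (Function.update (Function.update G (k + 1) (benderKnuth (G k) (G (k + 1)) (G (k + 2))))
          (k + 1) (benderKnuth
          (Function.update G (k + 1) (benderKnuth (G k) (G (k + 1)) (G (k + 2))) k)
          (Function.update G (k + 1) (benderKnuth (G k) (G (k + 1)) (G (k + 2))) (k + 1))
          (Function.update G (k + 1) (benderKnuth (G k) (G (k + 1)) (G (k + 2))) (k + 2)))) j := by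
      intro G hG j
      have hT := (isChain_strip_iff.1 hG).1
      rw [Function.update_of_ne (show k ≠ k + 1 by omega), Function.update_self,
        Function.update_of_ne (show k + 2 ≠ k + 1 by omega), benderKnuth_involutive (hT.strips hk),
        Function.update_idem, Function.update_eq_self]
    funext j
    simp only at hGG
    rw [key G hG j, key G' hG' j, hGG]

lemma ncard_chains_swap (hlam : ∀ i, L ≤ i → lam i = 0) {k : ℕ} (hk : k + 1 < N) :
    (chains Strip L N (e ∘ Equiv.swap k (k + 1)) μ lam).ncard =
      (chains Strip L N e μ lam).ncard := by
  refine le_antisymm ?_ (ncard_chains_swap_le hlam hk)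
  have h := ncard_chains_swap_le (e := e ∘ Equiv.swap k (k + 1)) (μ := μ) hlam hk
  rwa [Function.comp_assoc, ← Equiv.coe_trans, Equiv.swap_swap] at h

end Towers

/-! ### Symmetry of skew Schur functions -/

lemma YoungDiagram_rowLen_eq_zero (μ : YoungDiagram) {i : ℕ} (hi : μ.colLen 0 ≤ i) :
    μ.rowLen i = 0 := by
  by_contra h
  have := YoungDiagram.mem_iff_lt_colLen.1
    (YoungDiagram.mem_iff_lt_rowLen.2 (Nat.pos_of_ne_zero h))
  omega

lemma skewSchur_wordContent (A : SkewShape) (l : List ℕ) :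
    skewSchur A (wordContent l) = ((chains Strip (A.outer.colLen 0) l.length
      (fun k => (l.getD k 0 : ℕ)) A.inner.rowLen A.outer.rowLen).ncard : ℚ) := by
  exact skewSchur_eq_ncard_chains A (fun i hi => YoungDiagram_rowLen_eq_zero _ hi)
    fun i hi => List.getD_eq_default _ _ hi

lemma skewSchur_wordContent_swap (A : SkewShape) (p l : List ℕ) (a b : ℕ) :
    skewSchur A (wordContent (p ++ a :: b :: l)) = skewSchur A (wordContent (p ++ b :: a :: l)) := by
  rw [skewSchur_wordContent, skewSchur_wordContent,
    ← ncard_chains_swap (e := fun k => ((p ++ a :: b :: l).getD k 0 : ℕ)) (k := p.length)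
      (fun i hi => YoungDiagram_rowLen_eq_zero _ hi) (by simp)]
  have h1 : (p ++ a :: b :: l).length = (p ++ b :: a :: l).length := by simp
  rw [h1]
  congr 2
  refine chains_congr fun k _ => ?_
  rw [Function.comp_apply]
  rcases lt_or_ge k p.length with hk | hk
  · rw [Equiv.swap_apply_of_ne_of_ne (by omega) (by omega), List.getD_append _ _ _ _ hk,
      List.getD_append _ _ _ _ hk]
  · obtain ⟨j, rfl⟩ := Nat.exists_eq_add_of_le hk
    match j with
    | 0 =>
      simp only [Nat.add_zero]
      rw [Equiv.swap_apply_left, List.getD_append_right _ _ _ _ (by omega),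
        List.getD_append_right _ _ _ _ (by omega)]
      simp
    | 1 =>
      rw [Equiv.swap_apply_right, List.getD_append_right _ _ _ _ (by omega),
        List.getD_append_right _ _ _ _ (by omega)]
      simp
    | j + 2 =>
      rw [Equiv.swap_apply_of_ne_of_ne (by omega) (by omega),
        List.getD_append_right _ _ _ _ (by omega), List.getD_append_right _ _ _ _ (by omega)]
      simp [show p.length + (j + 2) - p.length = j + 2 by omega]

/-- The prefix `p` is quantified so that in the induction on permutations a common head can be
absorbed into it. -/
lemma skewSchur_wordContent_perm (A : SkewShape) {l l' : List ℕ} (h : l.Perm l') :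
    ∀ p, skewSchur A (wordContent (p ++ l)) = skewSchur A (wordContent (p ++ l')) := by
  induction h with
  | nil => exact fun _ => rfl
  | cons x _ ih =>
    intro p
    simpa using ih (p ++ [x])
  | swap x y l => exact fun p => skewSchur_wordContent_swap A p l y x
  | trans _ _ ih1 ih2 => exact fun p => (ih1 p).trans (ih2 p)

lemma exponents_equivMapDomain_perm (σ : Equiv.Perm ℕ) (m : ℕ →₀ ℕ) :
    (exponents (m.equivMapDomain σ)).Perm (exponents m) := by
  rw [← Multiset.coe_eq_coe, exponents, exponents, ← Multiset.map_coe, ← Multiset.map_coe,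
    Finset.sort_eq, Finset.sort_eq]
  have h : (m.equivMapDomain σ).support = m.support.map σ.toEmbedding := rfl
  rw [h, Finset.map_val, Multiset.map_map]
  refine Multiset.map_congr rfl fun i _ => ?_
  simp [Finsupp.equivMapDomain_apply]

lemma isSymmetricFunction_skewSchur (A : SkewShape) : IsSymmetricFunction (skewSchur A) := by
  refine ⟨⟨A.size, fun m hm => skewSchur_eq_zero_of_degree A hm.ne'⟩, fun σ m => ?_⟩
  have key : ∀ m, skewSchur A m = skewSchur A (wordContent ([] ++ exponents m)) := fun m =>
    skewSchur_eq_of_exponents A (exponents_wordContent _ fun _ hx => exponents_pos m hx).symm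
  change skewSchur A (m.equivMapDomain σ) = skewSchur A m
  rw [key, key m]
  exact skewSchur_wordContent_perm A (exponents_equivMapDomain_perm σ m) []

end SkewQSym

/-! ### Schur coefficients by a sign-reversing involution on towers. -/

namespace SkewQSym

/-! ### Alternating sums over towers -/

lemma perm_eq_one_of_strictMono {N : ℕ} {w : Equiv.Perm (Fin N)} (h : StrictMono w) : w = 1 := by
  have h1 : (h.orderIsoOfSurjective w w.surjective : Fin N ≃o Fin N) =
      OrderIso.refl _ := Subsingleton.elim _ _
  ext i
  exact congrArg (fun f : Fin N ≃o Fin N => (f i : ℕ)) h1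

/-- The alternating sum of the indicators of `t = x ∘ w`. -/
def signedCount {N : ℕ} (x t : Fin N → ℤ) : ℚ :=
  ∑ w : Equiv.Perm (Fin N), if ∀ k, t k = x (w k) then ((Equiv.Perm.sign w : ℤ) : ℚ) else 0

lemma signedCount_comp_swap {N : ℕ} (x t : Fin N → ℤ) {a b : Fin N} (hab : a ≠ b) :
    signedCount x (t ∘ Equiv.swap a b) = - signedCount x t := by
  rw [signedCount, signedCount, ← Finset.sum_neg_distrib]
  refine Fintype.sum_equiv (Equiv.mulRight (Equiv.swap a b)) _ _ fun w => ?_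
  have h1 : (∀ k, (t ∘ Equiv.swap a b) k = x (w k)) ↔
      ∀ k, t k = x ((w * Equiv.swap a b) k) := by
    constructor
    · intro h k
      have := h (Equiv.swap a b k)
      rwa [Function.comp_apply, Equiv.swap_apply_self] at this
    · intro h k
      have := h (Equiv.swap a b k)
      rwa [Equiv.Perm.mul_apply, Equiv.swap_apply_self] at this
  rw [Equiv.coe_mulRight]
  simp only [h1]
  split_ifs
  · rw [Equiv.Perm.sign_mul, Equiv.Perm.sign_swap hab]
    simp
  · simp

/-- A permutation relating two strictly decreasing sequences is monotone, hence the identity. -/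
lemma signedCount_of_strictAnti {N : ℕ} {x t : Fin N → ℤ} (hx : StrictAnti x) (ht : StrictAnti t) :
    signedCount x t = if ∀ k, t k = x k then 1 else 0 := by
  rw [signedCount, Finset.sum_eq_single 1]
  · simp
  · intro w _ hw
    rw [if_neg]
    intro h
    refine hw (perm_eq_one_of_strictMono fun i j hij => ?_)
    have := ht hij
    rw [h, h] at this
    exact hx.lt_iff_gt.1 this
  · exact fun h => absurd (Finset.mem_univ _) h

/-- Rows `k`, `k + 1`, `k + 2` of the tower fail to be concave in the columns `≥ h`. -/
def Violates (L N : ℕ) (G : ℕ → ℕ → ℕ) (k h : ℕ) : Prop :=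
  k + 1 < N ∧ 2 * excess L h (G (k + 1)) < excess L h (G k) + excess L h (G (k + 2))

/-- The first violation among those in the rightmost column. -/
def IsCritical (L N : ℕ) (G : ℕ → ℕ → ℕ) (p : ℕ × ℕ) : Prop :=
  Violates L N G p.1 p.2 ∧ (∀ h', p.2 < h' → ∀ k, ¬ Violates L N G k h') ∧
    ∀ k < p.1, ¬ Violates L N G k p.2

section Stembridge

variable {L N : ℕ} {μ lam : ℕ → ℕ} {G : ℕ → ℕ → ℕ} {p q : ℕ × ℕ} {k h : ℕ}

lemma IsCritical.unique (hp : IsCritical L N G p) (hq : IsCritical L N G q) : p = q := by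
  have h2 : p.2 = q.2 := by
    rcases lt_trichotomy p.2 q.2 with h | h | h
    · exact absurd hq.1 (hp.2.1 _ h _)
    · exact h
    · exact absurd hp.1 (hq.2.1 _ h _)
  have h1 : p.1 = q.1 := by
    rcases lt_trichotomy p.1 q.1 with h | h | h
    · exact absurd hp.1 (h2 ▸ hq.2.2 _ h)
    · exact h
    · exact absurd hq.1 (h2 ▸ hp.2.2 _ h)
  exact Prod.ext h1 h2

lemma IsTower.exists_isCritical (hG : IsTower N μ lam G) (hv : Violates L N G k h) :
    ∃ p, IsCritical L N G p := by
  classical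
  -- To the right of the whole diagram all excesses are 0, so violations occur in boundedly many
  -- columns and a rightmost one exists.
  have bound : ∀ k h, Violates L N G k h → h ≤ ∑ i ∈ Finset.range L, lam i := by
    intro k h hv
    by_contra hlt
    have h1 : ∀ j, excess L h (G j) = 0 := fun j => Finset.sum_eq_zero fun i hi => by
      have h2 : G j i ≤ lam i := hG.le_top j i
      have h3 := Finset.single_le_sum (f := lam) (fun _ _ => Nat.zero_le _) hi
      omega
    have := hv.2
    rw [h1, h1, h1] at this
    omega
  have ex : ∃ h, ∃ k, Violates L N G k h := ⟨h, k, hv⟩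
  set b := ∑ i ∈ Finset.range L, lam i with hb
  have h1 := Nat.findGreatest_spec (P := fun h => ∃ k, Violates L N G k h) (bound k h hv) ⟨k, hv⟩
  set h0 := Nat.findGreatest (fun h => ∃ k, Violates L N G k h) b with hh0
  refine ⟨(Nat.find h1, h0), Nat.find_spec h1, fun h' hh' k' hv' => ?_,
    fun k' hk' => Nat.find_min h1 hk'⟩
  exact Nat.findGreatest_is_greatest hh' (bound _ _ hv') ⟨k', hv'⟩

/-- The move at `p`. -/
def criticalMove (G : ℕ → ℕ → ℕ) (p : ℕ × ℕ) : ℕ → ℕ → ℕ :=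
  Function.update G (p.1 + 1) (cutMove p.2 (G p.1) (G (p.1 + 1)) (G (p.1 + 2)))

/-- The move leaves the columns from `p.2` on untouched, and criticality is decided by these columns
only. Hence the critical pair is the same after the move, which makes the move an involution. -/
lemma excess_criticalMove (hG : IsTower N μ lam G) (hp : p.1 + 1 < N) (hh : p.2 ≤ h) :
    excess L h (criticalMove G p k) = excess L h (G k) := by
  rw [criticalMove]
  by_cases hk : k = p.1 + 1
  · subst hk
    rw [Function.update_self, excess_cutMove (hG.strips hp) hh]
  · rw [Function.update_of_ne hk]

lemma IsTower.criticalMove (hG : IsTower N μ lam G) (hp : p.1 + 1 < N) :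
    IsTower N μ lam (criticalMove G p) := hG.update hp (cutMove_bounds (hG.strips hp))

lemma violates_criticalMove (hG : IsTower N μ lam G) (hp : p.1 + 1 < N) (hh : p.2 ≤ h) :
    Violates L N (criticalMove G p) k h ↔ Violates L N G k h := by
  rw [Violates, Violates, excess_criticalMove hG hp hh, excess_criticalMove hG hp hh,
    excess_criticalMove hG hp hh]

lemma IsCritical.criticalMove (hG : IsTower N μ lam G) (hp : IsCritical L N G p) :
    IsCritical L N (criticalMove G p) p := by
  have h1 := hp.1.1
  refine ⟨(violates_criticalMove hG h1 le_rfl).2 hp.1, fun h' hh' k => ?_, fun k hk => ?_⟩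
  · rw [violates_criticalMove hG h1 hh'.le]
    exact hp.2.1 _ hh' _
  · rw [violates_criticalMove hG h1 le_rfl]
    exact hp.2.2 _ hk

lemma criticalMove_involutive (hG : IsTower N μ lam G) (hp : p.1 + 1 < N) :
    criticalMove (criticalMove G p) p = G := by
  rw [criticalMove, criticalMove, Function.update_self, Function.update_of_ne (by omega),
    Function.update_of_ne (by omega), cutMove_involutive (hG.strips hp), Function.update_idem,
    Function.update_eq_self]

/-- The shifted step sizes of a tower. -/
def shiftedWeight (L N : ℕ) (G : ℕ → ℕ → ℕ) (k : Fin N) : ℤ := towerWeight L G k - k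

/-- The correction `-1` in `rowSum_cutMove` is exactly offset by subtracting `k` from the `k`-th
step size, so the move acts on shifted step sizes as an adjacent transposition and reverses signs.
-/
lemma shiftedWeight_criticalMove (hG : IsTower N μ lam G) (hlam : ∀ i, L ≤ i → lam i = 0)
    (hp : IsCritical L N G p) :
    shiftedWeight L N (criticalMove G p) = shiftedWeight L N G ∘
      Equiv.swap ⟨p.1, (Nat.lt_succ_self _).trans hp.1.1⟩ ⟨p.1 + 1, hp.1.1⟩ := by
  have h0 := hp.1.1
  have hz : ∀ k i, L ≤ i → G k i = 0 := fun k i hi =>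
    Nat.le_zero.1 ((hG.le_top k i).trans (hlam i hi).le)
  have h1 : excess L (p.2 + 1) (G p.1) + excess L (p.2 + 1) (G (p.1 + 2)) ≤
      2 * excess L (p.2 + 1) (G (p.1 + 1)) := by
    have := hp.2.1 (p.2 + 1) (Nat.lt_succ_self _) p.1
    rw [Violates, not_and, not_lt] at this
    exact this h0
  obtain ⟨h2, h3⟩ := critical_cut (hG.strips h0) (hz (p.1 + 1)) hp.1.2 h1
  have h4 := rowSum_cutMove (hG.strips h0) (hz (p.1 + 2) L le_rfl) h2 h3
  funext k
  rw [Function.comp_apply, shiftedWeight, shiftedWeight, criticalMove, towerWeight_update]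
  split_ifs with h5 h6
  · have : k = ⟨p.1, (Nat.lt_succ_self _).trans h0⟩ := Fin.ext h5
    rw [this, Equiv.swap_apply_left, h4, towerWeight]
    push_cast
    ring
  · have : k = ⟨p.1 + 1, h0⟩ := Fin.ext h6
    rw [this, Equiv.swap_apply_right, h4, towerWeight]
    push_cast
    ring
  · rw [Equiv.swap_apply_of_ne_of_ne (fun h => h5 (congrArg Fin.val h))
      (fun h => h6 (congrArg Fin.val h))]

/-- A tower without violations. -/
def IsGood (L N : ℕ) (G : ℕ → ℕ → ℕ) : Prop := ∀ k h, ¬ Violates L N G k h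

lemma rowSum_eq_excess (γ : ℕ → ℕ) : rowSum L γ = excess L 0 γ := rfl

/-- Concavity in column 0 says that the step sizes weakly decrease; the staircase makes them
strictly decreasing. -/
lemma IsGood.strictAnti (hG : IsGood L N G) : StrictAnti (shiftedWeight L N G) := by
  have h1 : ∀ k, k + 1 < N → towerWeight L G (k + 1) ≤ towerWeight L G k := by
    intro k hk
    have := hG k 0
    rw [Violates, not_and, not_lt] at this
    have h3 := this hk
    have h4 : excess L 0 (G (k + 1 + 1)) = excess L 0 (G (k + 2)) := rfl
    simp only [towerWeight, rowSum_eq_excess]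
    omega
  have h2 : ∀ d k, k + d < N → towerWeight L G (k + d) ≤ towerWeight L G k := by
    intro d
    induction d with
    | zero => exact fun k _ => le_rfl
    | succ d ih => exact fun k hk => (h1 (k + d) hk).trans (ih k (by omega))
  intro i j hij
  have h3 := h2 (j - i) i (by have := j.2; have : i.1 < j.1 := hij; omega)
  have h4 : i.1 < j.1 := hij
  rw [Nat.add_sub_cancel' h4.le] at h3
  rw [shiftedWeight, shiftedWeight]
  omega

open scoped Classical in
/-- The towers as a finset. -/
noncomputable def towerFinset (hlam : ∀ i, L ≤ i → lam i = 0) (N : ℕ) (μ : ℕ → ℕ) :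
    Finset (ℕ → ℕ → ℕ) := (finite_isTower (N := N) (μ := μ) hlam).toFinset

lemma mem_towerFinset (hlam : ∀ i, L ≤ i → lam i = 0) :
    G ∈ towerFinset hlam N μ ↔ IsTower N μ lam G := (finite_isTower hlam).mem_toFinset

-- Towers with a violation cancel in pairs under the critical move. For the others both vectors are
-- strictly decreasing, so the alternating sum is an indicator.
open scoped Classical in
lemma sum_signedCount (hlam : ∀ i, L ≤ i → lam i = 0) {x : Fin N → ℤ} (hx : StrictAnti x) :
    ∑ G ∈ towerFinset hlam N μ, signedCount x (shiftedWeight L N G) =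
      (((towerFinset hlam N μ).filter
        fun G => IsGood L N G ∧ ∀ k, shiftedWeight L N G k = x k).card : ℚ) := by
  have hbad : ∑ G ∈ (towerFinset hlam N μ).filter (fun G => ¬ IsGood L N G),
      signedCount x (shiftedWeight L N G) = 0 := by
    have hex : ∀ G ∈ (towerFinset hlam N μ).filter (fun G => ¬ IsGood L N G),
        ∃ p, IsCritical L N G p := by
      intro G hG
      rw [Finset.mem_filter, mem_towerFinset, IsGood] at hG
      push Not at hG
      obtain ⟨h1, k, h, hv⟩ := hG
      exact h1.exists_isCritical hv
    have hmem : ∀ G (hG : G ∈ (towerFinset hlam N μ).filter (fun G => ¬ IsGood L N G)),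
        criticalMove G (hex G hG).choose ∈
          (towerFinset hlam N μ).filter (fun G => ¬ IsGood L N G) := by
      intro G hG
      have h1 := (hex G hG).choose_spec
      have h2 := (mem_towerFinset hlam).1 (Finset.mem_filter.1 hG).1
      rw [Finset.mem_filter, mem_towerFinset]
      exact ⟨h2.criticalMove h1.1.1, fun h => h _ _ (h1.criticalMove h2).1⟩
    have hneg : ∀ G (hG : G ∈ (towerFinset hlam N μ).filter (fun G => ¬ IsGood L N G)),
        signedCount x (shiftedWeight L N (criticalMove G (hex G hG).choose)) =
          - signedCount x (shiftedWeight L N G) := by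
      intro G hG
      have h1 := (hex G hG).choose_spec
      have h2 := (mem_towerFinset hlam).1 (Finset.mem_filter.1 hG).1
      rw [shiftedWeight_criticalMove h2 hlam h1, signedCount_comp_swap]
      intro h
      have := congrArg Fin.val h
      simp at this
    refine Finset.sum_involution (fun G hG => criticalMove G (hex G hG).choose)
      (fun G hG => ?_) (fun G hG h0 h1 => h0 ?_) hmem (fun G hG => ?_)
    · rw [hneg G hG, add_neg_cancel]
    · have h2 := hneg G hG
      rw [h1] at h2
      linarith
    · have h1 := (hex G hG).choose_spec
      have h2 := (mem_towerFinset hlam).1 (Finset.mem_filter.1 hG).1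
      have h3 := (hex _ (hmem G hG)).choose_spec
      rw [h3.unique (h1.criticalMove h2), criticalMove_involutive h2 h1.1.1]
  rw [← Finset.sum_filter_add_sum_filter_not _ (IsGood L N), hbad, add_zero,
    ← Finset.filter_filter, Finset.card_filter, Nat.cast_sum]
  refine Finset.sum_congr rfl fun G hG => ?_
  rw [signedCount_of_strictAnti hx (Finset.mem_filter.1 hG).2.strictAnti]
  push_cast
  rfl

end Stembridge

/-! ### Coefficients of Schur functions -/

/-- An integer vector as an exponent vector. -/
noncomputable def vectorExponent {N : ℕ} (e : Fin N → ℤ) : ℕ →₀ ℕ :=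
  Finsupp.onFinset (Finset.range N) (fun k => if h : k < N then (e ⟨k, h⟩).toNat else 0)
    fun k hk => by
      rw [Finset.mem_range]
      by_contra h
      exact hk (dif_neg h)

lemma vectorExponent_apply {N : ℕ} (e : Fin N → ℤ) (k : Fin N) :
    vectorExponent e k = (e k).toNat := dif_pos k.2

lemma vectorExponent_of_le {N : ℕ} (e : Fin N → ℤ) {k : ℕ} (hk : N ≤ k) :
    vectorExponent e k = 0 := dif_neg (not_lt.2 hk)

/-- The coefficient at an integer vector. -/
noncomputable def vectorCoeff {N : ℕ} (f : Series) (e : Fin N → ℤ) : ℚ :=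
  if ∀ k, 0 ≤ e k then f (vectorExponent e) else 0

/-- The vector `ν` shifted by `-ρ`. -/
def shiftedShape {N : ℕ} (ν : Fin N → ℤ) (k : Fin N) : ℤ := ν k - k

/-- The coefficient of a Schur function in `f`, as an alternating sum. -/
noncomputable def schurCoeff {N : ℕ} (ν : Fin N → ℤ) (f : Series) : ℚ :=
  ∑ w : Equiv.Perm (Fin N),
    ((Equiv.Perm.sign w : ℤ) : ℚ) * vectorCoeff f fun k => shiftedShape ν (w k) + k

/-- The value 0 at vectors with a negative entry is consistent with counting towers, since step
sizes are never negative. -/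
lemma vectorCoeff_skewSchur (A : SkewShape) {L N : ℕ} (e : Fin N → ℤ)
    (hL : ∀ i, L ≤ i → A.outer.rowLen i = 0) :
    vectorCoeff (skewSchur A) e = ∑ G ∈ towerFinset hL N A.inner.rowLen,
      if ∀ k : Fin N, towerWeight L G k = e k then (1 : ℚ) else 0 := by
  classical
  rw [← Nat.cast_one, ← Nat.cast_zero (R := ℚ)]
  simp_rw [← Nat.cast_ite]
  rw [← Nat.cast_sum, ← Finset.card_filter, vectorCoeff]
  split_ifs with h
  · rw [skewSchur_eq_ncard_chains A hL (fun i hi => vectorExponent_of_le e hi),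
      ← Set.ncard_coe_finset]
    congr 2
    ext G
    rw [Finset.coe_filter, Set.mem_ofPred_eq, mem_towerFinset]
    refine isChain_strip_iff.trans (and_congr_right fun _ => ?_)
    constructor
    · intro h1 k
      rw [h1 k k.2, vectorExponent_apply, Int.toNat_of_nonneg (h k)]
    · intro h1 k hk
      have := vectorExponent_apply e ⟨k, hk⟩
      simp only at this
      rw [this, Int.toNat_of_nonneg (h _), ← h1]
  · rw [Finset.card_eq_zero.2, Nat.cast_zero]
    rw [Finset.filter_eq_empty_iff]
    intro G hG h1
    rw [mem_towerFinset] at hG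
    refine h fun k => ?_
    rw [← h1 k, towerWeight, sub_nonneg]
    exact Finset.sum_le_sum fun i _ => Int.ofNat_le.2 ((hG.rel k k.2).1 i)

-- A Littlewood–Richardson rule: inserting the tower count into the alternating sum and exchanging
-- summations leaves `sum_signedCount`. In particular the coefficient is nonnegative.
open scoped Classical in
lemma schurCoeff_skewSchur (A : SkewShape) {L N : ℕ} {ν : Fin N → ℤ} (hν : Antitone ν)
    (hL : ∀ i, L ≤ i → A.outer.rowLen i = 0) :
    schurCoeff ν (skewSchur A) = (((towerFinset hL N A.inner.rowLen).filter
        fun G => IsGood L N G ∧ ∀ k : Fin N, towerWeight L G k = ν k).card : ℚ) := by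
  have hx : StrictAnti (shiftedShape ν) := fun i j hij => by
    have h1 := hν hij.le
    have h2 : i.1 < j.1 := hij
    rw [shiftedShape, shiftedShape]
    omega
  rw [schurCoeff]
  simp_rw [vectorCoeff_skewSchur A _ hL, Finset.mul_sum]
  rw [Finset.sum_comm]
  convert sum_signedCount (N := N) (μ := A.inner.rowLen) hL hx using 1
  · refine Finset.sum_congr rfl fun G _ => Finset.sum_congr rfl fun w _ => ?_
    rw [mul_ite, mul_one, mul_zero]
    refine if_congr (forall_congr' fun k => ?_) rfl rfl
    rw [shiftedWeight]
    omega
  · congr 2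
    refine Finset.filter_congr fun G _ => and_congr_right fun _ => forall_congr' fun k => ?_
    rw [shiftedWeight, shiftedShape]
    omega

/-! ### The only good tower of a straight shape -/

section Straight

variable {N : ℕ} {lam : ℕ → ℕ}

/-- The tower whose `k`-th strip is row `k`. -/
def rowTower (lam : ℕ → ℕ) (k i : ℕ) : ℕ := if i < k then lam i else 0

lemma isTower_rowTower (hlam : Antitone lam) (hN : ∀ i, N ≤ i → lam i = 0) :
    IsTower N 0 lam (rowTower lam) where
  bot := rfl
  top k hk := by
    funext i
    rw [rowTower]
    split_ifs with h
    · rfl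
    · rw [hN i (by omega)]
  rel k hk := by
    refine ⟨fun i => ?_, fun i => ?_⟩
    · change rowTower lam k i ≤ rowTower lam (k + 1) i
      unfold rowTower
      split_ifs <;> omega
    · have : lam (i + 1) ≤ lam i := hlam (Nat.le_succ i)
      unfold rowTower
      split_ifs <;> omega

lemma excess_rowTower_succ {k h : ℕ} (hk : k < N) :
    excess N h (rowTower lam (k + 1)) = excess N h (rowTower lam k) + ((lam k - h : ℕ) : ℤ) := by
  have h1 : ∀ i ∈ Finset.range N, ((rowTower lam (k + 1) i - h : ℕ) : ℤ) =
      ((rowTower lam k i - h : ℕ) : ℤ) + if k = i then ((lam k - h : ℕ) : ℤ) else 0 := by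
    intro i _
    unfold rowTower
    by_cases h2 : k = i
    · subst h2
      simp
    · rw [if_neg h2, add_zero]
      have : i < k + 1 ↔ i < k := by omega
      simp only [this]
  rw [excess, Finset.sum_congr rfl h1, Finset.sum_add_distrib, Finset.sum_ite_eq,
    if_pos (Finset.mem_range.2 hk)]
  rfl

lemma isGood_rowTower (hlam : Antitone lam) : IsGood N N (rowTower lam) := by
  rintro k h ⟨hk, hv⟩
  rw [excess_rowTower_succ (k := k + 1) hk, excess_rowTower_succ (k := k) (by omega)] at hv
  have : lam (k + 1) ≤ lam k := hlam (Nat.le_succ k)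
  omega

lemma towerWeight_rowTower {k : ℕ} (hk : k < N) : towerWeight N (rowTower lam) k = lam k := by
  rw [towerWeight, rowSum_eq_excess, rowSum_eq_excess, excess_rowTower_succ hk]
  simp

/-- Starting from the empty shape, each horizontal strip creates at most one new row. -/
lemma eq_zero_of_isTower {G : ℕ → ℕ → ℕ} (hG : IsTower N 0 lam G) :
    ∀ k i, k ≤ i → k ≤ N → G k i = 0 := by
  intro k
  induction k with
  | zero => exact fun i _ _ => congrFun hG.bot i
  | succ k ih =>
    intro i hi hk
    obtain ⟨i, rfl⟩ := Nat.exists_eq_add_of_le' (show 1 ≤ i by omega)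
    exact Nat.le_zero.1 (((hG.rel k (by omega)).2 i).trans (ih i (by omega) (by omega)).le)

/-- A concave sequence that fails to increase once never increases later. -/
lemma concave_le {N : ℕ} {f : ℕ → ℤ} (hf : ∀ k, k + 1 < N → f k + f (k + 2) ≤ 2 * f (k + 1))
    {i : ℕ} (hi : f (i + 1) ≤ f i) : ∀ d, i + d ≤ N → f (i + d) ≤ f i := by
  have h1 : ∀ d, i + d + 1 ≤ N → f (i + d + 1) ≤ f (i + d) := by
    intro d
    induction d with
    | zero => exact fun _ => hi
    | succ d ih =>
      intro hd
      have h2 := ih (by omega)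
      have h3 := hf (i + d) (by omega)
      have h4 : f (i + (d + 1) + 1) = f (i + d + 2) := rfl
      have h5 : f (i + (d + 1)) = f (i + d + 1) := rfl
      omega
  intro d
  induction d with
  | zero => exact fun _ => le_rfl
  | succ d ih => exact fun hd => (h1 d hd).trans (ih (by omega))

lemma IsTower.mono {μ : ℕ → ℕ} {G : ℕ → ℕ → ℕ} (hG : IsTower N μ lam G) : Monotone G :=
  (hG.isChain (L := 0)).mono fun _ _ h => h.le

/-- Each row must be completed by the step that creates it: otherwise the excess beyond the length
reached would fail to grow at that step, and by concavity it could never grow to the value required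
by the final shape. -/
lemma eq_rowTower {G : ℕ → ℕ → ℕ} (hG : IsTower N 0 lam G) (hgood : IsGood N N G)
    (hN : ∀ i, N ≤ i → lam i = 0) : G = rowTower lam := by
  have key : ∀ i < N, lam i ≤ G (i + 1) i := by
    intro i
    induction i using Nat.strong_induction_on with
    | _ i ih =>
      intro hi
      by_contra hlt
      -- At this column the higher rows are already complete, row `i` contributes nothing yet and
      -- the lower rows are empty, so step `i` adds no excess.
      set h := G (i + 1) i with hh
      have h1 : excess N h (G (i + 1)) ≤ excess N h (G i) := by
        refine Finset.sum_le_sum fun j _ => ?_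
        rcases lt_trichotomy j i with hj | hj | hj
        · have h2 : lam j ≤ G i j := (ih j hj (by omega)).trans (hG.mono (by omega) j)
          have h3 : G (i + 1) j ≤ lam j := hG.le_top (i + 1) j
          omega
        · subst hj
          omega
        · rw [eq_zero_of_isTower hG (i + 1) j hj (by omega)]
          omega
      have h2 := concave_le (N := N) (f := fun k => excess N h (G k)) (fun k hk => by
        have := hgood k h
        rw [Violates, not_and, not_lt] at this
        exact this hk) h1 (N - i) (by omega)
      rw [Nat.add_sub_cancel' hi.le] at h2
      refine absurd h2 (not_le.2 ?_)
      refine Finset.sum_lt_sum (fun j _ => ?_) ⟨i, Finset.mem_range.2 hi, ?_⟩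
      · have : G i j ≤ G N j := hG.mono hi.le j
        omega
      · rw [hG.top N le_rfl, eq_zero_of_isTower hG i i le_rfl hi.le]
        omega
  funext k i
  rw [rowTower]
  split_ifs with h
  · rcases lt_or_ge i N with hi | hi
    · exact le_antisymm (hG.le_top k i) ((key i hi).trans (hG.mono h i))
    · rw [hG.top k (by omega)]
  · rcases le_or_gt k N with hk | hk
    · exact eq_zero_of_isTower hG k i (by omega) hk
    · rw [hG.top k hk.le, hN i (by omega)]

end Straight

lemma rowLen_bot : (⊥ : YoungDiagram).rowLen = 0 := by
  funext i
  by_contra h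
  exact YoungDiagram.notMem_bot _ (YoungDiagram.mem_iff_lt_rowLen.2 (Nat.pos_of_ne_zero h))

/-- The functionals are dual to the Schur functions: the single good tower of a straight shape has
the row lengths as step sizes. -/
lemma schurCoeff_schur (lam : YoungDiagram) {N : ℕ} {ν : Fin N → ℤ} (hν : Antitone ν)
    (hN : ∀ i, N ≤ i → lam.rowLen i = 0) :
    schurCoeff ν (schur lam) = if ∀ k : Fin N, (lam.rowLen k : ℤ) = ν k then 1 else 0 := by
  classical
  rw [schur, schurCoeff_skewSchur _ hν (show ∀ i, N ≤ i → (SkewShape.straight lam).outer.rowLen i = 0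
    from hN)]
  have hanti : Antitone lam.rowLen := fun i j h => lam.rowLen_anti i j h
  have h1 : ∀ G, G ∈ (towerFinset hN N (⊥ : YoungDiagram).rowLen).filter
      (fun G => IsGood N N G ∧ ∀ k : Fin N, towerWeight N G k = ν k) ↔
      G = rowTower lam.rowLen ∧ ∀ k : Fin N, (lam.rowLen k : ℤ) = ν k := by
    intro G
    rw [Finset.mem_filter, mem_towerFinset, rowLen_bot]
    constructor
    · rintro ⟨h1, h2, h3⟩
      have h4 := eq_rowTower h1 h2 hN
      refine ⟨h4, fun k => ?_⟩
      rw [← h3, h4, towerWeight_rowTower k.2]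
    · rintro ⟨rfl, h⟩
      refine ⟨isTower_rowTower hanti hN, isGood_rowTower hanti, fun k => ?_⟩
      rw [towerWeight_rowTower k.2, h]
  split_ifs with h
  · have : (towerFinset hN N (⊥ : YoungDiagram).rowLen).filter
      (fun G => IsGood N N G ∧ ∀ k : Fin N, towerWeight N G k = ν k) = {rowTower lam.rowLen} := by
      ext G
      rw [h1, Finset.mem_singleton]
      exact and_iff_left h
    exact (congrArg (fun s : Finset (ℕ → ℕ → ℕ) => (s.card : ℚ)) this).trans (by simp)
  · have : (towerFinset hN N (⊥ : YoungDiagram).rowLen).filter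
      (fun G => IsGood N N G ∧ ∀ k : Fin N, towerWeight N G k = ν k) = ∅ :=
      Finset.eq_empty_of_forall_notMem fun G hG => h ((h1 G).1 hG).2
    exact (congrArg (fun s : Finset (ℕ → ℕ → ℕ) => (s.card : ℚ)) this).trans (by simp)

end SkewQSym

/-! ### Existence of Schur expansions. -/

namespace SkewQSym

/-! ### Young diagrams and decreasing exponent vectors -/

lemma YoungDiagram_ext_rowLen {μ ν : YoungDiagram} (h : ∀ i, μ.rowLen i = ν.rowLen i) : μ = ν := by
  ext ⟨i, j⟩
  rw [YoungDiagram.mem_cells, YoungDiagram.mem_cells, YoungDiagram.mem_iff_lt_rowLen,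
    YoungDiagram.mem_iff_lt_rowLen, h]

lemma YoungDiagram_lt_card {μ : YoungDiagram} {i j : ℕ} (h : (i, j) ∈ μ) :
    i < μ.card ∧ j < μ.card := by
  constructor
  · refine (YoungDiagram.mem_iff_lt_colLen.1 h).trans_le ?_
    rw [YoungDiagram.colLen_eq_card]
    exact Finset.card_le_card (Finset.filter_subset _ _)
  · refine (YoungDiagram.mem_iff_lt_rowLen.1 h).trans_le ?_
    rw [YoungDiagram.rowLen_eq_card]
    exact Finset.card_le_card (Finset.filter_subset _ _)

lemma YoungDiagram_rowLen_of_card_le {μ : YoungDiagram} {i : ℕ} (h : μ.card ≤ i) :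
    μ.rowLen i = 0 := by
  by_contra h0
  have := (YoungDiagram_lt_card (YoungDiagram.mem_iff_lt_rowLen.2 (Nat.pos_of_ne_zero h0))).1
  omega

lemma finite_card_le (d : ℕ) : {μ : YoungDiagram | μ.card ≤ d}.Finite := by
  refine Set.Finite.of_finite_image (f := YoungDiagram.cells) ?_
    fun μ _ ν _ h => YoungDiagram.ext h
  refine (Finset.range d ×ˢ Finset.range d).powerset.finite_toSet.subset ?_
  rintro _ ⟨μ, hμ, rfl⟩
  rw [Finset.mem_coe, Finset.mem_powerset]
  rintro ⟨i, j⟩ hij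
  have := YoungDiagram_lt_card ((YoungDiagram.mem_cells _).1 hij)
  rw [Finset.mem_product, Finset.mem_range, Finset.mem_range]
  have hd : μ.card ≤ d := hμ
  exact ⟨by omega, by omega⟩

/-- The diagram whose row lengths are the entries of a decreasing exponent vector. -/
def diagramOf (m : ℕ →₀ ℕ) (hm : Antitone m) : YoungDiagram where
  cells := (m.support.sigma fun i => Finset.range (m i)).map (Equiv.sigmaEquivProd ℕ ℕ).toEmbedding
  isLowerSet := by
    have key : ∀ i j, (i, j) ∈ (m.support.sigma fun i => Finset.range (m i)).map
        (Equiv.sigmaEquivProd ℕ ℕ).toEmbedding ↔ j < m i := by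
      intro i j
      rw [Finset.mem_map_equiv, Finset.mem_sigma, Finsupp.mem_support_iff, Finset.mem_range]
      change m i ≠ 0 ∧ j < m i ↔ _
      omega
    rintro ⟨i, j⟩ ⟨i', j'⟩ h hij
    rw [Finset.mem_coe, key] at *
    exact lt_of_le_of_lt h.2 (hij.trans_le (hm h.1))

lemma rowLen_diagramOf (m : ℕ →₀ ℕ) (hm : Antitone m) (i : ℕ) :
    (diagramOf m hm).rowLen i = m i := by
  have h : ∀ j, j < (diagramOf m hm).rowLen i ↔ j < m i := by
    intro j
    rw [← YoungDiagram.mem_iff_lt_rowLen, ← YoungDiagram.mem_cells, diagramOf,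
      Finset.mem_map_equiv, Finset.mem_sigma, Finsupp.mem_support_iff, Finset.mem_range]
    change m i ≠ 0 ∧ j < m i ↔ _
    omega
  have h1 := h (m i)
  have h2 := h ((diagramOf m hm).rowLen i)
  omega

lemma card_diagramOf (m : ℕ →₀ ℕ) (hm : Antitone m) : (diagramOf m hm).card = m.degree := by
  rw [YoungDiagram.card, diagramOf, Finset.card_map, Finset.card_sigma]
  simp only [Finset.card_range]
  rfl

lemma size_straight (μ : YoungDiagram) : (SkewShape.straight μ).size = μ.card := by
  rw [SkewShape.size, SkewShape.cells]
  simp only [SkewShape.straight, YoungDiagram.cells_bot, Finset.sdiff_empty]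

lemma schur_eq_zero_of_degree {μ : YoungDiagram} {m : ℕ →₀ ℕ} (h : m.degree ≠ μ.card) :
    schur μ m = 0 := skewSchur_eq_zero_of_degree _ (by rwa [size_straight])

/-- Every exponent vector can be sorted into decreasing order. -/
lemma exists_perm_antitone (m : ℕ →₀ ℕ) : ∃ σ : Equiv.Perm ℕ, Antitone (m.equivMapDomain σ) := by
  obtain ⟨K, hK⟩ : ∃ K, ∀ i, K ≤ i → m i = 0 := by
    refine ⟨m.support.sup id + 1, fun i hi => ?_⟩
    by_contra h
    have := Finset.le_sup (f := id) (Finsupp.mem_support_iff.2 h)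
    simp only [id] at this
    omega
  set σ := Tuple.sort fun i : Fin K => OrderDual.toDual (m i) with hσ
  have h1 : Monotone ((fun i : Fin K => OrderDual.toDual (m i)) ∘ σ) := Tuple.monotone_sort _
  refine ⟨(σ.extendDomain (Fin.equivSubtype (n := K)))⁻¹, ?_⟩
  have h2 : ∀ i (hi : i < K), m.equivMapDomain (σ.extendDomain (Fin.equivSubtype (n := K)))⁻¹ i =
      m (σ ⟨i, hi⟩) := by
    intro i hi
    rw [Finsupp.equivMapDomain_apply]
    exact congrArg m (Equiv.Perm.extendDomain_apply_image σ (Fin.equivSubtype (n := K)) ⟨i, hi⟩)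
  have h3 : ∀ i, K ≤ i → m.equivMapDomain (σ.extendDomain (Fin.equivSubtype (n := K)))⁻¹ i =
      0 := by
    intro i hi
    rw [Finsupp.equivMapDomain_apply]
    refine (congrArg m (Equiv.Perm.extendDomain_apply_not_subtype σ (Fin.equivSubtype (n := K))
      (not_lt.2 hi))).trans (hK i hi)
  intro i j hij
  rcases lt_or_ge j K with hj | hj
  · rw [h2 i (by omega), h2 j hj]
    exact h1 (show (⟨i, by omega⟩ : Fin K) ≤ ⟨j, hj⟩ from hij)
  · rw [h3 j hj]
    exact Nat.zero_le _

/-- The sum of the squares of the exponents. -/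
def sumSq (m : ℕ →₀ ℕ) : ℕ := m.sum fun _ a => a ^ 2

lemma sumSq_equivMapDomain (σ : Equiv.Perm ℕ) (m : ℕ →₀ ℕ) :
    sumSq (m.equivMapDomain σ) = sumSq m := by
  have h : (m.equivMapDomain σ).support = m.support.map σ.toEmbedding := rfl
  rw [sumSq, sumSq, Finsupp.sum, h, Finset.sum_map]
  refine Finset.sum_congr rfl fun i _ => ?_
  simp [Finsupp.equivMapDomain_apply]

lemma sumSq_le (m : ℕ →₀ ℕ) : sumSq m ≤ m.degree * m.degree := by
  rw [sumSq, Finsupp.sum]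
  conv_rhs => rw [Finsupp.degree_apply m, Finset.mul_sum]
  refine Finset.sum_le_sum fun i hi => ?_
  simp only [sq]
  exact Nat.mul_le_mul_right _ (Finset.single_le_sum (f := m) (fun _ _ => Nat.zero_le _) hi)

lemma sumSq_eq_sum {N : ℕ} {m : ℕ →₀ ℕ} (hm : ∀ i, N ≤ i → m i = 0) :
    sumSq m = ∑ k : Fin N, m k ^ 2 := by
  rw [Fin.sum_univ_eq_sum_range (fun k => m k ^ 2), sumSq]
  refine Finset.sum_subset (fun i hi => ?_) fun i _ hi => ?_
  · rw [Finset.mem_range]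
    by_contra h
    exact Finsupp.mem_support_iff.1 hi (hm i (not_lt.1 h))
  · simp only [Finsupp.notMem_support_iff.1 hi]
    rfl

/-! ### Schur expansions -/

/-- The coefficient extraction `schurCoeff` as a linear map. -/
noncomputable def schurCoeffHom {N : ℕ} (ν : Fin N → ℤ) : Series →ₗ[ℚ] ℚ where
  toFun := schurCoeff ν
  map_add' f g := by
    rw [schurCoeff, schurCoeff, schurCoeff, ← Finset.sum_add_distrib]
    refine Finset.sum_congr rfl fun w _ => ?_
    rw [← mul_add]
    congr 1
    unfold vectorCoeff
    split_ifs
    · rfl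
    · rw [add_zero]
  map_smul' a f := by
    rw [schurCoeff, schurCoeff, smul_eq_mul, Finset.mul_sum]
    refine Finset.sum_congr rfl fun w _ => ?_
    rw [mul_left_comm, RingHom.id_apply]
    congr 1
    unfold vectorCoeff
    split_ifs
    · rfl
    · rw [mul_zero]

/-- Expanding the squares leaves only the mixed sums to compare, and the strict rearrangement
inequality applies because the index and the shifted vector are oppositely ordered. -/
lemma sumSq_shifted_lt {N : ℕ} {ν : Fin N → ℤ} (hν : Antitone ν) {w : Equiv.Perm (Fin N)}
    (hw : w ≠ 1) : ∑ k, ν k ^ 2 < ∑ k, (shiftedShape ν (w k) + k) ^ 2 := by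
  have hx : StrictAnti (shiftedShape ν) := fun i j hij => by
    have h1 := hν hij.le
    have h2 : i.1 < j.1 := hij
    rw [shiftedShape, shiftedShape]
    omega
  have h1 : Antivary (fun k : Fin N => (k : ℤ)) (shiftedShape ν) := by
    intro i j hij
    have : j.1 < i.1 := hx.lt_iff_gt.1 hij
    simp only
    omega
  have h2 := (h1.sum_mul_lt_sum_mul_comp_perm_iff (σ := w)).2 fun h => hw <|
    perm_eq_one_of_strictMono fun i j hij => by
      by_contra hlt
      have h3 : w j < w i := lt_of_le_of_ne (not_lt.1 hlt) fun h => hij.ne' (w.injective h)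
      have h4 := h (hx h3)
      have h5 : i.1 < j.1 := hij
      simp only at h4
      omega
  have h3 : ∑ k, shiftedShape ν (w k) ^ 2 = ∑ k, shiftedShape ν k ^ 2 :=
    Equiv.sum_comp w fun k => shiftedShape ν k ^ 2
  have h4 : ∀ k, ν k ^ 2 = shiftedShape ν k ^ 2 + 2 * ((k : ℤ) * shiftedShape ν k) + (k : ℤ) ^ 2 := by
    intro k
    rw [shiftedShape]
    ring
  have h5 : ∀ k, (shiftedShape ν (w k) + k) ^ 2 =
      shiftedShape ν (w k) ^ 2 + 2 * ((k : ℤ) * shiftedShape ν (w k)) + (k : ℤ) ^ 2 := by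
    intro k
    ring
  simp_rw [h4, h5, Finset.sum_add_distrib, h3, ← Finset.mul_sum]
  simp only [smul_eq_mul] at h2
  linarith

/-- A symmetric function of degree at most `d` vanishes if its Schur coefficients do. -/
lemma eq_zero_of_schurCoeff {f : Series} (hf : IsSymmetricFunction f) {d : ℕ}
    (hd : ∀ m : ℕ →₀ ℕ, d < m.degree → f m = 0)
    (hc : ∀ μ : YoungDiagram, μ.card ≤ d → schurCoeff (fun k : Fin d => (μ.rowLen k : ℤ)) f = 0) :
    f = 0 := by
  by_contra hne
  obtain ⟨m₀, hm₀⟩ : ∃ m, f m ≠ 0 := by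
    by_contra h
    push Not at h
    exact hne (funext h)
  have hdeg : ∀ m : ℕ →₀ ℕ, f m ≠ 0 → m.degree ≤ d := fun m hm => not_lt.1 fun h => hm (hd m h)
  have hbdd : BddAbove (sumSq '' {m | f m ≠ 0}) := by
    refine ⟨d * d, ?_⟩
    rintro _ ⟨m, hm, rfl⟩
    exact (sumSq_le m).trans (Nat.mul_le_mul (hdeg m hm) (hdeg m hm))
  -- A monomial of `f` with maximal sum of squares may be sorted by symmetry. In its Schur
  -- coefficient every permutation other than 1 asks for a monomial with larger sum of squares,
  -- whose coefficient is 0; so its own coefficient is a Schur coefficient of `f`.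
  obtain ⟨m₁, hm₁, hmax⟩ := Nat.sSup_mem ⟨_, Set.mem_image_of_mem sumSq hm₀⟩ hbdd
  have hmax' : ∀ m, f m ≠ 0 → sumSq m ≤ sumSq m₁ := fun m hm => by
    rw [hmax]
    exact le_csSup hbdd (Set.mem_image_of_mem sumSq hm)
  obtain ⟨σ, hσ⟩ := exists_perm_antitone m₁
  set m := m₁.equivMapDomain σ with hm
  have hfm : f m ≠ 0 := by
    have : f m = f m₁ := hf.2 σ m₁
    rw [this]
    exact hm₁
  have hcard : (diagramOf m hσ).card ≤ d := by
    rw [card_diagramOf]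
    exact hdeg m hfm
  have hz : ∀ i, d ≤ i → m i = 0 := fun i hi => by
    rw [← rowLen_diagramOf m hσ]
    exact YoungDiagram_rowLen_of_card_le (hcard.trans hi)
  have h1 := hc _ hcard
  simp only [rowLen_diagramOf] at h1
  rw [schurCoeff, Finset.sum_eq_single 1] at h1
  · rw [Equiv.Perm.sign_one, Units.val_one, Int.cast_one, one_mul, vectorCoeff, if_pos] at h1
    · refine hfm ?_
      convert h1 using 1
      congr 1
      ext k
      rcases lt_or_ge k d with hk | hk
      · rw [show k = ((⟨k, hk⟩ : Fin d) : ℕ) from rfl, vectorExponent_apply]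
        simp [shiftedShape]
      · rw [hz k hk, vectorExponent_of_le _ hk]
    · intro k
      simp [shiftedShape]
  · intro w _ hw
    rw [vectorCoeff]
    split_ifs with hpos
    · have h2 : sumSq m < sumSq (vectorExponent fun k : Fin d =>
          shiftedShape (fun k : Fin d => (m k : ℤ)) (w k) + k) := by
        rw [sumSq_eq_sum hz, sumSq_eq_sum fun i hi => vectorExponent_of_le _ hi]
        have h3 := sumSq_shifted_lt (ν := fun k : Fin d => (m k : ℤ))
          (fun i j hij => Int.ofNat_le.2 (hσ hij)) hw
        zify
        refine h3.trans_eq (Finset.sum_congr rfl fun k _ => ?_)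
        rw [vectorExponent_apply, Int.toNat_of_nonneg (hpos k)]
      by_contra h3
      have h4 := hmax' _ (right_ne_zero_of_mul h3)
      have h5 : sumSq m = sumSq m₁ := sumSq_equivMapDomain σ m₁
      omega
    · rw [mul_zero]
  · exact fun h => absurd (Finset.mem_univ _) h

lemma antitone_rowLen (μ : YoungDiagram) (d : ℕ) :
    Antitone fun k : Fin d => (μ.rowLen k : ℤ) :=
  fun _ _ hij => Int.ofNat_le.2 (μ.rowLen_anti _ _ hij)

/-- The Schur expansion of a symmetric function. -/
lemma exists_schur_expansion {f : Series} (hf : IsSymmetricFunction f) :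
    ∃ (d : ℕ) (c : YoungDiagram →₀ ℚ), IsExpansion schur c f ∧
      ∀ μ, c μ = 0 ∨ c μ = schurCoeff (fun k : Fin d => (μ.rowLen k : ℤ)) f := by
  classical
  obtain ⟨d, hd⟩ := hf.1
  set S := (finite_card_le d).toFinset with hS
  have memS : ∀ μ, μ ∈ S ↔ μ.card ≤ d := fun μ => (finite_card_le d).mem_toFinset
  set c : YoungDiagram →₀ ℚ := Finsupp.indicator S
    (fun μ _ => schurCoeff (fun k : Fin d => (μ.rowLen k : ℤ)) f) with hcdef
  have hc1 : ∀ μ, c μ = if μ ∈ S then schurCoeff (fun k : Fin d => (μ.rowLen k : ℤ)) f else 0 := by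
    intro μ
    rw [hcdef, Finsupp.indicator_apply]
    split_ifs <;> rfl
  refine ⟨d, c, ?_, fun μ => ?_⟩
  swap
  · rw [hc1]
    split_ifs
    · exact Or.inr rfl
    · exact Or.inl rfl
  have hlin : Finsupp.linearCombination ℚ schur c = ∑ μ ∈ S, c μ • schur μ := by
    rw [Finsupp.linearCombination_apply, Finsupp.sum]
    refine Finset.sum_subset (fun μ hμ => ?_) fun μ _ hμ => ?_
    · by_contra h
      rw [Finsupp.mem_support_iff, hc1, if_neg h] at hμ
      exact hμ rfl
    · rw [Finsupp.notMem_support_iff.1 hμ, zero_smul]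
  have heval : ∀ m, (∑ μ ∈ S, c μ • schur μ : Series) m = ∑ μ ∈ S, c μ * schur μ m := by
    intro m
    have : MvPowerSeries.coeff m (∑ μ ∈ S, c μ • schur μ : Series) = ∑ μ ∈ S, c μ * schur μ m := by
      rw [map_sum]
      rfl
    exact this
  -- By duality the remainder has no Schur coefficients left. The same `d` bounds the degree and
  -- serves as the number of variables, which suffices since a diagram with at most `d` boxes has at
  -- most `d` rows.
  have h0 : f - ∑ μ ∈ S, c μ • schur μ = 0 := by
    have heq : ∀ m, (f - ∑ μ ∈ S, c μ • schur μ : Series) m = f m - ∑ μ ∈ S, c μ * schur μ m :=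
      fun m => (congrArg (fun x => f m - x) (heval m) :)
    have hdeg : ∀ m : ℕ →₀ ℕ, d < m.degree → (f - ∑ μ ∈ S, c μ • schur μ : Series) m = 0 := by
      intro m hm
      rw [heq, show f m = 0 from hd m hm, Finset.sum_eq_zero, sub_zero]
      intro μ hμ
      rw [schur_eq_zero_of_degree, mul_zero]
      have := (memS μ).1 hμ
      omega
    refine eq_zero_of_schurCoeff ⟨⟨d, hdeg⟩, fun σ m => ?_⟩ hdeg fun ν hν => ?_
    · change (f - ∑ μ ∈ S, c μ • schur μ : Series) _ = (f - ∑ μ ∈ S, c μ • schur μ : Series) _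
      rw [heq, heq, show f (m.equivMapDomain σ) = f m from hf.2 σ m]
      congr 1
      refine Finset.sum_congr rfl fun μ _ => ?_
      congr 1
      exact (isSymmetricFunction_skewSchur (SkewShape.straight μ)).2 σ m
    · change schurCoeffHom _ _ = 0
      rw [map_sub, map_sum, sub_eq_zero, Finset.sum_eq_single ν]
      · rw [map_smul, hc1, if_pos ((memS ν).2 hν)]
        change schurCoeff _ _ = _ • schurCoeff _ _
        rw [schurCoeff_schur ν (antitone_rowLen ν d)
          (fun i hi => YoungDiagram_rowLen_of_card_le (hν.trans hi)), if_pos fun _ => rfl,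
          smul_eq_mul, mul_one]
      · intro μ hμ hne
        rw [map_smul]
        change _ • schurCoeff _ _ = _
        have hμ' := (memS μ).1 hμ
        rw [schurCoeff_schur μ (antitone_rowLen ν d)
          (fun i hi => YoungDiagram_rowLen_of_card_le (hμ'.trans hi)), if_neg, smul_zero]
        intro h
        refine hne (YoungDiagram_ext_rowLen fun i => ?_)
        rcases lt_or_ge i d with hi | hi
        · exact_mod_cast h ⟨i, hi⟩
        · rw [YoungDiagram_rowLen_of_card_le (hμ'.trans hi),
            YoungDiagram_rowLen_of_card_le (hν.trans hi)]
      · exact fun h => absurd ((memS ν).2 hν) h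
  rw [IsExpansion, hlin]
  exact (sub_eq_zero.1 h0).symm

/-- Skew Schur functions are Schur-positive. -/
lemma exists_schur_expansion_skewSchur (A : SkewShape) :
    ∃ c : YoungDiagram →₀ ℚ, IsExpansion schur c (skewSchur A) ∧ ∀ μ, 0 ≤ c μ := by
  obtain ⟨d, c, hc, h⟩ := exists_schur_expansion (isSymmetricFunction_skewSchur A)
  refine ⟨c, hc, fun μ => ?_⟩
  rcases h μ with h | h
  · exact h.ge
  · rw [h, schurCoeff_skewSchur A (antitone_rowLen μ d)
      (fun i hi => YoungDiagram_rowLen_eq_zero _ hi)]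
    exact Nat.cast_nonneg _

end SkewQSym

/-! ### The determinantal expansion of Schur functions in dual immaculate functions, by chains. -/

namespace SkewQSym

/-! ### Shifted rows, numbered from the bottom -/

section Shifted

variable {l L N M : ℕ} {e : ℕ → ℤ}

/-- The row lengths, from the top, of a vector shifted by the staircase, from the bottom. -/
def shiftedRow (b : Fin l → ℕ) (r : ℕ) : ℕ :=
  if h : r < l then b (Fin.rev ⟨r, h⟩) - (Fin.rev ⟨r, h⟩ : Fin l) else 0

lemma shiftedRow_rev (b : Fin l → ℕ) (i : Fin l) : shiftedRow b (Fin.rev i) = b i - i := by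
  rw [shiftedRow, dif_pos (Fin.rev i).2]
  simp only [Fin.eta, Fin.rev_rev]

lemma shiftedRow_of_le (b : Fin l → ℕ) {r : ℕ} (h : l ≤ r) : shiftedRow b r = 0 :=
  dif_neg (not_lt.2 h)

lemma forall_row_iff {p : ℕ → Prop} (hp : ∀ r, l ≤ r → p r) :
    (∀ r, p r) ↔ ∀ i : Fin l, p (Fin.rev i) := by
  refine ⟨fun h i => h _, fun h r => ?_⟩
  rcases lt_or_ge r l with hr | hr
  · have := h (Fin.rev ⟨r, hr⟩)
    rwa [Fin.rev_rev] at this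
  · exact hp r hr

/-- Truncated subtraction loses information unless every entry is at least its index, hence the
recurring hypothesis `i ≤ b i`. -/
lemma shiftedRow_injOn : Set.InjOn shiftedRow {b : Fin l → ℕ | ∀ i : Fin l, (i : ℕ) ≤ b i} := by
  intro b hb b' hb' h
  funext i
  have h1 := congrFun h (Fin.rev i)
  rw [shiftedRow_rev, shiftedRow_rev] at h1
  have h2 := hb i
  have h3 := hb' i
  omega

lemma exists_shiftedRow {γ : ℕ → ℕ} {a : Fin l → ℕ} (ha : ∀ i : Fin l, (i : ℕ) ≤ a i)
    (h : γ ≤ shiftedRow a) : ∃ b : Fin l → ℕ, (∀ i : Fin l, (i : ℕ) ≤ b i) ∧ (∀ i, b i ≤ a i) ∧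
      shiftedRow b = γ := by
  refine ⟨fun i => γ (Fin.rev i) + i, fun i => Nat.le_add_left _ _, fun i => ?_, ?_⟩
  · have h1 : γ (Fin.rev i) ≤ shiftedRow a (Fin.rev i) := h _
    rw [shiftedRow_rev] at h1
    have h2 := ha i
    change γ (Fin.rev i) + i ≤ a i
    omega
  · funext r
    revert r
    rw [forall_row_iff (l := l)]
    · intro i
      rw [shiftedRow_rev, Nat.add_sub_cancel]
    · intro r hr
      have h1 : γ r ≤ shiftedRow a r := h r
      rw [shiftedRow_of_le _ hr] at *
      omega

lemma rowSum_shiftedRow (hl : l ≤ L) {b : Fin l → ℕ} (hb : ∀ i : Fin l, (i : ℕ) ≤ b i) :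
    ∑ r ∈ Finset.range L, (shiftedRow b r : ℤ) = ∑ i, (b i : ℤ) - ∑ i : Fin l, (i : ℤ) := by
  have h1 : ∑ r ∈ Finset.range L, (shiftedRow b r : ℤ) =
      ∑ r ∈ Finset.range l, (shiftedRow b r : ℤ) := by
    refine (Finset.sum_subset (Finset.range_mono hl) fun r _ hr => ?_).symm
    rw [shiftedRow_of_le _ (by simpa using hr), Nat.cast_zero]
  rw [h1, ← Fin.sum_univ_eq_sum_range (fun r => (shiftedRow b r : ℤ)), ← Finset.sum_sub_distrib]
  refine Fintype.sum_equiv Fin.revPerm _ _ fun i => ?_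
  have h2 := shiftedRow_rev b (Fin.rev i)
  rw [Fin.rev_rev] at h2
  have h3 := hb (Fin.rev i)
  rw [h2, Fin.revPerm_apply]
  omega

/-- The number of towers of horizontal strips of a shifted shape. -/
noncomputable def stripCount (L : ℕ) (e : ℕ → ℤ) (N : ℕ) (b : Fin l → ℕ) : ℕ :=
  (chains Strip L N e 0 (shiftedRow b)).ncard

open Classical in
/-- The number of immaculate chains of a shifted shape whose rows, except possibly the last, are
nonempty. -/
noncomputable def immaculateCount (L : ℕ) (e : ℕ → ℤ) (N : ℕ) (b : Fin l → ℕ) : ℕ :=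
  if ∀ i : Fin l, 0 < (i : ℕ) → (i : ℕ) < b i then
    (chains ImmaculateStep L N e 0 (shiftedRow b)).ncard else 0

/-- The interval of the values that `b j` may take if `b` interlaces with `a`. -/
def InGap (a : Fin l → ℕ) (j : Fin l) (x : ℕ) : Prop :=
  x ≤ a j ∧ ∀ k : Fin l, (k : ℕ) + 1 = j → a k < x

/-- The common form of the two recursions on the last step: a sum over shapes becomes a sum over a
box of vectors, on which a condition `P` and a count `f` may replace the relation `R` and the chain
count. -/
lemma sum_candidates {R : (ℕ → ℕ) → (ℕ → ℕ) → Prop} (hR : ∀ α β, R α β → α ≤ β) (hl : l ≤ L)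
    {a : Fin l → ℕ} (ha : ∀ i : Fin l, (i : ℕ) ≤ a i) (hM : ∀ i, a i < M) (P : (Fin l → ℕ) → Prop)
    (f : (Fin l → ℕ) → ℕ) [DecidablePred P]
    (h1 : ∀ b : Fin l → ℕ, (∀ i : Fin l, (i : ℕ) ≤ b i) → R (shiftedRow b) (shiftedRow a) →
      P b ∧ f b = (chains R L N e 0 (shiftedRow b)).ncard)
    (h2 : ∀ b : Fin l → ℕ, P b → f b ≠ 0 →
      (∀ i : Fin l, (i : ℕ) ≤ b i) ∧ R (shiftedRow b) (shiftedRow a)) :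
    (chains R L (N + 1) e 0 (shiftedRow a)).ncard =
      ∑ b ∈ Fintype.piFinset fun _ : Fin l => Finset.range M,
        if P b ∧ ∑ i, (a i : ℤ) - ∑ i, (b i : ℤ) = e N then f b else 0 := by
  classical
  rw [ncard_chains_succ hR (fun i hi => shiftedRow_of_le a (hl.trans hi))
    (((Fintype.piFinset fun _ : Fin l => Finset.range M).filter
      fun b => ∀ i : Fin l, (i : ℕ) ≤ b i).image shiftedRow), Finset.sum_image, Finset.sum_filter]
  · refine Finset.sum_congr rfl fun b _ => ?_
    by_cases hb : ∀ i : Fin l, (i : ℕ) ≤ b i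
    · rw [if_pos hb, rowSum_shiftedRow hl ha, rowSum_shiftedRow hl hb, sub_sub_sub_cancel_right]
      by_cases hr : R (shiftedRow b) (shiftedRow a)
      · obtain ⟨h3, h4⟩ := h1 b hb hr
        simp only [hr, h3, h4, true_and]
      · simp only [hr, false_and, if_false]
        split_ifs with h3
        · by_contra h4
          exact hr (h2 b h3.1 (Ne.symm h4)).2
        · rfl
    · rw [if_neg hb]
      split_ifs with h3
      · by_contra h4
        exact hb (h2 b h3.1 (Ne.symm h4)).1
      · rfl
  · intro b hb b' hb' h
    exact shiftedRow_injOn (Finset.mem_filter.1 hb).2 (Finset.mem_filter.1 hb').2 h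
  · intro γ hγ
    obtain ⟨b, h3, h4, h5⟩ := exists_shiftedRow ha (hR _ _ hγ)
    refine Finset.mem_image.2 ⟨b, Finset.mem_filter.2 ⟨?_, h3⟩, h5⟩
    exact Fintype.mem_piFinset.2 fun i => Finset.mem_range.2 ((h4 i).trans_lt (hM i))

lemma shiftedRow_le_iff {a b : Fin l → ℕ} (ha : ∀ i : Fin l, (i : ℕ) ≤ a i) (hb : ∀ i : Fin l, (i : ℕ) ≤ b i) :
    shiftedRow b ≤ shiftedRow a ↔ ∀ i, b i ≤ a i := by
  refine (forall_row_iff (l := l) (p := fun r => shiftedRow b r ≤ shiftedRow a r)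
    fun r hr => ?_).trans (forall_congr' fun i => ?_)
  · rw [shiftedRow_of_le b hr, shiftedRow_of_le a hr]
  · rw [shiftedRow_rev, shiftedRow_rev]
    have h1 := ha i
    have h2 := hb i
    omega

-- Once the last row of `a` is nonempty, an immaculate step requires all higher rows of `b` to be
-- nonempty, which is the condition already built into the count for `b`. What remains is `b ≤ a`, a
-- condition on each row separately.
open Classical in
lemma immaculateCount_succ (hl : l ≤ L) {a : Fin l → ℕ} (ha : ∀ i, 1 ≤ a i) (hM : ∀ i, a i < M) :
    immaculateCount L e (N + 1) a = ∑ b ∈ Fintype.piFinset fun _ : Fin l => Finset.range M,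
      if (∀ i, b i ≤ a i) ∧ ∑ i, (a i : ℤ) - ∑ i, (b i : ℤ) = e N
      then immaculateCount L e N b else 0 := by
  by_cases hv : ∀ i : Fin l, 0 < (i : ℕ) → (i : ℕ) < a i
  · have hlt : ∀ i : Fin l, (i : ℕ) < a i := fun i => by
      rcases Nat.eq_zero_or_pos (i : ℕ) with h | h
      · rw [h]
        exact ha i
      · exact hv i h
    have hle : ∀ i : Fin l, (i : ℕ) ≤ a i := fun i => (hlt i).le
    rw [immaculateCount, if_pos hv]
    refine sum_candidates (fun _ _ h => h.1) hl hle hM _ _ (fun b hb hr => ?_) fun b hb h0 => ?_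
    · refine ⟨(shiftedRow_le_iff hle hb).1 hr.1, ?_⟩
      rw [immaculateCount, if_pos]
      intro i hi
      have h1 := hr.2 (Fin.rev i) (Fin.rev (⟨0, by omega⟩ : Fin l))
        (by simp only [Fin.val_rev]; omega)
      rw [shiftedRow_rev, shiftedRow_rev] at h1
      have h2 := hlt ⟨0, by omega⟩
      simp only at h1 h2
      omega
    · rw [immaculateCount] at h0
      split_ifs at h0 with h1
      · have h2 : ∀ i : Fin l, (i : ℕ) ≤ b i := fun i => by
          rcases Nat.eq_zero_or_pos (i : ℕ) with h | h
          · rw [h]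
            exact Nat.zero_le _
          · exact (h1 i h).le
        refine ⟨h2, (shiftedRow_le_iff hle h2).2 hb, fun r s hrs hs => ?_⟩
        have hs' : s < l := by
          by_contra h
          rw [shiftedRow_of_le a (not_lt.1 h)] at hs
          omega
        have h3 := shiftedRow_rev b (Fin.rev ⟨r, by omega⟩)
        rw [Fin.rev_rev] at h3
        have h4 := h1 (Fin.rev ⟨r, by omega⟩) (by simp only [Fin.val_rev]; omega)
        simp only at h3
        omega
      · exact absurd rfl h0
  · rw [immaculateCount, if_neg hv]
    push Not at hv
    obtain ⟨i, hi, h⟩ := hv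
    refine (Finset.sum_eq_zero fun b _ => ?_).symm
    split_ifs with h1
    · rw [immaculateCount, if_neg]
      intro h2
      have := h2 i hi
      have := h1.1 i
      omega
    · rfl

lemma le_of_strictMono {a : Fin l → ℕ} (ha : StrictMono a) (i : Fin l) : (i : ℕ) ≤ a i := by
  obtain ⟨i, hi⟩ := i
  induction i with
  | zero => exact Nat.zero_le _
  | succ i ih =>
    have h1 := ih (by omega)
    have h2 : a ⟨i, by omega⟩ < a ⟨i + 1, hi⟩ := ha (Nat.lt_succ_self i)
    simp only at *
    omega

lemma le_of_inGap {a b : Fin l → ℕ} (ha : StrictMono a) (h : ∀ j, InGap a j (b j)) (i : Fin l) :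
    (i : ℕ) ≤ b i := by
  obtain ⟨i, hi⟩ := i
  cases i with
  | zero => exact Nat.zero_le _
  | succ i =>
    have h1 := (h ⟨i + 1, hi⟩).2 ⟨i, by omega⟩ rfl
    have h2 := le_of_strictMono ha ⟨i, by omega⟩
    simp only at *
    omega

/-- After adding the staircase, horizontal strips become interlacing with one strict inequality, so
the possible values of the `b j` form disjoint intervals. -/
lemma strip_shiftedRow_iff {a b : Fin l → ℕ} (ha : ∀ i : Fin l, (i : ℕ) ≤ a i)
    (hb : ∀ i : Fin l, (i : ℕ) ≤ b i) :
    Strip (shiftedRow b) (shiftedRow a) ↔ ∀ j, InGap a j (b j) := by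
  rw [Strip, shiftedRow_le_iff ha hb]
  unfold InGap
  rw [forall_and]
  refine and_congr_right fun _ => ?_
  refine (forall_row_iff (l := l) (p := fun r => shiftedRow a (r + 1) ≤ shiftedRow b r)
    fun r hr => ?_).trans (forall_congr' fun i => ?_)
  · rw [shiftedRow_of_le a (by omega)]
    exact Nat.zero_le _
  · rw [shiftedRow_rev]
    constructor
    · intro h k hk
      have h1 := shiftedRow_rev a k
      have h2 : (Fin.rev i : ℕ) + 1 = Fin.rev k := by
        simp only [Fin.val_rev]
        omega
      rw [h2, h1] at h
      have := ha k
      have := hb i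
      omega
    · intro h
      rcases Nat.eq_zero_or_pos (i : ℕ) with hi | hi
      · rw [shiftedRow_of_le a (by simp only [Fin.val_rev]; omega)]
        exact Nat.zero_le _
      · have h0 := h ⟨i - 1, by omega⟩ (by simp only; omega)
        have h1 := shiftedRow_rev a ⟨i - 1, by omega⟩
        have h2 : (Fin.rev i : ℕ) + 1 = Fin.rev (⟨i - 1, by omega⟩ : Fin l) := by
          simp only [Fin.val_rev]
          omega
        rw [h2, h1]
        have := ha ⟨i - 1, by omega⟩
        have := hb i
        simp only at *
        omega

open Classical in
lemma stripCount_succ (hl : l ≤ L) {a : Fin l → ℕ} (ha : StrictMono a) (hM : ∀ i, a i < M) :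
    stripCount L e (N + 1) a = ∑ b ∈ Fintype.piFinset fun _ : Fin l => Finset.range M,
      if (∀ j, InGap a j (b j)) ∧ ∑ i, (a i : ℤ) - ∑ i, (b i : ℤ) = e N
      then stripCount L e N b else 0 := by
  have hle := le_of_strictMono ha
  refine sum_candidates (fun _ _ h => h.1) hl hle hM _ _ (fun b hb hr => ?_) fun b hb _ => ?_
  · exact ⟨(strip_shiftedRow_iff hle hb).1 hr, rfl⟩
  · exact ⟨le_of_inGap ha hb, (strip_shiftedRow_iff hle (le_of_inGap ha hb)).2 hb⟩

open Classical in
/-- Column operations turn the conditions `b i ≤ a j` into `a (j - 1) < b i ≤ a j`. -/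
lemma signed_sum_gap {a : Fin l → ℕ} (ha : StrictMono a) (b : Fin l → ℕ) :
    (∑ σ : Equiv.Perm (Fin l), (Equiv.Perm.sign σ : ℤ) * if ∀ i, b i ≤ a (σ i) then 1 else 0) =
      ∑ σ : Equiv.Perm (Fin l),
        (Equiv.Perm.sign σ : ℤ) * if ∀ i, InGap a (σ i) (b i) then 1 else 0 := by
  have h1 : ∀ p : Fin l → Fin l → Prop, (∑ σ : Equiv.Perm (Fin l),
      (Equiv.Perm.sign σ : ℤ) * if ∀ i, p (σ i) i then 1 else 0) =
      Matrix.det (Matrix.of fun j i => if p j i then (1 : ℤ) else 0) := by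
    intro p
    rw [Matrix.det_apply']
    refine Finset.sum_congr rfl fun σ _ => ?_
    congr 1
    simp only [Matrix.of_apply]
    rw [Fintype.prod_boole]
    congr
  suffices h2 : Matrix.det (Matrix.of fun j i => if b i ≤ a j then (1 : ℤ) else 0) =
      Matrix.det (Matrix.of fun j i => if InGap a j (b i) then (1 : ℤ) else 0) by
    convert h2 using 1
    · convert h1 fun j i => b i ≤ a j
    · convert h1 fun j i => InGap a j (b i)
  clear h1
  match l, a, b, ha with
  | 0, _, _, _ => rfl
  | n + 1, a, b, ha =>
    -- Subtracting from each row its predecessor turns the indicator of `b i ≤ a j` into that of the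
    -- gap below `a j`, without changing the determinant.
    refine Matrix.det_eq_of_forall_row_eq_smul_add_pred (fun _ => 1) (fun i => ?_) fun j i => ?_
    · rw [Matrix.of_apply, Matrix.of_apply]
      refine if_congr ⟨fun h => ⟨h, fun k hk => ?_⟩, fun h => h.1⟩ rfl rfl
      simp at hk
    · rw [Matrix.of_apply, Matrix.of_apply, Matrix.of_apply, one_mul]
      have h2 : a j.castSucc < a j.succ := ha j.castSucc_lt_succ
      have h3 : InGap a j.succ (b i) ↔ b i ≤ a j.succ ∧ a j.castSucc < b i := by
        refine and_congr_right fun _ => ⟨fun h => h _ (by simp), fun h k hk => ?_⟩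
        have : k = j.castSucc := Fin.ext (by simpa using hk)
        rwa [this]
      simp only [h3]
      split_ifs <;> omega

/-- The entry at index 0 describes the last row. If it is 0 that row is empty and can be deleted;
the staircase then drops by one. -/
lemma shiftedRow_of_zero {n : ℕ} {c : Fin (n + 1) → ℕ} (hc : c 0 = 0) :
    shiftedRow c = shiftedRow fun i : Fin n => c i.succ - 1 := by
  funext r
  rcases lt_trichotomy r n with h | h | h
  · rw [shiftedRow, shiftedRow, dif_pos h, dif_pos (by omega)]
    have h1 : Fin.rev (⟨r, by omega⟩ : Fin (n + 1)) = (Fin.rev (⟨r, h⟩ : Fin n)).succ := by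
      ext
      simp only [Fin.val_rev, Fin.val_succ]
      omega
    rw [h1, Fin.val_succ]
    omega
  · subst h
    rw [shiftedRow_of_le _ le_rfl, shiftedRow, dif_pos (Nat.lt_succ_self _)]
    have h1 : Fin.rev (⟨r, by omega⟩ : Fin (r + 1)) = 0 := by
      ext
      simp only [Fin.val_rev, Fin.val_zero]
      omega
    rw [h1, hc]
    rfl
  · rw [shiftedRow_of_le _ (by omega), shiftedRow_of_le _ (by omega)]

/-- The row that becomes the last one loses its nonemptiness requirement in the count; the
hypothesis `2 ≤ c i.succ` supplies it on the longer side. -/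
lemma immaculateCount_of_zero {n : ℕ} {c : Fin (n + 1) → ℕ} (hc : c 0 = 0)
    (h1 : ∀ i : Fin n, 2 ≤ c i.succ) :
    immaculateCount L e N c = immaculateCount L e N fun i : Fin n => c i.succ - 1 := by
  rw [immaculateCount, immaculateCount, shiftedRow_of_zero hc]
  refine if_congr ⟨fun h i hi => ?_, fun h i hi => ?_⟩ rfl rfl
  · have := h i.succ (by simp)
    rw [Fin.val_succ] at this
    omega
  · obtain ⟨i, rfl⟩ := Fin.exists_succ_eq.2 (show i ≠ 0 from fun h0 => by
      rw [h0] at hi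
      exact absurd hi (lt_irrefl _))
    have h2 := h1 i
    rw [Fin.val_succ]
    rcases Nat.eq_zero_or_pos (i : ℕ) with h0 | h0
    · omega
    · have := h i h0
      omega

/-- Removing an empty last row. -/
lemma signed_sum_of_zero {n : ℕ} {c : Fin (n + 1) → ℕ} (hc : c 0 = 0)
    (h1 : ∀ i : Fin n, 2 ≤ c i.succ) :
    (∑ σ : Equiv.Perm (Fin (n + 1)), (Equiv.Perm.sign σ : ℤ) * immaculateCount L e N (c ∘ σ)) =
      ∑ σ : Equiv.Perm (Fin n), (Equiv.Perm.sign σ : ℤ) *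
        immaculateCount L e N ((fun i : Fin n => c i.succ - 1) ∘ σ) := by
  rw [← Equiv.sum_comp (Equiv.Perm.decomposeFin (n := n)).symm, Fintype.sum_prod_type,
    Finset.sum_eq_single 0]
  · refine Finset.sum_congr rfl fun σ _ => ?_
    rw [Equiv.Perm.decomposeFin.symm_sign, if_pos rfl, one_mul, immaculateCount_of_zero]
    · congr 2
    · rw [Function.comp_apply, Equiv.Perm.decomposeFin_symm_apply_zero, hc]
    · intro i
      simpa using h1 (σ i)
  -- If the permutation moves the entry 0 away from the last row, a higher row violates the
  -- requirement of `immaculateCount`, and the term vanishes.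
  · intro p _ hp
    refine Finset.sum_eq_zero fun σ _ => ?_
    rw [immaculateCount, if_neg, Nat.cast_zero, mul_zero]
    intro h
    set τ := Equiv.Perm.decomposeFin.symm (p, σ) with hτ
    have h2 : τ.symm 0 ≠ 0 := by
      intro h2
      rw [Equiv.symm_apply_eq, hτ, Equiv.Perm.decomposeFin_symm_apply_zero] at h2
      exact hp h2.symm
    have h3 := h (τ.symm 0) (Fin.pos_iff_ne_zero.2 h2)
    rw [Function.comp_apply, Equiv.apply_symm_apply, hc] at h3
    omega
  · exact fun h => absurd (Finset.mem_univ _) h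

/-- The determinantal expansion of a Schur function in dual immaculate functions, for chains. -/
theorem stripCount_eq_signed_sum (L : ℕ) (e : ℕ → ℤ) (N : ℕ) : ∀ (l : ℕ), l ≤ L →
    ∀ a : Fin l → ℕ, StrictMono a → (∀ i, 1 ≤ a i) →
    (stripCount L e N a : ℤ) =
      ∑ σ : Equiv.Perm (Fin l), (Equiv.Perm.sign σ : ℤ) * immaculateCount L e N (a ∘ σ) := by
  classical
  induction N with
  | zero =>
    intro l hl a ha h1
    cases l with
    | zero =>
      rw [Fintype.sum_unique, stripCount, immaculateCount, if_pos fun i => i.elim0,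
        ncard_chains_zero, ncard_chains_zero]
      have h2 : ∀ b : Fin 0 → ℕ, (0 : ℕ → ℕ) = shiftedRow b := fun b =>
        funext fun r => (shiftedRow_of_le b (Nat.zero_le r)).symm
      rw [if_pos (h2 _), if_pos (h2 _)]
      simp
    | succ n =>
      have h2 : ∀ b : Fin (n + 1) → ℕ, 1 ≤ b 0 → (0 : ℕ → ℕ) ≠ shiftedRow b := by
        intro b hb h
        have h3 := congrFun h (Fin.rev (0 : Fin (n + 1)))
        rw [shiftedRow_rev, Pi.zero_apply, Fin.val_zero] at h3
        omega
      rw [stripCount, ncard_chains_zero, if_neg (h2 _ (h1 _)), Finset.sum_eq_zero]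
      · rfl
      · intro σ _
        rw [immaculateCount, ncard_chains_zero, if_neg (h2 (a ∘ σ) (h1 _))]
        simp
  | succ N ih =>
    intro l hl a ha h1
    obtain ⟨M, hM⟩ : ∃ M, ∀ i, a i < M :=
      ⟨Finset.univ.sup a + 1, fun i => Nat.lt_succ_of_le (Finset.le_sup (Finset.mem_univ i))⟩
    -- Interlacing with `a` keeps `c` strictly increasing, but its first entry may be 0. The
    -- induction hypothesis then applies to the vector with the empty last row removed, and so `l`
    -- is not fixed in the induction.
    have ih' : ∀ c : Fin l → ℕ, (∀ j, InGap a j (c j)) → (stripCount L e N c : ℤ) =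
        ∑ σ : Equiv.Perm (Fin l), (Equiv.Perm.sign σ : ℤ) * immaculateCount L e N (c ∘ σ) := by
      intro c hc
      cases l with
      | zero => exact ih 0 hl c (fun i => i.elim0) fun i => i.elim0
      | succ n =>
        have hgap : ∀ i : Fin n, a i.castSucc < c i.succ := fun i => (hc i.succ).2 _ (by simp)
        have hmono : StrictMono c := Fin.strictMono_iff_lt_succ.2 fun i =>
          ((hc i.castSucc).1).trans_lt (hgap i)
        rcases Nat.eq_zero_or_pos (c 0) with h0 | h0
        · have h2 : ∀ i : Fin n, 2 ≤ c i.succ := fun i => by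
            have := hgap i
            have := h1 i.castSucc
            omega
          rw [signed_sum_of_zero h0 h2, ← ih n (by omega), stripCount, stripCount,
            shiftedRow_of_zero h0]
          · intro i j hij
            have h3 : c i.succ < c j.succ := hmono (Fin.succ_lt_succ_iff.2 hij)
            have := h2 i
            simp only
            omega
          · intro i
            have := h2 i
            omega
        · exact ih (n + 1) hl c hmono fun i =>
            Nat.succ_le_of_lt (h0.trans_le (hmono.monotone (Fin.zero_le i)))
    have hsum : ∀ (σ : Equiv.Perm (Fin l)) (b : Fin l → ℕ),
        ∑ i, ((b ∘ σ) i : ℤ) = ∑ i, (b i : ℤ) := fun σ b => Equiv.sum_comp σ fun i => (b i : ℤ)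
    set W := Fintype.piFinset fun _ : Fin l => Finset.range M with hW
    -- Remove the last strip, apply the induction hypothesis, and collect for each vector `b` the
    -- signed number of ways in which a permutation of it interlaces with `a`. This signed number is
    -- a determinant; `signed_sum_gap` replaces the interlacing by `b i ≤ a (σ i)`, which is the
    -- recursion for immaculate chains.
    calc (stripCount L e (N + 1) a : ℤ)
        = ∑ c ∈ W, if (∀ j, InGap a j (c j)) ∧ ∑ i, (a i : ℤ) - ∑ i, (c i : ℤ) = e N
            then ∑ σ : Equiv.Perm (Fin l),
              (Equiv.Perm.sign σ : ℤ) * immaculateCount L e N (c ∘ σ) else 0 := by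
          rw [stripCount_succ hl ha hM, Nat.cast_sum]
          refine Finset.sum_congr rfl fun c _ => ?_
          split_ifs with h
          · exact ih' c h.1
          · rfl
      _ = ∑ c ∈ W, ∑ σ : Equiv.Perm (Fin l),
            if (∀ j, InGap a j (c j)) ∧ ∑ i, (a i : ℤ) - ∑ i, (c i : ℤ) = e N
            then (Equiv.Perm.sign σ : ℤ) * immaculateCount L e N (c ∘ σ) else 0 := by
          refine Finset.sum_congr rfl fun c _ => ?_
          split_ifs
          · rfl
          · rw [Finset.sum_const_zero]
      _ = ∑ σ : Equiv.Perm (Fin l), ∑ c ∈ W,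
            if (∀ j, InGap a j (c j)) ∧ ∑ i, (a i : ℤ) - ∑ i, (c i : ℤ) = e N
            then (Equiv.Perm.sign σ : ℤ) * immaculateCount L e N (c ∘ σ) else 0 := Finset.sum_comm
      _ = ∑ σ : Equiv.Perm (Fin l), ∑ b ∈ W,
            if (∀ i, InGap a (σ i) (b i)) ∧ ∑ i, (a i : ℤ) - ∑ i, (b i : ℤ) = e N
            then (Equiv.Perm.sign σ : ℤ) * immaculateCount L e N b else 0 := by
          refine Finset.sum_congr rfl fun σ _ => ?_
          refine Finset.sum_nbij' (fun c => c ∘ σ) (fun b => b ∘ σ.symm) ?_ ?_ ?_ ?_ ?_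
          · intro c hc
            rw [hW, Fintype.mem_piFinset] at *
            exact fun i => hc (σ i)
          · intro c hc
            rw [hW, Fintype.mem_piFinset] at *
            exact fun i => hc (σ.symm i)
          · intro c _
            funext i
            simp
          · intro c _
            funext i
            simp
          · intro c _
            rw [hsum]
            refine if_congr (and_congr_left fun _ => ?_) rfl rfl
            exact (Equiv.forall_congr_left (e := σ) (p := fun i => InGap a (σ i) ((c ∘ σ) i)) |>.trans
              (forall_congr' fun j => by simp)).symm
      _ = ∑ b ∈ W, (if ∑ i, (a i : ℤ) - ∑ i, (b i : ℤ) = e N then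
            (immaculateCount L e N b : ℤ) else 0) * ∑ σ : Equiv.Perm (Fin l),
              (Equiv.Perm.sign σ : ℤ) * if ∀ i, InGap a (σ i) (b i) then 1 else 0 := by
          rw [Finset.sum_comm]
          refine Finset.sum_congr rfl fun b _ => ?_
          rw [Finset.mul_sum]
          refine Finset.sum_congr rfl fun σ _ => ?_
          by_cases h2 : ∀ i, InGap a (σ i) (b i) <;>
            by_cases h3 : ∑ i, (a i : ℤ) - ∑ i, (b i : ℤ) = e N <;> simp [h2, h3, mul_comm]
      _ = ∑ b ∈ W, (if ∑ i, (a i : ℤ) - ∑ i, (b i : ℤ) = e N then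
            (immaculateCount L e N b : ℤ) else 0) * ∑ σ : Equiv.Perm (Fin l),
              (Equiv.Perm.sign σ : ℤ) * if ∀ i, b i ≤ a (σ i) then 1 else 0 := by
          refine Finset.sum_congr rfl fun b _ => ?_
          congr 1
          convert (signed_sum_gap ha b).symm
      _ = ∑ σ : Equiv.Perm (Fin l), ∑ b ∈ W,
            if (∀ i, b i ≤ (a ∘ σ) i) ∧ ∑ i, ((a ∘ σ) i : ℤ) - ∑ i, (b i : ℤ) = e N
            then (Equiv.Perm.sign σ : ℤ) * immaculateCount L e N b else 0 := by
          rw [Finset.sum_comm]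
          refine Finset.sum_congr rfl fun b _ => ?_
          rw [Finset.mul_sum]
          refine Finset.sum_congr rfl fun σ _ => ?_
          rw [hsum]
          simp only [Function.comp_apply]
          by_cases h2 : ∀ i, b i ≤ a (σ i) <;>
            by_cases h3 : ∑ i, (a i : ℤ) - ∑ i, (b i : ℤ) = e N <;> simp [h2, h3, mul_comm]
      _ = ∑ σ : Equiv.Perm (Fin l),
            (Equiv.Perm.sign σ : ℤ) * immaculateCount L e (N + 1) (a ∘ σ) := by
          refine Finset.sum_congr rfl fun σ _ => ?_
          rw [immaculateCount_succ (a := a ∘ σ) (M := M) hl (fun i => h1 (σ i)) (fun i => hM (σ i)),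
            Nat.cast_sum, Finset.mul_sum]
          refine Finset.sum_congr rfl fun b _ => ?_
          split_ifs
          · rfl
          · simp

end Shifted

end SkewQSym

/-! ### Disjoint expansions, and the dual immaculate basis. -/

namespace SkewQSym

/-! ### Bases into which the Schur functions expand with disjoint supports -/

section Disjoint

variable {ι : Type} {B : ι → Series} {f g : Series} {c d : YoungDiagram →₀ ℚ}

/-- An expansion of the Schur functions in a basis, with disjoint supports and a coefficient `1`
in every expansion. -/
structure IsDisjointExpansion (B : ι → Series) (e : YoungDiagram → ι →₀ ℚ)
    (key : YoungDiagram → ι) : Prop where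
  indep : LinearIndependent ℚ B
  expansion : ∀ μ, IsExpansion B (e μ) (schur μ)
  key_eq_one : ∀ μ, e μ (key μ) = 1
  disjoint : ∀ μ ν i, e μ i ≠ 0 → e ν i ≠ 0 → μ = ν

variable {e : YoungDiagram → ι →₀ ℚ} {key : YoungDiagram → ι}

/-- By disjointness a basis index sees at most one Schur coefficient, so nothing can cancel. -/
lemma IsDisjointExpansion.apply (h : IsDisjointExpansion B e key) {μ : YoungDiagram} {i : ι}
    (hi : e μ i ≠ 0) (c : YoungDiagram →₀ ℚ) :
    Finsupp.linearCombination ℚ e c i = c μ * e μ i := by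
  rw [linearCombination_finsupp_apply]
  refine Finset.sum_eq_single μ (fun ν _ hν => ?_) fun hμ => ?_
  · by_contra h0
    exact hν (h.disjoint ν μ i (right_ne_zero_of_mul h0) hi)
  · rw [Finsupp.notMem_support_iff.1 hμ, zero_mul]

lemma IsDisjointExpansion.apply_key (h : IsDisjointExpansion B e key) (μ : YoungDiagram)
    (c : YoungDiagram →₀ ℚ) : Finsupp.linearCombination ℚ e c (key μ) = c μ := by
  rw [h.apply (μ := μ) (by rw [h.key_eq_one]; exact one_ne_zero), h.key_eq_one, mul_one]

lemma exists_of_linearCombination_ne {i : ι} (h : Finsupp.linearCombination ℚ e c i ≠ 0) :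
    ∃ μ, e μ i ≠ 0 := by
  rw [linearCombination_finsupp_apply] at h
  obtain ⟨μ, _, h1⟩ := Finset.exists_ne_zero_of_sum_ne_zero h
  exact ⟨μ, right_ne_zero_of_mul h1⟩

lemma IsDisjointExpansion.linearIndependent_schur (h : IsDisjointExpansion B e key) :
    LinearIndependent ℚ schur := by
  rw [linearIndependent_iff]
  intro c hc
  have h1 := IsExpansion.bind h.expansion (show IsExpansion schur c 0 from hc)
  have h2 := IsExpansion.unique h.indep h1 (show IsExpansion B 0 0 from map_zero _)
  ext μ
  rw [← h.apply_key μ c, h2]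
  rfl

lemma IsDisjointExpansion.existsUnique (h : IsDisjointExpansion B e key)
    (hc : IsExpansion schur c f) : ∃! c, IsExpansion B c f :=
  (IsExpansion.bind h.expansion hc).existsUnique h.indep

lemma IsDisjointExpansion.isPositive_schur (h : IsDisjointExpansion B e key)
    (hc : IsExpansion schur c f) (hf : IsPositive B f) : IsPositive schur f := by
  rw [(IsExpansion.bind h.expansion hc).isPositive_iff h.indep] at hf
  refine ⟨c, hc, fun μ => ?_⟩
  rw [← h.apply_key μ c]
  exact hf _

lemma IsDisjointExpansion.isPositive_iff (h : IsDisjointExpansion B e key)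
    (he : ∀ μ i, 0 ≤ e μ i) (hc : IsExpansion schur c f) :
    IsPositive B f ↔ IsPositive schur f := by
  refine ⟨h.isPositive_schur hc, fun ⟨c, hc, h0⟩ => ?_⟩
  refine ⟨_, IsExpansion.bind h.expansion hc, fun i => ?_⟩
  rw [linearCombination_finsupp_apply]
  exact Finset.sum_nonneg fun μ _ => mul_nonneg (h0 μ) (he μ i)

lemma IsDisjointExpansion.nzSupport_iff (h : IsDisjointExpansion B e key)
    (hc : IsExpansion schur c f) (hd : IsExpansion schur d g) :
    nzSupport B g ⊆ nzSupport B f ↔ nzSupport schur g ⊆ nzSupport schur f := by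
  have hs := h.linearIndependent_schur
  simp only [Set.subset_def, hc.mem_nzSupport_iff hs, hd.mem_nzSupport_iff hs,
    (IsExpansion.bind h.expansion hc).mem_nzSupport_iff h.indep,
    (IsExpansion.bind h.expansion hd).mem_nzSupport_iff h.indep]
  constructor
  · intro h1 μ
    have := h1 (key μ)
    rwa [h.apply_key, h.apply_key] at this
  · intro h1 i hi
    obtain ⟨μ, hμ⟩ := exists_of_linearCombination_ne hi
    rw [h.apply hμ] at *
    exact mul_ne_zero (h1 μ (left_ne_zero_of_mul hi)) hμ

/-- Signs in `e` are harmless: with nonnegative Schur coefficients, the sign of the coefficient at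
an index depends only on `e`, and the key of each μ, where `e` is 1, always records μ. -/
lemma IsDisjointExpansion.posSupport_iff (h : IsDisjointExpansion B e key)
    (hc : IsExpansion schur c f) (hd : IsExpansion schur d g) (hc0 : ∀ μ, 0 ≤ c μ)
    (hd0 : ∀ μ, 0 ≤ d μ) :
    posSupport B g ⊆ posSupport B f ↔ nzSupport schur g ⊆ nzSupport schur f := by
  have hs := h.linearIndependent_schur
  simp only [Set.subset_def, hc.mem_nzSupport_iff hs, hd.mem_nzSupport_iff hs,
    (IsExpansion.bind h.expansion hc).mem_posSupport_iff h.indep,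
    (IsExpansion.bind h.expansion hd).mem_posSupport_iff h.indep]
  constructor
  · intro h1 μ hμ
    have := h1 (key μ)
    rw [h.apply_key, h.apply_key] at this
    exact (this ((hd0 μ).lt_of_ne' hμ)).ne'
  · intro h1 i hi
    obtain ⟨μ, hμ⟩ := exists_of_linearCombination_ne hi.ne'
    rw [h.apply hμ] at *
    have hdμ : 0 < d μ := (hd0 μ).lt_of_ne' (left_ne_zero_of_mul hi.ne')
    have heμ : 0 < e μ i := pos_of_mul_pos_right hi (hd0 μ)
    exact mul_pos ((hc0 μ).lt_of_ne' (h1 μ hdμ.ne')) heμ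

end Disjoint

/-! ### Dual immaculate functions -/

lemma compRow_injective {α β : Comp} (h : ∀ i, compRow α i = compRow β i) : α = β := by
  have hl : α.2.blocks.length = β.2.blocks.length := by
    have h1 : ∀ i, i < α.2.blocks.length ↔ i < β.2.blocks.length := fun i => by
      rw [Composition.blocks_length, Composition.blocks_length, ← compRow_pos, ← compRow_pos, h]
    have h2 := h1 α.2.blocks.length
    have h3 := h1 β.2.blocks.length
    omega
  refine comp_ext (List.ext_getElem hl fun i h1 h2 => ?_)
  have := h i
  rwa [compRow, compRow, List.getD_eq_getElem _ _ h1, List.getD_eq_getElem _ _ h2] at this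

lemma testContent_apply (α : Comp) (i : ℕ) : testContent α i = compRow α i := rfl

lemma card_filter_row {α : Comp} (i : ℕ) :
    ((compCells α).filter fun c => c.1 = i).card = compRow α i := by
  have h : (compCells α).filter (fun c => c.1 = i) =
      (Finset.range (compRow α i)).map ⟨fun j => (i, j), Prod.mk_right_injective i⟩ := by
    ext ⟨a, b⟩
    rw [Finset.mem_filter, mem_compCells, Finset.mem_map]
    constructor
    · rintro ⟨h, rfl⟩
      exact ⟨b, Finset.mem_range.2 h, rfl⟩
    · rintro ⟨j, hj, h⟩
      obtain ⟨rfl, rfl⟩ := Prod.mk.inj h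
      exact ⟨Finset.mem_range.1 hj, rfl⟩
  rw [h, Finset.card_map, Finset.card_range]

/-- The filling of each row with its index. -/
def rowFilling (α : Comp) (i j : ℕ) : ℕ := if (i, j) ∈ compCells α then i else 0

lemma content_rowFilling (α : Comp) {T : ℕ → ℕ → ℕ} (hT : ∀ c ∈ compCells α, T c.1 c.2 = c.1) :
    content (compCells α) T = testContent α := by
  ext v
  rw [content_apply, testContent_apply, ← card_filter_row]
  congr 1
  exact Finset.filter_congr fun c hc => by rw [hT c hc]

lemma FirstColumnStrict.le {α : Comp} {T : ℕ → ℕ → ℕ} (hT : FirstColumnStrict (compCells α) T) :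
    ∀ i, 0 < compRow α i → i ≤ T i 0 := by
  intro i
  induction i with
  | zero => exact fun _ => Nat.zero_le _
  | succ i ih =>
    intro h
    have h1 : 0 < compRow α i := compRow_pos.2 (Nat.lt_of_succ_lt (compRow_pos.1 h))
    have h2 := hT i (i + 1) (Nat.lt_succ_self i) (mem_compCells.2 h1) (mem_compCells.2 h)
    have := ih h1
    omega

/-- The sum of the entries depends only on the content. -/
lemma sum_entries (cells : Finset (ℕ × ℕ)) (T : ℕ → ℕ → ℕ) :
    ∑ c ∈ cells, T c.1 c.2 = (content cells T).sum fun v k => v * k := by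
  rw [content, ← Finsupp.sum_finsetSum_index (fun _ => mul_zero _) (fun _ _ _ => mul_add _ _ _)]
  refine Finset.sum_congr rfl fun c _ => ?_
  rw [Finsupp.sum_single_index (mul_zero _), mul_one]

/-- Entries in row `i` of an immaculate tableau are at least `i`, and the sum of all entries is
determined by the content. Hence the sum of row indices for the shape is at most that for the
content, with equality only if every row is filled with its index. -/
lemma linearIndependent_dualImmaculate : LinearIndependent ℚ dualImmaculate := by
  refine linearIndependent_of_triangular _ testContent
    (fun α => -((∑ c ∈ compCells α, c.1 : ℕ) : ℤ)) (fun α => ?_) fun α β h => ?_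
  · refine fillingSeries_ne_zero.2 ⟨rowFilling α, fun i j h => if_neg h,
      ⟨fun i j₁ j₂ _ h h' => ?_, fun i₁ i₂ hi h h' => ?_⟩,
      content_rowFilling α fun c hc => if_pos hc⟩
    · rw [rowFilling, rowFilling, if_pos h, if_pos h']
    · rwa [rowFilling, rowFilling, if_pos h, if_pos h']
  · obtain ⟨T, -, ⟨hT1, hT2⟩, hc⟩ := fillingSeries_ne_zero.1 h
    have hle : ∀ c ∈ compCells β, c.1 ≤ T c.1 c.2 := by
      rintro ⟨i, j⟩ hij
      have h0 : 0 < compRow β i := Nat.zero_lt_of_lt (mem_compCells.1 hij)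
      refine (hT2.le i h0).trans ?_
      rcases Nat.eq_zero_or_pos j with rfl | hj
      · exact le_rfl
      · exact hT1 i 0 j hj (mem_compCells.2 h0) hij
    have h1 : ∑ c ∈ compCells β, T c.1 c.2 = ∑ c ∈ compCells α, c.1 := by
      rw [sum_entries, hc, ← content_rowFilling α (T := rowFilling α) fun c hc => if_pos hc,
        ← sum_entries]
      exact Finset.sum_congr rfl fun c hc => if_pos hc
    rcases (Finset.sum_le_sum hle).lt_or_eq with h2 | h2
    · right
      omega
    · left
      have h3 : ∀ c ∈ compCells β, T c.1 c.2 = c.1 := fun c hc' =>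
        ((Finset.sum_eq_sum_iff_of_le hle).1 h2 c hc').symm
      have h4 := content_rowFilling β h3
      refine compRow_injective fun i => ?_
      rw [← testContent_apply, ← testContent_apply, ← h4, hc]

section Expansion

variable {l L N : ℕ}

/-- The composition with the given shifted rows. -/
def shiftedComp (b : Fin l → ℕ) (hb : ∀ i : Fin l, (i : ℕ) < b i) : Comp :=
  ⟨_, ⟨List.ofFn fun r : Fin l => b r.rev - (r.rev : ℕ), fun {x} hx => by
    obtain ⟨r, rfl⟩ := List.mem_ofFn.1 hx
    exact Nat.sub_pos_of_lt (hb _), rfl⟩⟩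

lemma length_shiftedComp (b : Fin l → ℕ) (hb : ∀ i : Fin l, (i : ℕ) < b i) :
    (shiftedComp b hb).2.length = l := by
  rw [← Composition.blocks_length]
  exact List.length_ofFn

lemma compRow_shiftedComp (b : Fin l → ℕ) (hb : ∀ i : Fin l, (i : ℕ) < b i) :
    compRow (shiftedComp b hb) = shiftedRow b := by
  funext r
  rcases lt_or_ge r l with h | h
  · rw [shiftedRow, dif_pos h, compRow, List.getD_eq_getElem _ _ (by
      rw [Composition.blocks_length, length_shiftedComp]; exact h)]
    simp [shiftedComp]
  · rw [shiftedRow_of_le _ h]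
    by_contra h0
    have := compRow_pos.1 (Nat.pos_of_ne_zero h0)
    rw [length_shiftedComp] at this
    omega

lemma shiftedComp_inj {b b' : Fin l → ℕ} {hb : ∀ i : Fin l, (i : ℕ) < b i}
    {hb' : ∀ i : Fin l, (i : ℕ) < b' i} (h : shiftedComp b hb = shiftedComp b' hb') : b = b' := by
  refine shiftedRow_injOn (fun i => (hb i).le) (fun i => (hb' i).le) ?_
  rw [← compRow_shiftedComp b hb, h, compRow_shiftedComp]

lemma dualImmaculate_shiftedComp (b : Fin l → ℕ) (hb : ∀ i : Fin l, (i : ℕ) < b i) {m : ℕ →₀ ℕ}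
    (hm : ∀ i, N ≤ i → m i = 0) :
    dualImmaculate (shiftedComp b hb) m = (immaculateCount l (fun k => m k) N b : ℚ) := by
  rw [dualImmaculate_eq_ncard_chains _ (length_shiftedComp b hb).le hm, compRow_shiftedComp,
    immaculateCount, if_pos fun i _ => hb i]

/-- The row lengths of a Young diagram from the bottom, shifted by the staircase. -/
def diagramVector (μ : YoungDiagram) (i : Fin (μ.colLen 0)) : ℕ := μ.rowLen i.rev + i

lemma diagramVector_pos (μ : YoungDiagram) (i : Fin (μ.colLen 0)) : (i : ℕ) < diagramVector μ i := by
  have h : (i.rev.1, 0) ∈ μ := YoungDiagram.mem_iff_lt_colLen.2 i.rev.2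
  have := YoungDiagram.mem_iff_lt_rowLen.1 h
  rw [diagramVector]
  omega

lemma diagramVector_strictMono (μ : YoungDiagram) : StrictMono (diagramVector μ) := by
  intro i j hij
  have h1 : i.1 < j.1 := hij
  have h2 : μ.rowLen i.rev ≤ μ.rowLen j.rev := μ.rowLen_anti _ _ (Fin.rev_le_rev.2 hij.le)
  rw [diagramVector, diagramVector]
  omega

lemma shiftedRow_diagramVector (μ : YoungDiagram) : shiftedRow (diagramVector μ) = μ.rowLen := by
  funext r
  rcases lt_or_ge r (μ.colLen 0) with h | h
  · rw [shiftedRow, dif_pos h, diagramVector, Nat.add_sub_cancel, Fin.rev_rev]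
  · rw [shiftedRow_of_le _ h, YoungDiagram_rowLen_eq_zero μ h]

open Classical in
/-- The signed expansion of a Schur function in the dual immaculate functions. -/
noncomputable def dualImmaculateCoeff (μ : YoungDiagram) : Comp →₀ ℚ :=
  ∑ σ : Equiv.Perm (Fin (μ.colLen 0)),
    if h : ∀ i : Fin (μ.colLen 0), (i : ℕ) < (diagramVector μ ∘ σ) i then
      Finsupp.single (shiftedComp (diagramVector μ ∘ σ) h) ((Equiv.Perm.sign σ : ℤ) : ℚ) else 0

lemma isExpansion_dualImmaculateCoeff (μ : YoungDiagram) :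
    IsExpansion dualImmaculate (dualImmaculateCoeff μ) (schur μ) := by
  classical
  funext m
  obtain ⟨N, hN⟩ : ∃ N, ∀ i, N ≤ i → m i = 0 := by
    refine ⟨m.support.sup id + 1, fun i hi => ?_⟩
    by_contra h
    have := Finset.le_sup (f := id) (Finsupp.mem_support_iff.2 h)
    simp only [id] at this
    omega
  have h1 : schur μ m = (stripCount (μ.colLen 0) (fun k => m k) N (diagramVector μ) : ℚ) := by
    rw [schur, skewSchur_eq_ncard_chains (SkewShape.straight μ)
      (fun i hi => YoungDiagram_rowLen_eq_zero μ hi) hN, stripCount, shiftedRow_diagramVector]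
    change ((chains _ _ _ _ (⊥ : YoungDiagram).rowLen _).ncard : ℚ) = _
    rw [rowLen_bot]
    rfl
  have h2 := stripCount_eq_signed_sum (μ.colLen 0) (fun k => m k) N (μ.colLen 0) le_rfl
    (diagramVector μ) (diagramVector_strictMono μ)
    fun i => Nat.succ_le_of_lt (Nat.zero_lt_of_lt (diagramVector_pos μ i))
  rw [h1, ← Int.cast_natCast, h2, dualImmaculateCoeff, map_sum, Int.cast_sum]
  have h3 : ∀ (F : Equiv.Perm (Fin (μ.colLen 0)) → Series),
      (∑ σ, F σ : Series) m = ∑ σ, F σ m := fun F =>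
    (map_sum (MvPowerSeries.coeff m) F Finset.univ : _)
  rw [h3]
  refine Finset.sum_congr rfl fun σ _ => ?_
  split_ifs with h
  · rw [Finsupp.linearCombination_single]
    change _ * dualImmaculate _ m = _
    rw [dualImmaculate_shiftedComp _ _ hN]
    push_cast
    rfl
  · rw [map_zero, immaculateCount, if_neg]
    · simp
      rfl
    -- The discarded permutations are those whose immaculate count vanishes: a failure cannot occur
    -- in the last row, since all entries of the diagram vector are positive.
    · intro h4
      refine h fun i => ?_
      rcases Nat.eq_zero_or_pos (i : ℕ) with h0 | h0
      · rw [h0]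
        exact Nat.zero_lt_of_lt (diagramVector_pos μ (σ i))
      · exact h4 i h0

lemma exists_of_dualImmaculateCoeff_ne {μ : YoungDiagram} {α : Comp}
    (h : dualImmaculateCoeff μ α ≠ 0) : ∃ σ : Equiv.Perm (Fin (μ.colLen 0)),
      ∃ h : ∀ i : Fin (μ.colLen 0), (i : ℕ) < (diagramVector μ ∘ σ) i,
        shiftedComp (diagramVector μ ∘ σ) h = α := by
  classical
  rw [dualImmaculateCoeff, Finsupp.finsetSum_apply] at h
  obtain ⟨σ, _, h1⟩ := Finset.exists_ne_zero_of_sum_ne_zero h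
  split_ifs at h1 with h2
  · refine ⟨σ, h2, ?_⟩
    by_contra h3
    exact h1 (Finsupp.single_eq_of_ne (Ne.symm h3))
  · exact absurd rfl h1

lemma eq_of_comp_perm {a b : Fin l → ℕ} (ha : StrictMono a) (hb : StrictMono b)
    {σ τ : Equiv.Perm (Fin l)} (h : a ∘ σ = b ∘ τ) : σ = τ := by
  have h1 : ∀ i, a i = b ((τ * σ⁻¹) i) := fun i => by
    have := congrFun h (σ⁻¹ i)
    simpa using this
  have h2 : τ * σ⁻¹ = 1 := perm_eq_one_of_strictMono fun i j hij => by
    have h3 := ha hij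
    rw [h1, h1] at h3
    exact hb.lt_iff_lt.1 h3
  exact (mul_inv_eq_one.1 h2).symm

/-- The leading composition of a Young diagram: its rows. -/
def diagramComp (μ : YoungDiagram) : Comp := shiftedComp (diagramVector μ) (diagramVector_pos μ)

/-- A composition in the support determines the permuted vector; sorting it recovers both the
diagram and the permutation. So different permutations never collide, and the identity contributes
the coefficient 1. -/
lemma isDisjointExpansion_dualImmaculate :
    IsDisjointExpansion dualImmaculate dualImmaculateCoeff diagramComp where
  indep := linearIndependent_dualImmaculate
  expansion := isExpansion_dualImmaculateCoeff
  key_eq_one μ := by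
    classical
    rw [dualImmaculateCoeff, Finsupp.finsetSum_apply, Finset.sum_eq_single 1]
    · rw [dif_pos (show ∀ i : Fin (μ.colLen 0), (i : ℕ) <
        (diagramVector μ ∘ (1 : Equiv.Perm (Fin (μ.colLen 0)))) i from diagramVector_pos μ)]
      refine (Finsupp.single_apply.trans (if_pos rfl)).trans ?_
      simp
    · intro σ _ hσ
      split_ifs with h
      · refine Finsupp.single_eq_of_ne fun h1 => hσ ?_
        exact eq_of_comp_perm (diagramVector_strictMono μ) (diagramVector_strictMono μ)
          (τ := 1) (shiftedComp_inj h1.symm)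
      · rfl
    · exact fun h => absurd (Finset.mem_univ _) h
  disjoint μ ν α hμ hν := by
    obtain ⟨σ, h1, h2⟩ := exists_of_dualImmaculateCoeff_ne hμ
    obtain ⟨τ, h3, h4⟩ := exists_of_dualImmaculateCoeff_ne hν
    have hl : μ.colLen 0 = ν.colLen 0 := by
      rw [← length_shiftedComp _ h1, h2, ← h4, length_shiftedComp]
    have hμ' := diagramVector_strictMono μ
    have hν' := diagramVector_strictMono ν
    have hr := shiftedRow_diagramVector μ
    have hr' := shiftedRow_diagramVector ν
    refine YoungDiagram_ext_rowLen fun i => congrFun ?_ i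
    rw [← hr, ← hr']
    generalize diagramVector μ = a at *
    generalize diagramVector ν = b at *
    generalize μ.colLen 0 = x at *
    subst hl
    have h5 := shiftedComp_inj (h2.trans h4.symm)
    have h6 := eq_of_comp_perm hμ' hν' h5
    subst h6
    congr 1
    funext i
    have := congrFun h5 (σ⁻¹ i)
    simpa using this

end Expansion

end SkewQSym

/-! ### Semistandard tableaux of straight shape as sequences of column sets. -/

namespace SkewQSym

/-! ### Sets of entries of columns -/

/-- The entries of a column. -/
def columnSet (cells : Finset (ℕ × ℕ)) (T : ℕ → ℕ → ℕ) (c : ℕ) : Finset ℕ :=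
  (cells.filter fun p => p.2 = c).image fun p => T p.1 p.2

/-- The columns of a filling have distinct entries. -/
def ColumnsInjective (cells : Finset (ℕ × ℕ)) (T : ℕ → ℕ → ℕ) : Prop :=
  ∀ i i' c, (i, c) ∈ cells → (i', c) ∈ cells → T i c = T i' c → i = i'

section Columns

variable {cells : Finset (ℕ × ℕ)} {T : ℕ → ℕ → ℕ} {W : ℕ}

lemma mem_columnSet {c v : ℕ} : v ∈ columnSet cells T c ↔ ∃ i, (i, c) ∈ cells ∧ T i c = v := by
  rw [columnSet, Finset.mem_image]
  constructor
  · rintro ⟨⟨i, c'⟩, h, rfl⟩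
    obtain ⟨h1, h2⟩ := Finset.mem_filter.1 h
    simp only at h2
    subst h2
    exact ⟨i, h1, rfl⟩
  · rintro ⟨i, h, rfl⟩
    exact ⟨(i, c), Finset.mem_filter.2 ⟨h, rfl⟩, rfl⟩

lemma ColumnsInjective.injOn (hT : ColumnsInjective cells T) (c : ℕ) :
    Set.InjOn (fun p : ℕ × ℕ => T p.1 p.2) (cells.filter fun p => p.2 = c) := by
  rintro ⟨i, j⟩ h ⟨i', j'⟩ h' heq
  rw [Finset.mem_coe, Finset.mem_filter] at h h'
  obtain ⟨h1, rfl⟩ := h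
  obtain ⟨h2, h3⟩ := h'
  simp only at h3 heq
  subst h3
  rw [hT _ _ _ h1 h2 heq]

lemma ColumnsInjective.card_columnSet (hT : ColumnsInjective cells T) (c : ℕ) :
    (columnSet cells T c).card = (cells.filter fun p => p.2 = c).card :=
  Finset.card_image_of_injOn (hT.injOn c)

lemma ColumnsInjective.content_apply (hT : ColumnsInjective cells T) (hW : ∀ p ∈ cells, p.2 < W)
    (v : ℕ) : content cells T v =
      ((Finset.range W).filter fun c => v ∈ columnSet cells T c).card := by
  rw [SkewQSym.content_apply]
  refine Finset.card_bij (fun p _ => p.2) ?_ ?_ ?_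
  · rintro ⟨i, j⟩ h
    obtain ⟨h1, h2⟩ := Finset.mem_filter.1 h
    exact Finset.mem_filter.2 ⟨Finset.mem_range.2 (hW _ h1), mem_columnSet.2 ⟨i, h1, h2⟩⟩
  · rintro ⟨i, j⟩ h ⟨i', j'⟩ h' heq
    obtain ⟨h1, h2⟩ := Finset.mem_filter.1 h
    obtain ⟨h3, h4⟩ := Finset.mem_filter.1 h'
    simp only at heq h2 h4
    subst heq
    rw [hT _ _ _ h1 h3 (h2.trans h4.symm)]
  · intro c hc
    obtain ⟨i, h1, h2⟩ := mem_columnSet.1 (Finset.mem_filter.1 hc).2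
    exact ⟨(i, c), Finset.mem_filter.2 ⟨h1, h2⟩, rfl⟩

end Columns

/-- The sequences of sets with given sizes and multiplicities that are related consecutively. -/
def columnFamilies (D : Finset ℕ → Finset ℕ → Prop) (h : ℕ → ℕ) (W : ℕ) (m : ℕ → ℕ) :
    Set (ℕ → Finset ℕ) :=
  {V | (∀ c, (V c).card = h c) ∧ (∀ c, D (V c) (V (c + 1))) ∧
    ∀ v, ((Finset.range W).filter fun c => v ∈ V c).card = m v}

/-- Domination in initial segments. -/
def DominatedBelow (V V' : Finset ℕ) : Prop :=
  ∀ v, (V'.filter fun x => x < v).card ≤ (V.filter fun x => x < v).card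

/-- Domination in final segments. -/
def DominatedAbove (V V' : Finset ℕ) : Prop :=
  ∀ v, (V'.filter fun x => v ≤ x).card ≤ (V.filter fun x => v ≤ x).card

/-! ### Semistandard tableaux of straight shape and their columns -/

lemma eq_of_strictMono_of_image_eq {k : ℕ} {t t' : ℕ → ℕ} (ht : ∀ i j, i < j → j < k → t i < t j)
    (ht' : ∀ i j, i < j → j < k → t' i < t' j)
    (h : (Finset.range k).image t = (Finset.range k).image t') : ∀ i < k, t i = t' i := by
  have hcard : ((Finset.range k).image t).card = k := by
    rw [Finset.card_image_of_injOn, Finset.card_range]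
    intro i hi j hj hij
    rw [Finset.mem_coe, Finset.mem_range] at hi hj
    rcases lt_trichotomy i j with h1 | h1 | h1
    · exact absurd hij (ht _ _ h1 hj).ne
    · exact h1
    · exact absurd hij (ht _ _ h1 hi).ne'
  have h1 := Finset.orderEmbOfFin_unique hcard (f := fun i : Fin k => t i)
    (fun i => Finset.mem_image_of_mem t (Finset.mem_range.2 i.2)) fun i j hij => ht _ _ hij j.2
  have h2 := Finset.orderEmbOfFin_unique hcard (f := fun i : Fin k => t' i)
    (fun i => h ▸ Finset.mem_image_of_mem t' (Finset.mem_range.2 i.2)) fun i j hij => ht' _ _ hij j.2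
  exact fun i hi => congrFun (h1.trans h2.symm) ⟨i, hi⟩

/-- The elements of a set in increasing order. -/
noncomputable def enumerate (V : Finset ℕ) (i : ℕ) : ℕ :=
  if h : i < V.card then V.orderEmbOfFin rfl ⟨i, h⟩ else 0

lemma enumerate_lt {V : Finset ℕ} {i j : ℕ} (hij : i < j) (hj : j < V.card) :
    enumerate V i < enumerate V j := by
  rw [enumerate, enumerate, dif_pos hj, dif_pos (hij.trans hj)]
  exact (V.orderEmbOfFin rfl).strictMono hij

lemma mem_iff_enumerate {V : Finset ℕ} {v : ℕ} : v ∈ V ↔ ∃ i < V.card, enumerate V i = v := by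
  constructor
  · intro hv
    have h1 : v ∈ Set.range (V.orderEmbOfFin rfl) := by
      rw [Finset.range_orderEmbOfFin]
      exact hv
    obtain ⟨i, hi⟩ := h1
    exact ⟨i, i.2, by rw [enumerate, dif_pos i.2]; exact hi⟩
  · rintro ⟨i, hi, rfl⟩
    rw [enumerate, dif_pos hi]
    exact Finset.orderEmbOfFin_mem _ _ _

/-- `V'` has at least `i + 1` elements up to its element number `i`, so the dominating set `V` has
as many there. -/
lemma enumerate_le {V V' : Finset ℕ} (h : DominatedBelow V V') {i : ℕ} (hi : i < V'.card)
    (hi' : i < V.card) : enumerate V i ≤ enumerate V' i := by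
  by_contra hlt
  have h1 := h (enumerate V' i + 1)
  have h2 : i + 1 ≤ (V'.filter fun x => x < enumerate V' i + 1).card := by
    calc i + 1 = ((Finset.range (i + 1)).image (enumerate V')).card := by
          rw [Finset.card_image_of_injOn, Finset.card_range]
          intro a ha b hb hab
          rw [Finset.mem_coe, Finset.mem_range] at ha hb
          rcases lt_trichotomy a b with h1 | h1 | h1
          · exact absurd hab (enumerate_lt h1 (by omega)).ne
          · exact h1
          · exact absurd hab (enumerate_lt h1 (by omega)).ne'
      _ ≤ _ := by
          refine Finset.card_le_card fun x hx => ?_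
          obtain ⟨a, ha, rfl⟩ := Finset.mem_image.1 hx
          rw [Finset.mem_range] at ha
          refine Finset.mem_filter.2 ⟨mem_iff_enumerate.2 ⟨a, by omega, rfl⟩, ?_⟩
          rcases Nat.lt_succ_iff_lt_or_eq.1 ha with h1 | rfl
          · have := enumerate_lt h1 hi
            omega
          · omega
  have h3 : (V.filter fun x => x < enumerate V' i + 1).card ≤ i := by
    calc _ ≤ ((Finset.range i).image (enumerate V)).card := by
          refine Finset.card_le_card fun x hx => ?_
          obtain ⟨hx1, hx2⟩ := Finset.mem_filter.1 hx
          obtain ⟨a, ha, rfl⟩ := mem_iff_enumerate.1 hx1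
          refine Finset.mem_image_of_mem _ (Finset.mem_range.2 ?_)
          by_contra h1
          rcases (not_lt.1 h1).lt_or_eq with h1 | rfl
          · have := enumerate_lt h1 ha
            omega
          · omega
      _ ≤ i := Finset.card_image_le.trans (Finset.card_range i).le
  omega

lemma columnHeight_cells (μ : YoungDiagram) (c : ℕ) :
    (μ.cells.filter fun p => p.2 = c).card = μ.colLen c := by
  rw [YoungDiagram.colLen_eq_card]
  rfl

lemma mem_straight_cells {μ : YoungDiagram} {i j : ℕ} :
    (i, j) ∈ (SkewShape.straight μ).cells ↔ i < μ.colLen j := by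
  rw [← YoungDiagram.mem_iff_lt_colLen, SkewShape.cells]
  simp [SkewShape.straight]

lemma straight_cells (μ : YoungDiagram) : (SkewShape.straight μ).cells = μ.cells := by
  rw [SkewShape.cells]
  simp [SkewShape.straight]

lemma columnSet_straight (μ : YoungDiagram) (T : ℕ → ℕ → ℕ) (c : ℕ) :
    columnSet (SkewShape.straight μ).cells T c =
      (Finset.range (μ.colLen c)).image fun i => T i c := by
  ext v
  rw [mem_columnSet, Finset.mem_image]
  simp only [mem_straight_cells, Finset.mem_range]

/-- Tableaux of straight shape correspond to their columns. -/
lemma schur_eq_ncard_columnFamilies (μ : YoungDiagram) (m : ℕ →₀ ℕ) :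
    schur μ m = ((columnFamilies DominatedBelow μ.colLen (μ.rowLen 0) m).ncard : ℚ) := by
  have hanti : ∀ {i c d}, c ≤ d → i < μ.colLen d → i < μ.colLen c := fun hcd hi =>
    hi.trans_le (μ.colLen_anti _ _ hcd)
  have hW : ∀ p ∈ (SkewShape.straight μ).cells, p.2 < μ.rowLen 0 := by
    rintro ⟨i, j⟩ h
    rw [mem_straight_cells] at h
    exact YoungDiagram.mem_iff_lt_rowLen.1 (YoungDiagram.mem_iff_lt_colLen.2
      ((Nat.zero_le i).trans_lt h))
  have hinj : ∀ T, IsSemistandard (SkewShape.straight μ).cells T →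
      ColumnsInjective (SkewShape.straight μ).cells T := by
    intro T hT i i' c h h' heq
    rcases lt_trichotomy i i' with h1 | h1 | h1
    · exact absurd heq (hT.2 _ _ _ h1 h h').ne
    · exact h1
    · exact absurd heq (hT.2 _ _ _ h1 h' h).ne'
  rw [schur, skewSchur, fillingSeries_apply]
  congr 1
  refine Set.ncard_congr (fun T _ => columnSet (SkewShape.straight μ).cells T) ?_ ?_ ?_
  · rintro T ⟨-, hT, hc⟩
    refine ⟨fun c => ?_, fun c v => ?_, fun v => ?_⟩
    · rw [(hinj T hT).card_columnSet, straight_cells, columnHeight_cells]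
    · have key : ∀ c, ((columnSet (SkewShape.straight μ).cells T c).filter fun x => x < v).card =
          ((Finset.range (μ.colLen c)).filter fun i => T i c < v).card := by
        intro c
        rw [columnSet_straight, Finset.filter_image, Finset.card_image_of_injOn]
        intro i hi i' hi' heq
        rw [Finset.mem_coe, Finset.mem_filter, Finset.mem_range] at hi hi'
        exact hinj T hT i i' c (mem_straight_cells.2 hi.1) (mem_straight_cells.2 hi'.1) heq
      rw [key, key]
      refine Finset.card_le_card fun i hi => ?_
      rw [Finset.mem_filter, Finset.mem_range] at *
      have h1 := hanti (Nat.le_succ c) hi.1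
      exact ⟨h1, (hT.1 i c (c + 1) (Nat.lt_succ_self c) (mem_straight_cells.2 h1)
        (mem_straight_cells.2 hi.1)).trans_lt hi.2⟩
    · rw [← hc, (hinj T hT).content_apply hW]
  · rintro T T' ⟨h0, hT, -⟩ ⟨h0', hT', -⟩ heq
    funext i c
    by_cases h : (i, c) ∈ (SkewShape.straight μ).cells
    · have h1 := congrFun heq c
      rw [columnSet_straight, columnSet_straight] at h1
      have h3 : ∀ {T}, IsSemistandard (SkewShape.straight μ).cells T →
          ∀ i j, i < j → j < μ.colLen c → T i c < T j c := fun hT i j hij hj =>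
        hT.2 i j c hij (mem_straight_cells.2 (hij.trans hj)) (mem_straight_cells.2 hj)
      exact eq_of_strictMono_of_image_eq (t := fun i => T i c) (t' := fun i => T' i c)
        (h3 hT) (h3 hT') h1 i (mem_straight_cells.1 h)
    · rw [h0 i c h, h0' i c h]
  · rintro V ⟨hcard, hdom, hm⟩
    set T : ℕ → ℕ → ℕ := fun i c => enumerate (V c) i with hTdef
    have hzero : ∀ i j, (i, j) ∉ (SkewShape.straight μ).cells → T i j = 0 := by
      intro i j h
      rw [mem_straight_cells, ← hcard] at h
      exact dif_neg h
    have hT : IsSemistandard (SkewShape.straight μ).cells T := by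
      refine ⟨fun i j₁ j₂ hj h h' => ?_, fun i₁ i₂ j hi _ h' => ?_⟩
      · rw [mem_straight_cells] at h'
        clear h
        induction j₂, hj using Nat.le_induction with
        | base =>
          refine enumerate_le (hdom j₁) ?_ ?_
          · rwa [hcard]
          · rw [hcard]
            exact hanti (Nat.le_succ j₁) h'
        | succ j₂ _ ih =>
          refine (ih (hanti (Nat.le_succ j₂) h')).trans (enumerate_le (hdom j₂) ?_ ?_)
          · rwa [hcard]
          · rw [hcard]
            exact hanti (Nat.le_succ j₂) h'
      · rw [mem_straight_cells, ← hcard] at h'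
        exact enumerate_lt hi h'
    have hV : columnSet (SkewShape.straight μ).cells T = V := by
      funext c
      ext v
      rw [mem_columnSet, mem_iff_enumerate, hcard]
      simp only [mem_straight_cells, hTdef]
    refine ⟨T, ⟨hzero, hT, ?_⟩, hV⟩
    ext v
    rw [(hinj T hT).content_apply hW, hV, hm]

/-! ### Reversal of the alphabet -/

lemma filter_image_rev {N v : ℕ} {V : Finset ℕ} (hV : ∀ x ∈ V, x < N) (hv : v ≤ N) :
    ((V.image fun x => N - 1 - x).filter fun x => v ≤ x).card =
      (V.filter fun x => x < N - v).card := by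
  have h1 : (V.image fun x => N - 1 - x).filter (fun x => v ≤ x) =
      (V.filter fun x => x < N - v).image fun x => N - 1 - x := by
    ext y
    simp only [Finset.mem_filter, Finset.mem_image]
    constructor
    · rintro ⟨⟨x, hx, rfl⟩, h⟩
      have := hV x hx
      exact ⟨x, ⟨hx, by omega⟩, rfl⟩
    · rintro ⟨x, ⟨hx, h⟩, rfl⟩
      have := hV x hx
      exact ⟨⟨x, hx, rfl⟩, by omega⟩
  rw [h1, Finset.card_image_of_injOn]
  intro x hx y hy hxy
  have h2 := hV x (Finset.mem_filter.1 hx).1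
  have h3 := hV y (Finset.mem_filter.1 hy).1
  simp only at hxy
  omega

lemma dominatedAbove_image_rev_iff {N : ℕ} {V V' : Finset ℕ} (hV : ∀ x ∈ V, x < N)
    (hV' : ∀ x ∈ V', x < N) :
    DominatedAbove (V.image fun x => N - 1 - x) (V'.image fun x => N - 1 - x) ↔
      DominatedBelow V V' := by
  constructor
  · intro h v
    rcases le_or_gt v N with hv | hv
    · have h1 := h (N - v)
      rw [filter_image_rev hV (by omega), filter_image_rev hV' (by omega)] at h1
      rwa [show N - (N - v) = v by omega] at h1
    -- For `v > N` the filter keeps the whole set, and the comparison is the one at 0 for the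
    -- reversed sets.
    · have h1 := h 0
      rw [filter_image_rev hV (by omega), filter_image_rev hV' (by omega)] at h1
      rw [Finset.filter_congr (s := V) (q := fun x => x < N - 0)
        fun x hx => by have := hV x hx; constructor <;> intro _ <;> omega,
        Finset.filter_congr (s := V') (q := fun x => x < N - 0)
        fun x hx => by have := hV' x hx; constructor <;> intro _ <;> omega]
      exact h1
  · intro h v
    rcases le_or_gt v N with hv | hv
    · rw [filter_image_rev hV hv, filter_image_rev hV' hv]
      exact h _
    · rw [Finset.card_eq_zero.2]
      · exact Nat.zero_le _
      · rw [Finset.filter_eq_empty_iff]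
        intro y hy
        obtain ⟨x, hx, rfl⟩ := Finset.mem_image.1 hy
        omega

lemma image_rev_rev {N : ℕ} {V : Finset ℕ} (hV : ∀ x ∈ V, x < N) :
    (V.image fun x => N - 1 - x).image (fun x => N - 1 - x) = V := by
  rw [Finset.image_image]
  have : Set.EqOn ((fun x => N - 1 - x) ∘ fun x => N - 1 - x) id V := fun x hx => by
    have := hV x hx
    simp only [Function.comp_apply, id]
    omega
  rw [Finset.image_congr this, Finset.image_id]

section Reverse

variable {h m m' : ℕ → ℕ} {W N : ℕ} {D : Finset ℕ → Finset ℕ → Prop}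

lemma lt_of_mem_columnFamilies (hh : ∀ c, W ≤ c → h c = 0) (hm : ∀ v, N ≤ v → m v = 0)
    {V : ℕ → Finset ℕ} (hV : V ∈ columnFamilies D h W m) (c : ℕ) : ∀ x ∈ V c, x < N := by
  intro x hx
  by_contra hN
  have h1 := hV.2.2 x
  rw [hm x (not_lt.1 hN), Finset.card_eq_zero, Finset.filter_eq_empty_iff] at h1
  by_cases hc : c < W
  · exact h1 (Finset.mem_range.2 hc) hx
  · have h2 := hV.1 c
    rw [hh c (not_lt.1 hc), Finset.card_eq_zero] at h2
    rw [h2] at hx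
    exact absurd hx (Finset.notMem_empty x)

lemma reverse_mem_columnFamilies {D' : Finset ℕ → Finset ℕ → Prop} (hh : ∀ c, W ≤ c → h c = 0)
    (hm : ∀ v, N ≤ v → m v = 0) (hm' : ∀ v, m' v = if v < N then m (N - 1 - v) else 0)
    (hD : ∀ V V' : Finset ℕ, (∀ x ∈ V, x < N) → (∀ x ∈ V', x < N) → D V V' →
      D' (V.image fun x => N - 1 - x) (V'.image fun x => N - 1 - x))
    {V : ℕ → Finset ℕ} (hV : V ∈ columnFamilies D h W m) :
    (fun c => (V c).image fun x => N - 1 - x) ∈ columnFamilies D' h W m' := by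
  have hlt := lt_of_mem_columnFamilies hh hm hV
  refine ⟨fun c => ?_, fun c => hD _ _ (hlt c) (hlt (c + 1)) (hV.2.1 c), fun v => ?_⟩
  · rw [← hV.1 c, Finset.card_image_of_injOn]
    intro x hx y hy hxy
    have h2 := hlt c x hx
    have h3 := hlt c y hy
    simp only at hxy
    omega
  · rw [hm']
    split_ifs with hv
    · rw [← hV.2.2]
      congr 1
      refine Finset.filter_congr fun c _ => ?_
      rw [Finset.mem_image]
      constructor
      · rintro ⟨x, hx, rfl⟩
        have := hlt c x hx
        rwa [show N - 1 - (N - 1 - x) = x by omega]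
      · intro hx
        exact ⟨_, hx, by omega⟩
    · rw [Finset.card_eq_zero, Finset.filter_eq_empty_iff]
      intro c _ hx
      obtain ⟨x, hx', rfl⟩ := Finset.mem_image.1 hx
      have := hlt c x hx'
      omega

/-- Rows of composition tableaux decrease, whereas those of semistandard tableaux increase;
complementing the entries converts one domination order into the other and reverses the content. -/
lemma ncard_columnFamilies_reverse (hh : ∀ c, W ≤ c → h c = 0)
    (hm : ∀ v, N ≤ v → m v = 0) (hm' : ∀ v, m' v = if v < N then m (N - 1 - v) else 0) :
    (columnFamilies DominatedBelow h W m).ncard = (columnFamilies DominatedAbove h W m').ncard := by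
  have hm1 : ∀ v, N ≤ v → m' v = 0 := fun v hv => by rw [hm', if_neg (by omega)]
  have hm2 : ∀ v, m v = if v < N then m' (N - 1 - v) else 0 := fun v => by
    split_ifs with hv
    · rw [hm', if_pos (by omega), show N - 1 - (N - 1 - v) = v by omega]
    · exact hm v (not_lt.1 hv)
  refine Set.ncard_congr (fun V _ c => (V c).image fun x => N - 1 - x) ?_ ?_ ?_
  · intro V hV
    exact reverse_mem_columnFamilies hh hm hm'
      (fun V V' h1 h2 => (dominatedAbove_image_rev_iff h1 h2).2) hV
  · intro V V' hV hV' heq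
    funext c
    have h1 := congrFun heq c
    rw [← image_rev_rev (lt_of_mem_columnFamilies hh hm hV c), h1,
      image_rev_rev (lt_of_mem_columnFamilies hh hm hV' c)]
  · intro V hV
    have hlt := lt_of_mem_columnFamilies hh hm1 hV
    refine ⟨fun c => (V c).image fun x => N - 1 - x, ?_, funext fun c => image_rev_rev (hlt c)⟩
    refine reverse_mem_columnFamilies hh hm1 hm2 (fun V V' h1 h2 h3 => ?_) hV
    rw [← image_rev_rev h1, ← image_rev_rev h2] at h3
    have h4 : ∀ {V : Finset ℕ}, (∀ x ∈ V, x < N) → ∀ x ∈ V.image (fun x => N - 1 - x), x < N := by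
      intro V hV x hx
      obtain ⟨y, hy, rfl⟩ := Finset.mem_image.1 hx
      have := hV y hy
      omega
    exact (dominatedAbove_image_rev_iff (h4 h1) (h4 h2)).1 h3

end Reverse

/-- Schur functions count dominated sequences of columns. -/
lemma schur_eq_ncard_dominatedAbove (μ : YoungDiagram) (m : ℕ →₀ ℕ) :
    schur μ m = ((columnFamilies DominatedAbove μ.colLen (μ.rowLen 0) m).ncard : ℚ) := by
  obtain ⟨N, hN⟩ : ∃ N, ∀ i, N ≤ i → m i = 0 := by
    refine ⟨m.support.sup id + 1, fun i hi => ?_⟩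
    by_contra h
    have := Finset.le_sup (f := id) (Finsupp.mem_support_iff.2 h)
    simp only [id] at this
    omega
  -- Reversing the first `N` variables reverses the content; Schur functions being symmetric, the
  -- coefficient is unaffected.
  set σ : Equiv.Perm ℕ := ((Fin.revPerm (n := N)).extendDomain (Fin.equivSubtype (n := N))) with hσ
  have h1 : schur μ (m.equivMapDomain σ) = schur μ m :=
    (isSymmetricFunction_skewSchur (SkewShape.straight μ)).2 σ m
  have h2 : ∀ v, N ≤ v → σ v = v := fun v hv =>
    Equiv.Perm.extendDomain_apply_not_subtype _ _ (not_lt.2 hv)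
  have h3 : ∀ v, v < N → σ v = N - 1 - v := by
    intro v hv
    refine (Equiv.Perm.extendDomain_apply_image (Fin.revPerm (n := N)) Fin.equivSubtype
      ⟨v, hv⟩).trans ?_
    change ((Fin.rev ⟨v, hv⟩ : Fin N) : ℕ) = _
    simp only [Fin.val_rev]
    omega
  have h4 : ∀ v, σ.symm v = if v < N then N - 1 - v else v := by
    intro v
    rw [Equiv.symm_apply_eq]
    split_ifs with hv
    · rw [h3 _ (by omega)]
      omega
    · exact (h2 v (not_lt.1 hv)).symm
  rw [← h1, schur_eq_ncard_columnFamilies]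
  congr 1
  refine ncard_columnFamilies_reverse (N := N) (fun c hc => ?_) (fun v hv => ?_) fun v => ?_
  · by_contra h
    have h5 := YoungDiagram.mem_iff_lt_rowLen.1
      (YoungDiagram.mem_iff_lt_colLen.2 (Nat.pos_of_ne_zero h))
    omega
  · rw [Finsupp.equivMapDomain_apply, h4, if_neg (not_lt.2 hv), hN v hv]
  · split_ifs with hv
    · rw [Finsupp.equivMapDomain_apply, h4, if_pos (by omega)]
      congr 1
      omega
    · exact hN v (not_lt.1 hv)

end SkewQSym

/-! ### Composition tableaux by columns, and the quasisymmetric Schur basis. -/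

namespace SkewQSym

/-! ### Consecutive columns of composition tableaux

A column is a function `f : ℕ → ℕ` that is `0` off the boxes and the entry plus one on them. -/

/-- The column `g` may follow the column `f` in a composition tableau, and has the entries `V`. -/
structure ColumnStep (f g : ℕ → ℕ) (V : Finset ℕ) : Prop where
  le : ∀ i, g i ≤ f i
  mem : ∀ v, v ∈ V ↔ ∃ i, g i = v + 1
  triple : ∀ i j, i < j → 0 < g j → g i ≤ g j → f i < g j

section Step

variable {f g : ℕ → ℕ} {V : Finset ℕ} {l : ℕ}

/-- Equality of two entries of the new column would, by the triple rule, make one of them larger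
than its own left neighbour. -/
lemma ColumnStep.inj (h : ColumnStep f g V) {i j : ℕ} (hi : 0 < g i) (hij : g i = g j) : i = j := by
  rcases lt_trichotomy i j with h1 | h1 | h1
  · have h2 := h.triple i j h1 (hij ▸ hi) hij.le
    have h3 := h.le i
    omega
  · exact h1
  · have h2 := h.triple j i h1 hi hij.ge
    have h3 := h.le j
    omega

/-- The largest entry goes to the first row that can take it. Setting the old column to 0 there
removes the row from the problem, and the triple rule holds because all earlier rows are too small
for this entry. -/
lemma columnStep_of_insert {a : ℕ} {s : Finset ℕ} (hs : ∀ x ∈ s, x < a) {j : ℕ}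
    (hj : a < f j) (hmin : ∀ i < j, f i ≤ a) (h : ColumnStep (Function.update f j 0) g s) :
    ColumnStep f (Function.update g j (a + 1)) (insert a s) := by
  have hgj : g j = 0 := by
    have := h.le j
    rwa [Function.update_self, Nat.le_zero] at this
  have hlt : ∀ i, g i ≤ a := fun i => by
    rcases Nat.eq_zero_or_pos (g i) with h0 | h0
    · omega
    · have := hs (g i - 1) ((h.mem _).2 ⟨i, by omega⟩)
      omega
  refine ⟨fun i => ?_, fun v => ?_, fun i i' hi h0 hle => ?_⟩
  · by_cases hi : i = j
    · subst hi
      rw [Function.update_self]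
      omega
    · have := h.le i
      rw [Function.update_of_ne hi] at *
      exact this
  · rw [Finset.mem_insert, h.mem]
    constructor
    · rintro (rfl | ⟨i, hi⟩)
      · exact ⟨j, Function.update_self _ _ _⟩
      · refine ⟨i, ?_⟩
        rw [Function.update_of_ne, hi]
        rintro rfl
        omega
    · rintro ⟨i, hi⟩
      by_cases hij : i = j
      · subst hij
        rw [Function.update_self] at hi
        left
        omega
      · rw [Function.update_of_ne hij] at hi
        exact Or.inr ⟨i, hi⟩
  · by_cases hi' : i' = j
    · subst hi'
      rw [Function.update_self]
      have := hmin i hi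
      omega
    · rw [Function.update_of_ne hi'] at *
      by_cases hij : i = j
      · subst hij
        rw [Function.update_self] at hle
        have := hlt i'
        omega
      · rw [Function.update_of_ne hij] at hle
        have := h.triple i i' hi h0 hle
        rwa [Function.update_of_ne hij] at this

/-- The placement of the largest entry is forced: an earlier row cannot hold it, and in a later row
it would violate the triple rule with row `j`. -/
lemma ColumnStep.of_insert {a : ℕ} {s : Finset ℕ} (hs : ∀ x ∈ s, x < a) {j : ℕ}
    (hmin : ∀ i < j, f i ≤ a) (hj : a < f j) (h : ColumnStep f g (insert a s)) :
    g j = a + 1 ∧ ColumnStep (Function.update f j 0) (Function.update g j 0) s := by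
  obtain ⟨j', hj'⟩ := (h.mem a).1 (Finset.mem_insert_self a s)
  have hlt : ∀ i, g i ≤ a + 1 := fun i => by
    rcases Nat.eq_zero_or_pos (g i) with h0 | h0
    · omega
    · rcases Finset.mem_insert.1 ((h.mem (g i - 1)).2 ⟨i, by omega⟩) with h1 | h1
      · omega
      · have := hs _ h1
        omega
  have hjj : j' = j := by
    rcases lt_trichotomy j' j with h1 | h1 | h1
    · have := hmin j' h1
      have := h.le j'
      omega
    · exact h1
    · have := h.triple j j' h1 (by omega) (by rw [hj']; exact hlt j)
      omega
  subst hjj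
  refine ⟨hj', fun i => ?_, fun v => ?_, fun i i' hi h0 hle => ?_⟩
  · by_cases hi : i = j'
    · subst hi
      rw [Function.update_self, Function.update_self]
    · rw [Function.update_of_ne hi, Function.update_of_ne hi]
      exact h.le i
  · constructor
    · intro hv
      obtain ⟨i, hi⟩ := (h.mem v).1 (Finset.mem_insert_of_mem hv)
      refine ⟨i, ?_⟩
      rw [Function.update_of_ne, hi]
      rintro rfl
      have := hs v hv
      omega
    · rintro ⟨i, hi⟩
      by_cases hij : i = j'
      · subst hij
        rw [Function.update_self] at hi
        omega
      · rw [Function.update_of_ne hij] at hi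
        rcases Finset.mem_insert.1 ((h.mem v).2 ⟨i, hi⟩) with rfl | h1
        · exact absurd (h.inj (by omega) (hi.trans hj'.symm)) hij
        · exact h1
  · by_cases hi' : i' = j'
    · subst hi'
      rw [Function.update_self] at h0
      omega
    · rw [Function.update_of_ne hi'] at *
      by_cases hij : i = j'
      · subst hij
        rwa [Function.update_self]
      · rw [Function.update_of_ne hij] at *
        exact h.triple i i' hi h0 hle

/-- The entries of the next column determine it, and exist if they are dominated. -/
lemma existsUnique_columnStep (l : ℕ) : ∀ (V : Finset ℕ) (f : ℕ → ℕ),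
    (∀ v, (V.filter fun x => v ≤ x).card ≤ ((Finset.range l).filter fun i => v < f i).card) →
    ∃! g, ColumnStep f g V := by
  intro V
  induction V using Finset.induction_on_max with
  | empty =>
    intro f _
    refine ⟨0, ⟨fun i => Nat.zero_le _, fun v => ?_, fun i j _ h0 => ?_⟩, fun g hg => ?_⟩
    · simp
    · exact absurd h0 (lt_irrefl _)
    · funext i
      by_contra h
      have h1 : 0 < g i := Nat.pos_of_ne_zero h
      exact absurd ((hg.mem (g i - 1)).2 ⟨i, by omega⟩) (Finset.notMem_empty _)
  | insert a s hs ih =>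
    intro f hf
    have hanot : a ∉ s := fun h => lt_irrefl _ (hs a h)
    have hex : ∃ i, a < f i := by
      have h1 := hf a
      have h2 : 0 < ((insert a s).filter fun x => a ≤ x).card :=
        Finset.card_pos.2 ⟨a, Finset.mem_filter.2 ⟨Finset.mem_insert_self _ _, le_rfl⟩⟩
      obtain ⟨i, hi⟩ := Finset.card_pos.1 (h2.trans_le h1)
      exact ⟨i, (Finset.mem_filter.1 hi).2⟩
    classical
    -- Domination at the level `a` provides a row that can hold the largest entry; the first such
    -- row is used.
    set j := Nat.find hex with hj
    have hj1 : a < f j := Nat.find_spec hex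
    have hmin : ∀ i < j, f i ≤ a := fun i hi => not_lt.1 (Nat.find_min hex hi)
    have hjl : j < l := by
      have h1 := hf a
      have h2 : 0 < ((insert a s).filter fun x => a ≤ x).card :=
        Finset.card_pos.2 ⟨a, Finset.mem_filter.2 ⟨Finset.mem_insert_self _ _, le_rfl⟩⟩
      obtain ⟨i, hi⟩ := Finset.card_pos.1 (h2.trans_le h1)
      obtain ⟨h3, h4⟩ := Finset.mem_filter.1 hi
      exact (Nat.find_min' hex h4).trans_lt (Finset.mem_range.1 h3)
    -- Domination persists: for `v ≤ a` both sides lose exactly one element, and for `v > a` the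
    -- remaining set has no element to count.
    obtain ⟨g, hg, huniq⟩ := ih (Function.update f j 0) fun v => by
      rcases le_or_gt v a with hv | hv
      · have h1 := hf v
        rw [Finset.filter_insert, if_pos hv, Finset.card_insert_of_notMem fun h =>
          hanot (Finset.mem_filter.1 h).1] at h1
        have h2 : (Finset.range l).filter (fun i => v < Function.update f j 0 i) =
            ((Finset.range l).filter fun i => v < f i).erase j := by
          ext i
          rw [Finset.mem_filter, Finset.mem_erase, Finset.mem_filter]
          by_cases hi : i = j
          · subst hi
            simp
          · rw [Function.update_of_ne hi]
            simp [hi]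
        have h3 : j ∈ (Finset.range l).filter fun i => v < f i :=
          Finset.mem_filter.2 ⟨Finset.mem_range.2 hjl, hv.trans_lt hj1⟩
        rw [h2, Finset.card_erase_of_mem h3]
        omega
      · rw [Finset.card_eq_zero.2]
        · exact Nat.zero_le _
        · rw [Finset.filter_eq_empty_iff]
          intro x hx
          have := hs x hx
          omega
    refine ⟨_, columnStep_of_insert hs hj1 hmin hg, fun g' hg' => ?_⟩
    obtain ⟨h1, h2⟩ := hg'.of_insert hs hmin hj1
    have h3 := huniq _ h2
    rw [← h3, Function.update_idem, ← h1, Function.update_eq_self]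

lemma card_filter_of_mem (hV : ∀ v, v ∈ V ↔ ∃ i, g i = v + 1)
    (hinj : ∀ i j, 0 < g i → g i = g j → i = j) (hl : ∀ i, l ≤ i → g i = 0) (v : ℕ) :
    (V.filter fun x => v ≤ x).card = ((Finset.range l).filter fun i => v < g i).card := by
  symm
  refine Finset.card_bij (fun i _ => g i - 1) (fun i hi => ?_) (fun i hi j hj h => ?_)
    fun x hx => ?_
  · rw [Finset.mem_filter] at *
    exact ⟨(hV _).2 ⟨i, by omega⟩, by omega⟩
  · rw [Finset.mem_filter] at hi hj
    exact hinj i j (by omega) (by omega)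
  · obtain ⟨h1, h2⟩ := Finset.mem_filter.1 hx
    obtain ⟨i, hi⟩ := (hV x).1 h1
    refine ⟨i, Finset.mem_filter.2 ⟨Finset.mem_range.2 ?_, by omega⟩, by omega⟩
    by_contra h3
    rw [hl i (not_lt.1 h3)] at hi
    omega

end Step

/-! ### Composition tableaux and their columns -/

/-- The columns of a filling, as functions of the row. -/
def columnOf (cells : Finset (ℕ × ℕ)) (T : ℕ → ℕ → ℕ) (c i : ℕ) : ℕ :=
  if (i, c) ∈ cells then T i c + 1 else 0

/-- Raising entries by one frees the value 0 to play the role of `⊥`, so the triple rule can be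
stated with natural numbers. -/
lemma extended_le_iff {cells : Finset (ℕ × ℕ)} {T : ℕ → ℕ → ℕ} {i j i' j' : ℕ} :
    extended cells T i j ≤ extended cells T i' j' ↔ columnOf cells T j i ≤ columnOf cells T j' i' := by
  unfold extended columnOf
  split_ifs
  · refine WithBot.coe_le_coe.trans ?_
    rw [Nat.cast_id, Nat.cast_id]
    omega
  · simp
  · simp
  · simp

lemma extended_lt_iff {cells : Finset (ℕ × ℕ)} {T : ℕ → ℕ → ℕ} {i j i' j' : ℕ} :
    extended cells T i j < extended cells T i' j' ↔ columnOf cells T j i < columnOf cells T j' i' := by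
  rw [← not_le, extended_le_iff, not_le]

lemma columnOf_pos {cells : Finset (ℕ × ℕ)} {T : ℕ → ℕ → ℕ} {i c : ℕ} :
    0 < columnOf cells T c i ↔ (i, c) ∈ cells := by
  unfold columnOf
  split_ifs with h
  · simp [h]
  · simp [h]

lemma mem_columnSet_iff {cells : Finset (ℕ × ℕ)} {T : ℕ → ℕ → ℕ} {c v : ℕ} :
    v ∈ columnSet cells T c ↔ ∃ i, columnOf cells T c i = v + 1 := by
  rw [mem_columnSet]
  refine exists_congr fun i => ?_
  unfold columnOf
  split_ifs with h
  · simp [h]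
  · simp [h]

section CompositionTableaux

variable {α : Comp} {T : ℕ → ℕ → ℕ}

lemma IsCompositionTableau.columnStep (hT : IsCompositionTableau (compCells α) T) (c : ℕ) :
    ColumnStep (columnOf (compCells α) T c) (columnOf (compCells α) T (c + 1))
      (columnSet (compCells α) T (c + 1)) := by
  refine ⟨fun i => ?_, fun v => mem_columnSet_iff, fun i j hij h0 hle => ?_⟩
  · unfold columnOf
    split_ifs with h1 h2
    · have := hT.1 i c (c + 1) (Nat.lt_succ_self c) h2 h1
      omega
    · rw [mem_compCells] at h1 h2
      omega
    · exact Nat.zero_le _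
    · exact le_rfl
  · exact extended_lt_iff.1 (hT.2.2 i j c hij (columnOf_pos.1 h0) (extended_le_iff.2 hle))

lemma IsCompositionTableau.columnsInjective (hT : IsCompositionTableau (compCells α) T) :
    ColumnsInjective (compCells α) T := by
  intro i i' c h h' heq
  cases c with
  | zero =>
    rcases lt_trichotomy i i' with h1 | h1 | h1
    · exact absurd heq (hT.2.1 _ _ h1 h h').ne
    · exact h1
    · exact absurd heq (hT.2.1 _ _ h1 h' h).ne'
  | succ c =>
    refine (hT.columnStep c).inj (columnOf_pos.2 h) ?_
    unfold columnOf
    rw [if_pos h, if_pos h', heq]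

lemma columnOf_inj (hT : ColumnsInjective (compCells α) T) (c i j : ℕ)
    (h0 : 0 < columnOf (compCells α) T c i)
    (h : columnOf (compCells α) T c i = columnOf (compCells α) T c j) : i = j := by
  have h1 := columnOf_pos.1 h0
  have h2 := columnOf_pos.1 (h ▸ h0)
  unfold columnOf at h
  rw [if_pos h1, if_pos h2] at h
  exact hT i j c h1 h2 (by omega)

lemma columnOf_of_le {c i : ℕ} (h : α.2.length ≤ i) : columnOf (compCells α) T c i = 0 := by
  by_contra h0
  have h1 := mem_compCells.1 (columnOf_pos.1 (Nat.pos_of_ne_zero h0))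
  have h2 := compRow_pos.1 (Nat.zero_lt_of_lt h1)
  omega

lemma IsCompositionTableau.card_filter (hT : IsCompositionTableau (compCells α) T) (c v : ℕ) :
    ((columnSet (compCells α) T c).filter fun x => v ≤ x).card =
      ((Finset.range α.2.length).filter fun i => v < columnOf (compCells α) T c i).card :=
  card_filter_of_mem (fun _ => mem_columnSet_iff) (columnOf_inj hT.columnsInjective c)
    (fun _ hi => columnOf_of_le hi) v

lemma IsCompositionTableau.dominatedAbove (hT : IsCompositionTableau (compCells α) T) (c : ℕ) :
    DominatedAbove (columnSet (compCells α) T c) (columnSet (compCells α) T (c + 1)) := by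
  intro v
  rw [hT.card_filter, hT.card_filter]
  refine Finset.card_le_card fun i hi => ?_
  rw [Finset.mem_filter] at *
  exact ⟨hi.1, hi.2.trans_le ((hT.columnStep c).le i)⟩

lemma columnSet_zero (α : Comp) (T : ℕ → ℕ → ℕ) :
    columnSet (compCells α) T 0 = (Finset.range α.2.length).image fun i => T i 0 := by
  ext v
  rw [mem_columnSet, Finset.mem_image]
  simp only [mem_compCells, compRow_pos, Finset.mem_range]

lemma card_columnSet_zero (hT : ColumnsInjective (compCells α) T) :
    (columnSet (compCells α) T 0).card = α.2.length := by
  rw [columnSet_zero, Finset.card_image_of_injOn, Finset.card_range]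
  intro i hi j hj hij
  rw [Finset.mem_coe, Finset.mem_range, ← compRow_pos] at hi hj
  exact hT i j 0 (mem_compCells.2 hi) (mem_compCells.2 hj) hij

/-- A composition tableau is determined by the entries of its columns. -/
lemma IsCompositionTableau.columnOf_eq {β : Comp} {T' : ℕ → ℕ → ℕ}
    (hT : IsCompositionTableau (compCells α) T) (hT' : IsCompositionTableau (compCells β) T')
    (h : columnSet (compCells α) T = columnSet (compCells β) T') :
    columnOf (compCells α) T = columnOf (compCells β) T' := by
  have hl : α.2.length = β.2.length := by
    rw [← card_columnSet_zero hT.columnsInjective, h, card_columnSet_zero hT'.columnsInjective]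
  have hmono : ∀ {α : Comp} {T : ℕ → ℕ → ℕ}, IsCompositionTableau (compCells α) T →
      ∀ i j, i < j → j < α.2.length → T i 0 < T j 0 := fun hT i j hij hj =>
    hT.2.1 i j hij (mem_compCells.2 (compRow_pos.2 (hij.trans hj)))
      (mem_compCells.2 (compRow_pos.2 hj))
  funext c
  induction c with
  | zero =>
    funext i
    rcases lt_or_ge i α.2.length with hi | hi
    · have h1 := congrFun h 0
      rw [columnSet_zero, columnSet_zero, ← hl] at h1
      have h2 := eq_of_strictMono_of_image_eq (t := fun i => T i 0) (t' := fun i => T' i 0)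
        (hmono hT) (hl ▸ hmono hT') h1 i hi
      unfold columnOf
      rw [if_pos (mem_compCells.2 (compRow_pos.2 hi)),
        if_pos (mem_compCells.2 (compRow_pos.2 (hl ▸ hi)))]
      exact congrArg (· + 1) h2
    · rw [columnOf_of_le hi, columnOf_of_le (hl ▸ hi)]
  | succ c ih =>
    have h1 := hT.columnStep c
    have h2 := hT'.columnStep c
    rw [h] at h1
    rw [← ih] at h2
    refine (existsUnique_columnStep α.2.length _ _ fun v => ?_).unique h1 h2
    rw [← hT.card_filter, ← h]
    exact hT.dominatedAbove c v

end CompositionTableaux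

/-- The columns with prescribed entries. -/
noncomputable def buildColumns (V : ℕ → Finset ℕ) : ℕ → ℕ → ℕ
  | 0 => fun i => if i < (V 0).card then enumerate (V 0) i + 1 else 0
  | c + 1 =>
    open Classical in
    if h : ∃ g, ColumnStep (buildColumns V c) g (V (c + 1)) then h.choose else 0

section Build

variable {V : ℕ → Finset ℕ}

lemma buildColumns_zero (i : ℕ) :
    buildColumns V 0 i = if i < (V 0).card then enumerate (V 0) i + 1 else 0 := by
  rw [buildColumns]

/-- The four properties are proved together: the entries, injectivity and bounded support of one
column translate domination into the hypothesis of `existsUnique_columnStep`, which produces the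
next. -/
lemma buildColumns_spec (hV : ∀ c, DominatedAbove (V c) (V (c + 1))) (c : ℕ) :
    (∀ v, v ∈ V c ↔ ∃ i, buildColumns V c i = v + 1) ∧
      (∀ i j, 0 < buildColumns V c i → buildColumns V c i = buildColumns V c j → i = j) ∧
      (∀ i, (V 0).card ≤ i → buildColumns V c i = 0) ∧
      ColumnStep (buildColumns V c) (buildColumns V (c + 1)) (V (c + 1)) := by
  have key : ∀ c, (∀ v, v ∈ V c ↔ ∃ i, buildColumns V c i = v + 1) →
      (∀ i j, 0 < buildColumns V c i → buildColumns V c i = buildColumns V c j → i = j) →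
      (∀ i, (V 0).card ≤ i → buildColumns V c i = 0) →
      ColumnStep (buildColumns V c) (buildColumns V (c + 1)) (V (c + 1)) := by
    intro c h1 h2 h3
    have hex : ∃ g, ColumnStep (buildColumns V c) g (V (c + 1)) := by
      refine (existsUnique_columnStep (V 0).card _ _ fun v => ?_).exists
      rw [← card_filter_of_mem h1 h2 h3]
      exact hV c v
    rw [buildColumns, dif_pos hex]
    exact hex.choose_spec
  induction c with
  | zero =>
    have h1 : ∀ v, v ∈ V 0 ↔ ∃ i, buildColumns V 0 i = v + 1 := by
      intro v
      rw [mem_iff_enumerate]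
      refine exists_congr fun i => ?_
      rw [buildColumns_zero]
      split_ifs with h
      · simp [h]
      · simp [h]
    have h2 : ∀ i j, 0 < buildColumns V 0 i → buildColumns V 0 i = buildColumns V 0 j →
        i = j := by
      intro i j h0 h
      rw [buildColumns_zero] at h0
      rw [buildColumns_zero, buildColumns_zero] at h
      split_ifs at h0 h with h3 h4
      · rcases lt_trichotomy i j with h1 | h1 | h1
        · have := enumerate_lt h1 h4
          omega
        · exact h1
        · have := enumerate_lt h1 h3
          omega
      · omega
    have h3 : ∀ i, (V 0).card ≤ i → buildColumns V 0 i = 0 := fun i hi => by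
      rw [buildColumns_zero, if_neg (not_lt.2 hi)]
    exact ⟨h1, h2, h3, key 0 h1 h2 h3⟩
  | succ c ih =>
    have h4 := ih.2.2.2
    have h1 := h4.mem
    have h2 : ∀ i j, 0 < buildColumns V (c + 1) i →
        buildColumns V (c + 1) i = buildColumns V (c + 1) j → i = j := fun i j => h4.inj
    have h3 : ∀ i, (V 0).card ≤ i → buildColumns V (c + 1) i = 0 := fun i hi =>
      Nat.le_zero.1 ((h4.le i).trans (ih.2.2.1 i hi).le)
    exact ⟨h1, h2, h3, key (c + 1) h1 h2 h3⟩

/-- Every dominated sequence of columns comes from a composition tableau. -/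
lemma exists_compositionTableau (hV : ∀ c, DominatedAbove (V c) (V (c + 1))) {W : ℕ}
    (hW : ∀ c, W ≤ c → V c = ∅) : ∃ (α : Comp) (T : ℕ → ℕ → ℕ),
      (∀ i j, (i, j) ∉ compCells α → T i j = 0) ∧ IsCompositionTableau (compCells α) T ∧
      columnSet (compCells α) T = V := by
  set g := buildColumns V with hg
  have hspec := buildColumns_spec hV
  have hanti : ∀ i, Antitone fun c => g c i := fun i =>
    antitone_nat_of_succ_le fun c => (hspec c).2.2.2.le i
  have hzero : ∀ c i, W ≤ c → g c i = 0 := by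
    intro c i hc
    by_contra h0
    have h1 := ((hspec c).1 (g c i - 1)).2 ⟨i, (Nat.succ_pred_eq_of_ne_zero h0).symm⟩
    rw [hW c hc] at h1
    exact absurd h1 (Finset.notMem_empty _)
  -- Each row of the columns decreases to 0, so the number of nonzero values is the length of the
  -- row in the diagram.
  set r : ℕ → ℕ := fun i => ((Finset.range W).filter fun c => 0 < g c i).card with hr
  have hr1 : ∀ i c, c < r i ↔ 0 < g c i := by
    intro i c
    constructor
    · intro h
      by_contra h0
      have h1 : (Finset.range W).filter (fun c => 0 < g c i) ⊆ Finset.range c := by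
        intro c' hc'
        rw [Finset.mem_range]
        by_contra h2
        have h3 : g c' i ≤ g c i := hanti i (not_lt.1 h2)
        have h4 := (Finset.mem_filter.1 hc').2
        omega
      have h2 := Finset.card_le_card h1
      rw [Finset.card_range] at h2
      have h3 : c < ((Finset.range W).filter fun c => 0 < g c i).card := h
      omega
    · intro h
      have h1 : Finset.range (c + 1) ⊆ (Finset.range W).filter fun c => 0 < g c i := by
        intro c' hc'
        rw [Finset.mem_range] at hc'
        have h3 : g c i ≤ g c' i := hanti i (Nat.lt_succ_iff.1 hc')
        refine Finset.mem_filter.2 ⟨Finset.mem_range.2 ?_, h.trans_le h3⟩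
        by_contra h2
        rw [hzero c' i (not_lt.1 h2)] at h3
        omega
      have h2 := Finset.card_le_card h1
      rwa [Finset.card_range] at h2
  have hpos : ∀ i, i < (V 0).card → 0 < r i := fun i hi => by
    rw [hr1, hg, buildColumns_zero, if_pos hi]
    exact Nat.succ_pos _
  set α : Comp := ⟨_, ⟨List.ofFn fun i : Fin (V 0).card => r i, fun {x} hx => by
    obtain ⟨i, rfl⟩ := List.mem_ofFn.1 hx
    exact hpos i i.2, rfl⟩⟩ with hα
  have hl : α.2.blocks.length = (V 0).card := List.length_ofFn
  have hrow : ∀ i, compRow α i = r i := by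
    intro i
    rcases lt_or_ge i (V 0).card with hi | hi
    · rw [compRow, List.getD_eq_getElem _ _ (hl ▸ hi)]
      exact List.getElem_ofFn _
    · rw [compRow, List.getD_eq_default _ _ (hl ▸ hi)]
      by_contra h0
      have h1 := (hr1 i 0).1 (Nat.pos_of_ne_zero (Ne.symm h0))
      rw [hg, (hspec 0).2.2.1 i hi] at h1
      omega
  have hcell : ∀ i c, (i, c) ∈ compCells α ↔ 0 < g c i := fun i c => by
    rw [mem_compCells, hrow, hr1]
  set T : ℕ → ℕ → ℕ := fun i c => g c i - 1 with hTdef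
  have hcol : columnOf (compCells α) T = g := by
    funext c i
    unfold columnOf
    split_ifs with h
    · have := (hcell i c).1 h
      simp only [hTdef]
      omega
    · have := (hcell i c).not.1 h
      omega
  refine ⟨α, T, fun i c h => ?_, ⟨fun i j₁ j₂ hj h h' => ?_, fun i₁ i₂ hi h h' => ?_,
    fun i j k hij h hle => ?_⟩, ?_⟩
  · have := (hcell i c).not.1 h
    simp only [hTdef]
    omega
  · have : g j₂ i ≤ g j₁ i := hanti i hj.le
    simp only [hTdef]
    omega
  · rw [mem_compCells, compRow_pos] at h h'
    rw [← Composition.blocks_length, hl] at h h'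
    simp only [hTdef, hg, buildColumns_zero]
    rw [if_pos h, if_pos h']
    have := enumerate_lt hi h'
    omega
  · rw [extended_le_iff, hcol] at hle
    rw [extended_lt_iff, hcol]
    exact (hspec k).2.2.2.triple i j hij ((hcell j (k + 1)).1 h) hle
  · funext c
    ext v
    rw [mem_columnSet_iff, hcol]
    exact ((hspec c).1 v).symm

end Build

/-! ### Quasisymmetric Schur functions -/

lemma card_compCells (α : Comp) : (compCells α).card = α.1 := by
  rw [Finset.card_eq_sum_card_fiberwise (f := Prod.fst) (t := Finset.range α.2.length)]
  · rw [Finset.sum_congr rfl fun i _ => card_filter_row (α := α) i]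
    refine Eq.trans ?_ (degree_testContent α)
    rw [Finsupp.degree_apply]
    refine (Finset.sum_subset (fun i hi => ?_) fun i _ hi => ?_).symm
    · rw [Finsupp.mem_support_iff, testContent_apply] at hi
      exact Finset.mem_range.2 (compRow_pos.1 (Nat.pos_of_ne_zero hi))
    · exact Finsupp.notMem_support_iff.1 hi
  · rintro ⟨i, j⟩ h
    rw [Finset.mem_coe, mem_compCells] at h
    exact Finset.mem_coe.2 (Finset.mem_range.2 (compRow_pos.1 (Nat.zero_lt_of_lt h)))

/-- The compositions whose diagram has the column lengths of a Young diagram, that is, those whose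
parts are a rearrangement of its rows. -/
noncomputable def rearrangements (μ : YoungDiagram) : Finset Comp :=
  ((Finset.univ : Finset (Composition μ.card)).map
    ⟨fun β => (⟨μ.card, β⟩ : Comp), fun _ _ h => eq_of_heq (Sigma.mk.inj h).2⟩).filter
    fun α => ∀ c ≤ μ.card, ((compCells α).filter fun p => p.2 = c).card = μ.colLen c

lemma colLen_of_card_le {μ : YoungDiagram} {c : ℕ} (h : μ.card ≤ c) : μ.colLen c = 0 := by
  by_contra h0
  have := (YoungDiagram_lt_card (YoungDiagram.mem_iff_lt_colLen.2 (Nat.pos_of_ne_zero h0))).2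
  omega

lemma mem_rearrangements {μ : YoungDiagram} {α : Comp} : α ∈ rearrangements μ ↔
    ∀ c, ((compCells α).filter fun p => p.2 = c).card = μ.colLen c := by
  rw [rearrangements, Finset.mem_filter, Finset.mem_map]
  constructor
  · rintro ⟨⟨β, -, rfl⟩, h⟩ c
    rcases le_or_gt c μ.card with hc | hc
    · exact h c hc
    · rw [colLen_of_card_le hc.le, Finset.card_eq_zero, Finset.filter_eq_empty_iff]
      rintro ⟨i, j⟩ hij rfl
      have h1 := mem_compCells.1 hij
      exact absurd (h1.trans_le (compRow_le (⟨μ.card, β⟩ : Comp) i)) (not_lt.2 hc.le)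
  · intro h
    refine ⟨?_, fun c _ => h c⟩
    -- Equal column lengths force equal sizes, so the composition belongs to the finite set from
    -- which the rearrangements are selected.
    have h1 : α.1 = μ.card := by
      obtain ⟨K, hK1, hK2⟩ : ∃ K, α.1 ≤ K ∧ μ.card ≤ K := ⟨_, le_max_left _ _, le_max_right _ _⟩
      rw [← card_compCells, YoungDiagram.card,
        Finset.card_eq_sum_card_fiberwise (f := Prod.snd) (t := Finset.range K),
        Finset.card_eq_sum_card_fiberwise (s := μ.cells) (f := Prod.snd) (t := Finset.range K)]
      · refine Finset.sum_congr rfl fun c _ => ?_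
        rw [columnHeight_cells]
        exact h c
      · rintro ⟨i, j⟩ hij
        have := (YoungDiagram_lt_card ((YoungDiagram.mem_cells _).1 (Finset.mem_coe.1 hij))).2
        exact Finset.mem_coe.2 (Finset.mem_range.2 (this.trans_le hK2))
      · rintro ⟨i, j⟩ hij
        have := (mem_compCells.1 (Finset.mem_coe.1 hij)).trans_le (compRow_le α i)
        exact Finset.mem_coe.2 (Finset.mem_range.2 (this.trans_le hK1))
    obtain ⟨n, β⟩ := α
    simp only at h1
    subst h1
    exact ⟨β, Finset.mem_univ _, rfl⟩

/-- Composition tableaux whose column lengths are those of μ correspond bijectively to dominated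
sequences of column sets: the sets determine shape and filling, and every such sequence is realized.
The same sequences count semistandard tableaux of shape μ. -/
lemma schur_eq_sum_quasiSchur (μ : YoungDiagram) (m : ℕ →₀ ℕ) :
    schur μ m = ∑ α ∈ rearrangements μ, quasiSchur α m := by
  classical
  have hh : ∀ c, μ.rowLen 0 ≤ c → μ.colLen c = 0 := by
    intro c hc
    by_contra h
    have h5 := YoungDiagram.mem_iff_lt_rowLen.1
      (YoungDiagram.mem_iff_lt_colLen.2 (Nat.pos_of_ne_zero h))
    omega
  have hW : ∀ α ∈ rearrangements μ, ∀ p ∈ compCells α, p.2 < μ.rowLen 0 := by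
    intro α hα p hp
    by_contra h
    have h1 := mem_rearrangements.1 hα p.2
    rw [hh _ (not_lt.1 h), Finset.card_eq_zero, Finset.filter_eq_empty_iff] at h1
    exact h1 hp rfl
  rw [schur_eq_ncard_dominatedAbove]
  simp only [quasiSchur, fillingSeries_apply]
  rw [← Nat.cast_sum]
  congr 1
  have hfin := fun α : Comp =>
    finite_fillingSeries (compCells α) (IsCompositionTableau (compCells α)) m
  rw [Finset.sum_congr rfl fun α _ => Set.ncard_eq_toFinset_card _ (hfin α), ← Finset.card_sigma,
    ← Set.ncard_coe_finset]
  symm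
  refine Set.ncard_congr (fun p _ => columnSet (compCells p.1) p.2) ?_ ?_ ?_
  · rintro ⟨α, T⟩ hp
    obtain ⟨hα, hT⟩ := Finset.mem_sigma.1 (Finset.mem_coe.1 hp)
    obtain ⟨h0, hT, hc⟩ := (hfin α).mem_toFinset.1 hT
    refine ⟨fun c => ?_, hT.dominatedAbove, fun v => ?_⟩
    · exact (hT.columnsInjective.card_columnSet c).trans (mem_rearrangements.1 hα c)
    · rw [← hc, hT.columnsInjective.content_apply (hW α hα)]
  · rintro ⟨α, T⟩ ⟨β, T'⟩ hp hp' h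
    obtain ⟨-, hT⟩ := Finset.mem_sigma.1 (Finset.mem_coe.1 hp)
    obtain ⟨h0, hT, -⟩ := (hfin α).mem_toFinset.1 hT
    obtain ⟨-, hT'⟩ := Finset.mem_sigma.1 (Finset.mem_coe.1 hp')
    obtain ⟨h0', hT', -⟩ := (hfin β).mem_toFinset.1 hT'
    simp only at h h0 h0' hT hT'
    have h1 := hT.columnOf_eq hT' h
    have h2 : ∀ i c, (i, c) ∈ compCells α ↔ (i, c) ∈ compCells β := fun i c => by
      rw [← columnOf_pos (T := T), h1, columnOf_pos]
    have h3 : α = β := compRow_injective fun i => by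
      have h3 := h2 i (compRow α i)
      have h4 := h2 i (compRow β i)
      rw [mem_compCells, mem_compCells] at h3 h4
      omega
    subst h3
    have h4 : T = T' := by
      funext i c
      by_cases hc : (i, c) ∈ compCells α
      · have := congrFun (congrFun h1 c) i
        unfold columnOf at this
        rw [if_pos hc, if_pos hc] at this
        omega
      · rw [h0 i c hc, h0' i c hc]
    rw [h4]
  · rintro V ⟨hcard, hdom, hm⟩
    obtain ⟨α, T, h0, hT, hV⟩ := exists_compositionTableau hdom (W := μ.rowLen 0) fun c hc => by
      rw [← Finset.card_eq_zero, hcard, hh c hc]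
    have hα : α ∈ rearrangements μ := mem_rearrangements.2 fun c => by
      rw [← hT.columnsInjective.card_columnSet, hV, hcard]
    refine ⟨⟨α, T⟩, Finset.mem_coe.2 (Finset.mem_sigma.2 ⟨hα, (hfin α).mem_toFinset.2
      ⟨h0, hT, ?_⟩⟩), hV⟩
    ext v
    rw [hT.columnsInjective.content_apply (hW α hα), hV, hm]

/-! ### Independence of the quasisymmetric Schur functions -/

/-- Double counting of pairs of columns containing a common element. -/
lemma sum_card_sq (S : Finset ℕ) (W : ℕ) (R : ℕ → ℕ → Prop) [∀ x c, Decidable (R x c)] :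
    ∑ x ∈ S, ((Finset.range W).filter fun c => R x c).card ^ 2 =
      ∑ p ∈ Finset.range W ×ˢ Finset.range W, (S.filter fun x => R x p.1 ∧ R x p.2).card := by
  have h : ∀ x, ((Finset.range W).filter fun c => R x c).card ^ 2 =
      ((Finset.range W ×ˢ Finset.range W).filter fun p => R x p.1 ∧ R x p.2).card := by
    intro x
    rw [sq, ← Finset.card_product, Finset.filter_product]
  simp_rw [h, Finset.card_filter]
  exact Finset.sum_comm

lemma sumSq_testContent (α : Comp) {K : ℕ} (hK : α.2.length ≤ K) :
    sumSq (testContent α) = ∑ i ∈ Finset.range K, compRow α i ^ 2 := by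
  rw [sumSq_eq_sum (N := K), Fin.sum_univ_eq_sum_range (fun k => testContent α k ^ 2)]
  · rfl
  · intro i hi
    rw [testContent_apply]
    by_contra h
    have := compRow_pos.1 (Nat.pos_of_ne_zero h)
    omega

/-- The values of a composition tableau with nested columns depend only on the row. -/
lemma IsCompositionTableau.eq_of_nested {α : Comp} {T : ℕ → ℕ → ℕ}
    (hT : IsCompositionTableau (compCells α) T)
    (hn : ∀ c, columnSet (compCells α) T (c + 1) ⊆ columnSet (compCells α) T c) (c : ℕ) :
    ∀ i, 0 < columnOf (compCells α) T c i →
      columnOf (compCells α) T c i = columnOf (compCells α) T 0 i := by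
  set g := columnOf (compCells α) T with hg
  have h0 : ∀ i j, i < j → 0 < g 0 j → g 0 i < g 0 j := by
    intro i j hij hj
    have h1 := columnOf_pos.1 hj
    by_cases hi : (i, 0) ∈ compCells α
    · have := hT.2.1 i j hij hi h1
      simp only [hg, columnOf]
      rw [if_pos hi, if_pos h1]
      omega
    · simp only [hg, columnOf]
      rw [if_neg hi, if_pos h1]
      omega
  induction c with
  | zero => exact fun _ _ => rfl
  | succ c ih =>
    -- When columns are nested, keeping the surviving values in their rows is a legitimate next
    -- column, so by uniqueness it is the next column.
    have h1 : ColumnStep (g c) (fun i => if g c i - 1 ∈ columnSet (compCells α) T (c + 1) then g c i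
        else 0) (columnSet (compCells α) T (c + 1)) := by
      refine ⟨fun i => ?_, fun v => ?_, fun i j hij hj hle => ?_⟩
      · split_ifs
        · exact le_rfl
        · exact Nat.zero_le _
      · constructor
        · intro hv
          obtain ⟨i, hi⟩ := mem_columnSet_iff.1 (hn c hv)
          have hi' : g c i = v + 1 := hi
          refine ⟨i, ?_⟩
          simp only [hi']
          rw [if_pos (by simpa using hv)]
        · rintro ⟨i, hi⟩
          split_ifs at hi with h
          · rwa [hi, Nat.add_sub_cancel] at h
      · split_ifs at hj hle ⊢ with h2 h3 h3
        · rcases Nat.eq_zero_or_pos (g c i) with h4 | h4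
          · omega
          · have h5 := ih i h4
            have h6 := ih j hj
            have h7 := h0 i j hij (h6 ▸ hj)
            omega
        · rcases Nat.eq_zero_or_pos (g c i) with h4 | h4
          · omega
          · have h5 := ih i h4
            have h6 := ih j hj
            have h7 := h0 i j hij (h6 ▸ hj)
            omega
        · omega
        · omega
    have h2 := (existsUnique_columnStep α.2.length _ _ fun v => by
      rw [← hT.card_filter c]
      exact hT.dominatedAbove c v).unique (hT.columnStep c) h1
    intro i hi
    have h3 : g (c + 1) i = if g c i - 1 ∈ columnSet (compCells α) T (c + 1) then g c i else 0 :=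
      congrFun h2 i
    split_ifs at h3
    · rw [h3] at hi ⊢
      exact ih i hi
    · omega

/-- The sum of squares of the content counts the elements common to pairs of column sets, and each
intersection is at most the later, smaller column; summed up, these bounds give the sum of squares
of the shape. Equality forces nested columns, hence constant rows, hence row `i` filled with `i`, so
content and shape agree. -/
lemma linearIndependent_quasiSchur : LinearIndependent ℚ quasiSchur := by
  refine linearIndependent_of_triangular _ testContent (fun α => (sumSq (testContent α) : ℤ))
    (fun α => ?_) fun α β h => ?_
  · refine fillingSeries_ne_zero.2 ⟨rowFilling α, fun i j h => if_neg h,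
      ⟨fun i j₁ j₂ _ h h' => ?_, fun i₁ i₂ hi h h' => ?_, fun i j k hij h _ => ?_⟩,
      content_rowFilling α fun c hc => if_pos hc⟩
    · rw [rowFilling, rowFilling, if_pos h, if_pos h']
    · rwa [rowFilling, rowFilling, if_pos h, if_pos h']
    · rw [extended_lt_iff, columnOf, columnOf, if_pos h, rowFilling, rowFilling, if_pos h]
      split_ifs <;> omega
  · obtain ⟨T, -, hT, hc⟩ := fillingSeries_ne_zero.1 h
    set V := columnSet (compCells β) T with hV
    obtain ⟨K, hK1, hK2, hK3⟩ : ∃ K, α.2.length ≤ K ∧ β.2.length ≤ K ∧ ∀ i, compRow β i ≤ K :=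
      ⟨max α.2.length (max β.2.length β.1), le_max_left _ _,
        (le_max_left _ _).trans (le_max_right _ _),
        fun i => (compRow_le β i).trans ((le_max_right _ _).trans (le_max_right _ _))⟩
    have hW : ∀ p ∈ compCells β, p.2 < K := by
      rintro ⟨i, j⟩ hij
      exact (mem_compCells.1 hij).trans_le (hK3 i)
    have hrowα : ∀ v, compRow α v = ((Finset.range K).filter fun c => v ∈ V c).card := fun v => by
      rw [← testContent_apply, ← hc, hT.columnsInjective.content_apply hW]
    have hrowβ : ∀ i, compRow β i = ((Finset.range K).filter fun c => c < compRow β i).card := by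
      intro i
      have : (Finset.range K).filter (fun c => c < compRow β i) = Finset.range (compRow β i) := by
        ext c
        have := hK3 i
        simp only [Finset.mem_filter, Finset.mem_range]
        omega
      rw [this, Finset.card_range]
    have hcardV : ∀ c, (V c).card = ((Finset.range K).filter fun i => c < compRow β i).card := by
      intro c
      rw [hV, columnSet, Finset.card_image_of_injOn (hT.columnsInjective.injOn c)]
      refine Finset.card_bij (fun p _ => p.1) ?_ ?_ ?_
      · rintro ⟨i, j⟩ hp
        obtain ⟨h1, rfl⟩ := Finset.mem_filter.1 hp
        have h2 := mem_compCells.1 h1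
        exact Finset.mem_filter.2 ⟨Finset.mem_range.2
          ((compRow_pos.1 (Nat.zero_lt_of_lt h2)).trans_le hK2), h2⟩
      · rintro ⟨i, j⟩ hp ⟨i', j'⟩ hp' heq
        obtain ⟨-, h1⟩ := Finset.mem_filter.1 hp
        obtain ⟨-, h2⟩ := Finset.mem_filter.1 hp'
        simp only at h1 h2 heq
        rw [h1, h2, heq]
      · intro i hi
        exact ⟨(i, c), Finset.mem_filter.2 ⟨mem_compCells.2 (Finset.mem_filter.1 hi).2, rfl⟩, rfl⟩
    have hsα : sumSq (testContent α) = ∑ p ∈ Finset.range K ×ˢ Finset.range K,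
        ((Finset.range K).filter fun x => x ∈ V p.1 ∧ x ∈ V p.2).card := by
      rw [sumSq_testContent α hK1, ← sum_card_sq (R := fun x c => x ∈ V c)]
      exact Finset.sum_congr rfl fun i _ => by rw [hrowα]
    have hsβ : sumSq (testContent β) = ∑ p ∈ Finset.range K ×ˢ Finset.range K,
        ((Finset.range K).filter fun x => p.1 < compRow β x ∧ p.2 < compRow β x).card := by
      rw [sumSq_testContent β hK2, ← sum_card_sq (R := fun x c => c < compRow β x)]
      exact Finset.sum_congr rfl fun i _ => by rw [← hrowβ]
    have hmax : ∀ a b, ((Finset.range K).filter fun x => a < compRow β x ∧ b < compRow β x).card =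
        (V (max a b)).card := by
      intro a b
      rw [hcardV]
      congr 1
      exact Finset.filter_congr fun x _ => max_lt_iff.symm
    have hsub : ∀ a b, (Finset.range K).filter (fun x => x ∈ V a ∧ x ∈ V b) ⊆ V (max a b) := by
      intro a b x hx
      obtain ⟨-, h1, h2⟩ := Finset.mem_filter.1 hx
      rcases max_choice a b with h3 | h3 <;> rw [h3]
      · exact h1
      · exact h2
    have hle : ∀ p ∈ Finset.range K ×ˢ Finset.range K,
        ((Finset.range K).filter fun x => x ∈ V p.1 ∧ x ∈ V p.2).card ≤
          ((Finset.range K).filter fun x => p.1 < compRow β x ∧ p.2 < compRow β x).card := by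
      intro p _
      rw [hmax]
      exact Finset.card_le_card (hsub _ _)
    rcases (Finset.sum_le_sum hle).lt_or_eq with h2 | h2
    · right
      rw [← hsα, ← hsβ] at h2
      exact_mod_cast h2
    · left
      have h3 := (Finset.sum_eq_sum_iff_of_le hle).1 h2
      have hnest : ∀ c, V (c + 1) ⊆ V c := by
        intro c x hx
        have hcK : c + 1 < K := by
          obtain ⟨i, hi, -⟩ := mem_columnSet.1 hx
          exact hW _ hi
        have h4 := h3 (c, c + 1) (Finset.mem_product.2
          ⟨Finset.mem_range.2 (by simp only; omega), Finset.mem_range.2 hcK⟩)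
        simp only at h4
        rw [hmax, max_eq_right (Nat.le_succ c)] at h4
        have h5 := Finset.eq_of_subset_of_card_le
          ((hsub c (c + 1)).trans (by rw [max_eq_right (Nat.le_succ c)])) h4.ge
        rw [← h5] at hx
        exact (Finset.mem_filter.1 hx).2.1
      have hconst : ∀ i c, (i, c) ∈ compCells β → T i c = T i 0 := by
        intro i c hic
        have h4 := hT.eq_of_nested hnest c i (columnOf_pos.2 hic)
        have h5 : (i, 0) ∈ compCells β := mem_compCells.2 (Nat.zero_lt_of_lt (mem_compCells.1 hic))
        unfold columnOf at h4
        rw [if_pos hic, if_pos h5] at h4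
        omega
      have hV0 : V 0 = Finset.range α.2.length := by
        ext v
        rw [Finset.mem_range, ← compRow_pos, hrowα, Finset.card_pos]
        constructor
        · intro hv
          obtain ⟨i, hi, -⟩ := mem_columnSet.1 hv
          exact ⟨0, Finset.mem_filter.2 ⟨Finset.mem_range.2 (hW _ hi), hv⟩⟩
        · rintro ⟨c, hc⟩
          have hle : ∀ c, V c ⊆ V 0 := fun c => by
            induction c with
            | zero => exact subset_rfl
            | succ c ih => exact (hnest c).trans ih
          exact hle c (Finset.mem_filter.1 hc).2
      have hl : β.2.length = α.2.length := by
        rw [← card_columnSet_zero hT.columnsInjective, ← hV, hV0, Finset.card_range]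
      have hid : ∀ i < β.2.length, T i 0 = i := by
        refine eq_of_strictMono_of_image_eq (t := fun i => T i 0) (t' := fun i => i)
          (fun i j hij hj => hT.2.1 i j hij (mem_compCells.2 (compRow_pos.2 (hij.trans hj)))
            (mem_compCells.2 (compRow_pos.2 hj))) (fun i j hij _ => hij) ?_
        rw [← columnSet_zero, ← hV, hV0, hl, Finset.image_id']
      have h4 := content_rowFilling β (T := T) fun c hc => by
        rw [hconst c.1 c.2 hc, hid]
        exact compRow_pos.1 (Nat.zero_lt_of_lt (mem_compCells.1 hc))
      refine compRow_injective fun i => ?_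
      rw [← testContent_apply, ← testContent_apply, ← h4, hc]

/-- The expansion of a Schur function in the quasisymmetric Schur functions. -/
noncomputable def quasiSchurCoeff (μ : YoungDiagram) : Comp →₀ ℚ :=
  Finsupp.indicator (rearrangements μ) fun _ _ => 1

open Classical in
lemma quasiSchurCoeff_apply (μ : YoungDiagram) (α : Comp) :
    quasiSchurCoeff μ α = if α ∈ rearrangements μ then 1 else 0 := by
  rw [quasiSchurCoeff, Finsupp.indicator_apply]
  split_ifs <;> rfl

lemma quasiSchurCoeff_nonneg (μ : YoungDiagram) (α : Comp) : 0 ≤ quasiSchurCoeff μ α := by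
  classical
  rw [quasiSchurCoeff_apply]
  split_ifs
  · exact zero_le_one
  · exact le_rfl

/-- The column lengths of a composition diagram determine the partition of which it is a
rearrangement. -/
lemma isDisjointExpansion_quasiSchur :
    IsDisjointExpansion quasiSchur quasiSchurCoeff diagramComp where
  indep := linearIndependent_quasiSchur
  expansion μ := by
    classical
    funext m
    rw [linearCombination_eval, schur_eq_sum_quasiSchur]
    refine (Finset.sum_subset (fun α hα => ?_) fun α _ hα => ?_).trans
      (Finset.sum_congr rfl fun α hα => ?_)
    · by_contra h
      rw [Finsupp.mem_support_iff, quasiSchurCoeff_apply, if_neg h] at hα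
      exact hα rfl
    · rw [Finsupp.notMem_support_iff.1 hα, zero_mul]
    · rw [quasiSchurCoeff_apply, if_pos hα, one_mul]
  key_eq_one μ := by
    classical
    rw [quasiSchurCoeff_apply, if_pos]
    rw [mem_rearrangements]
    intro c
    have h : compCells (diagramComp μ) = μ.cells := by
      ext ⟨i, j⟩
      rw [mem_compCells, diagramComp, compRow_shiftedComp, shiftedRow_diagramVector,
        YoungDiagram.mem_cells, YoungDiagram.mem_iff_lt_rowLen]
    rw [h, columnHeight_cells]
  disjoint μ ν α hμ hν := by
    classical
    rw [quasiSchurCoeff_apply] at hμ hν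
    have h1 : α ∈ rearrangements μ := by
      by_contra h
      exact hμ (if_neg h)
    have h2 : α ∈ rearrangements ν := by
      by_contra h
      exact hν (if_neg h)
    rw [mem_rearrangements] at h1 h2
    ext ⟨i, j⟩
    rw [YoungDiagram.mem_cells, YoungDiagram.mem_cells, YoungDiagram.mem_iff_lt_colLen,
      YoungDiagram.mem_iff_lt_colLen, ← h1, h2]

end SkewQSym

/-! ### Computable coefficients and the explicit witnesses. -/

namespace SkewQSym

/-! ### Computing coefficients of skew Schur functions -/

/-- The lists of row lengths below `l` that differ from it by a horizontal strip. -/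
def stripsBelow : List ℕ → List (List ℕ)
  | [] => [[]]
  | b :: l => (List.range' (l.headD 0) (b + 1 - l.headD 0)).flatMap fun a =>
      (stripsBelow l).map (a :: ·)

/-- The number of chains of horizontal strips from `μ` to `lam`; the sizes of the strips are listed
from the last one to the first one. -/
def chainCount (μ : List ℕ) : List ℕ → List ℕ → ℕ
  | [], lam => if μ = lam then 1 else 0
  | a :: w, lam => (((stripsBelow lam).filter fun γ => γ.sum + a = lam.sum).map
      (chainCount μ w)).sum

lemma nodup_stripsBelow : ∀ l : List ℕ, (stripsBelow l).Nodup
  | [] => List.nodup_singleton _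
  | b :: l => by
    rw [stripsBelow, List.nodup_flatMap]
    refine ⟨fun a _ => (nodup_stripsBelow l).map (List.cons_injective), ?_⟩
    refine List.Pairwise.imp (R := (· ≠ ·)) (fun {a a'} h => ?_) List.nodup_range'
    refine List.disjoint_left.2 fun x hx hx' => h ?_
    obtain ⟨y, _, rfl⟩ := List.mem_map.1 hx
    obtain ⟨z, _, h1⟩ := List.mem_map.1 hx'
    exact (List.cons.inj h1).1.symm

lemma mem_stripsBelow : ∀ {l γ : List ℕ}, γ ∈ stripsBelow l ↔ γ.length = l.length ∧
    ∀ i < l.length, l.getD (i + 1) 0 ≤ γ.getD i 0 ∧ γ.getD i 0 ≤ l.getD i 0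
  | [], γ => by simp [stripsBelow]
  | b :: l, γ => by
    have key : (∃ a, (l.headD 0 ≤ a ∧ a < l.headD 0 + (b + 1 - l.headD 0)) ∧
        ∃ y ∈ stripsBelow l, a :: y = γ) ↔ γ ∈ stripsBelow (b :: l) := by
      simp [stripsBelow, List.mem_flatMap, List.mem_range'_1]
    rw [← key]
    have h0 : l.getD 0 0 = l.headD 0 := by cases l <;> rfl
    constructor
    · rintro ⟨a, ha, y, hy, rfl⟩
      obtain ⟨h1, h2⟩ := mem_stripsBelow.1 hy
      refine ⟨by simp [h1], fun i hi => ?_⟩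
      rcases i with - | i
      · simp only [List.getD_cons_succ, List.getD_cons_zero, h0]
        omega
      · simp only [List.getD_cons_succ]
        exact h2 i (Nat.lt_of_succ_lt_succ hi)
    · rintro ⟨h1, h2⟩
      obtain _ | ⟨a, y⟩ := γ
      · simp at h1
      · refine ⟨a, ?_, y, mem_stripsBelow.2 ⟨by simpa using h1, fun i hi => ?_⟩, rfl⟩
        · have := h2 0 (Nat.succ_pos _)
          simp only [List.getD_cons_succ, List.getD_cons_zero, h0] at this
          omega
        · have := h2 (i + 1) (Nat.succ_lt_succ hi)
          simpa only [List.getD_cons_succ] using this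

/-- A list, continued by zeros. -/
def ofList (l : List ℕ) (i : ℕ) : ℕ := l.getD i 0

lemma ofList_of_le {l : List ℕ} {i : ℕ} (h : l.length ≤ i) : ofList l i = 0 :=
  List.getD_eq_default _ _ h

lemma ofList_injOn {l l' : List ℕ} (hl : l.length = l'.length) (h : ofList l = ofList l') :
    l = l' := by
  refine List.ext_getElem hl fun i h1 h2 => ?_
  have := congrFun h i
  rwa [ofList, ofList, List.getD_eq_getElem _ _ h1, List.getD_eq_getElem _ _ h2] at this

lemma sum_ofList (l : List ℕ) : ∀ v, ∑ i ∈ Finset.range v, ofList l i = (l.take v).sum := by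
  induction l with
  | nil => intro v; simp [ofList]
  | cons a l ih =>
    rintro (- | v)
    · simp
    · rw [Finset.sum_range_succ', List.take_succ_cons, List.sum_cons, ← ih, add_comm]
      rfl

/-- `chainCount` peels off the last strip first, like `ncard_chains_succ`; therefore the word is
reversed and the induction appends at its end. -/
lemma ncard_chains_eq_chainCount {μ : List ℕ} (w : List ℕ) : ∀ {lam : List ℕ},
    lam.length = μ.length → (chains Strip μ.length w.length (fun k => (w.getD k 0 : ℕ))
      (ofList μ) (ofList lam)).ncard = chainCount μ w.reverse lam := by
  classical
  induction w using List.reverseRecOn with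
  | nil =>
    intro lam hl
    rw [List.length_nil, ncard_chains_zero, List.reverse_nil, chainCount]
    exact if_congr ⟨fun h => ofList_injOn hl.symm h, fun h => h ▸ rfl⟩ rfl rfl
  | append_singleton w a ih =>
    intro lam hl
    have hz : ∀ i, μ.length ≤ i → ofList lam i = 0 := fun i hi => ofList_of_le (hl ▸ hi)
    have hsum : ∀ γ : List ℕ, γ.length = μ.length →
        ∑ i ∈ Finset.range μ.length, (ofList γ i : ℤ) = (γ.sum : ℤ) := fun γ hγ => by
      rw [← Nat.cast_sum, sum_ofList, ← hγ, List.take_length]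
    have hS : ∀ γ, Strip γ (ofList lam) → γ ∈ (stripsBelow lam).toFinset.image ofList := by
      intro γ hγ
      have h1 : ∀ i, γ i = ofList (List.ofFn fun i : Fin lam.length => γ i) i := by
        intro i
        rcases lt_or_ge i lam.length with hi | hi
        · rw [ofList, List.getD_eq_getElem _ _ (by simpa using hi), List.getElem_ofFn]
        · rw [ofList_of_le (by simpa using hi)]
          exact Nat.le_zero.1 ((hγ.1 i).trans (hz i (hl ▸ hi)).le)
      refine Finset.mem_image.2 ⟨_, List.mem_toFinset.2 (mem_stripsBelow.2
        ⟨List.length_ofFn, fun i _ => ?_⟩), (funext h1).symm⟩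
      have h2 : List.getD (List.ofFn fun i : Fin lam.length => γ i) i 0 = γ i := (h1 i).symm
      rw [h2]
      exact ⟨hγ.2 i, hγ.1 i⟩
    rw [List.length_append, List.length_singleton, ncard_chains_succ (fun _ _ h => h.le) hz _ hS,
      Finset.sum_image, List.reverse_append, List.reverse_singleton, List.singleton_append,
      chainCount, ← List.sum_toFinset _ ((nodup_stripsBelow lam).filter _), List.toFinset_filter,
      Finset.sum_filter]
    · refine Finset.sum_congr rfl fun γ hγ => ?_
      obtain ⟨h1, h2⟩ := mem_stripsBelow.1 (List.mem_toFinset.1 hγ)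
      have hs : Strip (ofList γ) (ofList lam) := by
        refine ⟨fun i => ?_, fun i => ?_⟩
        · rcases lt_or_ge i lam.length with hi | hi
          · exact (h2 i hi).2
          · exact (ofList_of_le (h1 ▸ hi)).le.trans (Nat.zero_le _)
        · rcases lt_or_ge i lam.length with hi | hi
          · exact (h2 i hi).1
          · exact (ofList_of_le (hi.trans i.le_succ)).le.trans (Nat.zero_le _)
      have ha : (w ++ [a]).getD w.length 0 = a := by simp
      rw [hsum lam hl, hsum γ (h1.trans hl), ← ih (h1.trans hl), ha]
      refine if_congr ?_ (congrArg Set.ncard (chains_congr fun k hk => ?_)) rfl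
      · rw [decide_eq_true_eq]
        exact ⟨fun h => by omega, fun h => ⟨hs, by omega⟩⟩
      · rw [List.getD_append _ _ _ _ hk]
    · intro γ hγ γ' hγ' h
      rw [Finset.mem_coe, List.mem_toFinset, mem_stripsBelow] at hγ hγ'
      exact ofList_injOn (hγ.1.trans hγ'.1.symm) h

lemma rowLen_ofRowLens {w : List ℕ} (hw : w.SortedGE) :
    (YoungDiagram.ofRowLens w hw).rowLen = ofList w := by
  funext i
  rcases lt_or_ge i w.length with h | h
  · exact (YoungDiagram.rowLen_ofRowLens (hw := hw) ⟨i, h⟩).trans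
      (List.getD_eq_getElem _ _ h).symm
  · rw [ofList_of_le h]
    by_contra h0
    have h1 : (i, 0) ∈ YoungDiagram.ofRowLens w hw :=
      YoungDiagram.mem_iff_lt_rowLen.2 (Nat.pos_of_ne_zero h0)
    obtain ⟨h2, _⟩ := YoungDiagram.mem_ofRowLens.1 h1
    exact absurd h2 (not_lt.2 h)

/-- The skew shape with given row lengths. -/
def skewShape (outer inner : List ℕ) (ho : outer.SortedGE) (hi : inner.SortedGE)
    (h : List.Forall₂ (· ≤ ·) inner outer) : SkewShape where
  outer := YoungDiagram.ofRowLens outer ho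
  inner := YoungDiagram.ofRowLens inner hi
  le := by
    rintro ⟨i, j⟩ hc
    rw [YoungDiagram.mem_ofRowLens] at hc ⊢
    obtain ⟨h1, h2⟩ := hc
    exact ⟨h.length_eq ▸ h1, h2.trans_le (List.forall₂_iff_get.1 h |>.2 i h1 (h.length_eq ▸ h1))⟩

lemma skewSchur_eq_chainCount {A : SkewShape} {outer inner : List ℕ}
    (ho : A.outer.rowLen = ofList outer) (hi : A.inner.rowLen = ofList inner)
    (hl : outer.length = inner.length) (w : List ℕ) :
    skewSchur A (wordContent w) = chainCount inner w.reverse outer := by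
  rw [← ncard_chains_eq_chainCount w hl, skewSchur_eq_ncard_chains A (L := inner.length)
    (N := w.length), ho, hi]
  · rfl
  · intro i hi
    rw [ho, ofList_of_le (hl ▸ hi)]
  · exact fun i hi => List.getD_eq_default _ _ hi

/-! ### Comparing homogeneous series -/

/-- The compositions of `n`, as lists. -/
def compositionLists : ℕ → List (List ℕ)
  | 0 => [[]]
  | n + 1 => (compositionLists n).flatMap fun l =>
      match l with
      | [] => [[1]]
      | a :: t => [1 :: a :: t, (a + 1) :: t]

/-- A composition of `n + 1` arises either by prepending a part 1 or by enlarging the first part. -/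
lemma mem_compositionLists : ∀ {n : ℕ} {l : List ℕ}, (∀ x ∈ l, 0 < x) → l.sum = n →
    l ∈ compositionLists n
  | 0, [], _, _ => List.mem_singleton_self _
  | 0, a :: l, h, hs => by
    have := h a List.mem_cons_self
    rw [List.sum_cons] at hs
    omega
  | n + 1, [], _, hs => by simp at hs
  | n + 1, 0 :: l, h, _ => absurd (h 0 List.mem_cons_self) (lt_irrefl 0)
  | n + 1, 1 :: l, h, hs => by
    have h1 := mem_compositionLists (n := n) (l := l) (fun x hx => h x (List.mem_cons_of_mem _ hx))
      (by rw [List.sum_cons] at hs; omega)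
    rw [compositionLists, List.mem_flatMap]
    refine ⟨l, h1, ?_⟩
    cases l <;> simp
  | n + 1, (a + 2) :: l, h, hs => by
    have h1 := mem_compositionLists (n := n) (l := (a + 1) :: l) (fun x hx => by
      rcases List.mem_cons.1 hx with rfl | hx
      · omega
      · exact h x (List.mem_cons_of_mem _ hx)) (by rw [List.sum_cons] at hs ⊢; omega)
    rw [compositionLists, List.mem_flatMap]
    exact ⟨_, h1, by simp⟩

/-- Quasisymmetric functions that are homogeneous of degree `n`. -/
structure IsHomogeneousQSym (n : ℕ) (f : Series) : Prop where
  eq_of_exponents : ∀ m m', exponents m = exponents m' → f m = f m'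
  eq_zero : ∀ m, m.degree ≠ n → f m = 0

lemma IsHomogeneousQSym.add {n : ℕ} {f g : Series} (hf : IsHomogeneousQSym n f)
    (hg : IsHomogeneousQSym n g) : IsHomogeneousQSym n (f + g) where
  eq_of_exponents m m' h :=
    congrArg₂ (· + ·) (hf.eq_of_exponents m m' h) (hg.eq_of_exponents m m' h)
  eq_zero m h := (congrArg₂ (· + ·) (hf.eq_zero m h) (hg.eq_zero m h)).trans (add_zero 0)

/-- One monomial for each composition of `n` decides equality. This reduces the identities below to
finite checks by evaluation. -/
lemma IsHomogeneousQSym.ext {n : ℕ} {f g : Series} (hf : IsHomogeneousQSym n f)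
    (hg : IsHomogeneousQSym n g)
    (h : ∀ l ∈ compositionLists n, f (wordContent l) = g (wordContent l)) : f = g := by
  funext m
  by_cases hm : m.degree = n
  · have h1 : exponents m = exponents (wordContent (exponents m)) :=
      (exponents_wordContent _ fun x hx => exponents_pos m hx).symm
    rw [hf.eq_of_exponents _ _ h1, hg.eq_of_exponents _ _ h1]
    exact h _ (mem_compositionLists (fun x hx => exponents_pos m hx) ((exponents_sum m).trans hm))
  · rw [hf.eq_zero m hm, hg.eq_zero m hm]

lemma isHomogeneousQSym_skewSchur {A : SkewShape} {n : ℕ} (hA : A.size = n) :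
    IsHomogeneousQSym n (skewSchur A) where
  eq_of_exponents _ _ h := skewSchur_eq_of_exponents A h
  eq_zero _ h := skewSchur_eq_zero_of_degree A (hA ▸ h)

lemma isHomogeneousQSym_fundamentalQ {α : Comp} {n : ℕ} (hα : α.1 = n) :
    IsHomogeneousQSym n (fundamentalQ α) where
  eq_of_exponents _ _ h := fundamentalQ_eq_of_exponents α h
  eq_zero m h := by
    rw [fundamentalQ_apply, if_neg fun h' => h (h'.1.trans hα)]

lemma isHomogeneousQSym_monomialQ {α : Comp} {n : ℕ} (hα : α.1 = n) :
    IsHomogeneousQSym n (monomialQ α) where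
  eq_of_exponents m m' h := by rw [monomialQ_apply, monomialQ_apply, h]
  eq_zero m h := by
    rw [monomialQ_apply, if_neg fun h' => h ?_]
    rw [← exponents_sum, h', α.2.blocks_sum, hα]

/-- The composition with given parts. -/
def compOfList (l : List ℕ) (h : ∀ x ∈ l, 0 < x) : Comp := ⟨l.sum, ⟨l, fun {x} hx => h x hx, rfl⟩⟩

/-- The partial sums of a list. -/
def partialSums (l : List ℕ) : List ℕ := (List.range (l.length + 1)).map fun v => (l.take v).sum

lemma mem_cuts_wordContent {l : List ℕ} {p : ℕ} :
    p ∈ cuts (wordContent l) ↔ p ∈ partialSums l := by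
  have h : ∀ v, ∑ u ∈ Finset.range v, wordContent l u = (l.take v).sum := sum_ofList l
  simp only [cuts, Set.mem_ofPred_eq, h, partialSums, List.mem_map, List.mem_range]
  constructor
  · rintro ⟨v, rfl⟩
    refine ⟨min v l.length, by omega, ?_⟩
    rw [← List.take_eq_take_min]
  · rintro ⟨v, _, rfl⟩
    exact ⟨v, rfl⟩

-- Unlike the descent set, the list of partial sums contains 0 and the total; both are shared by
-- lists of equal sum, so the condition is unchanged and becomes decidable.
open Classical in
lemma fundamentalQ_wordContent {a l : List ℕ} (ha : ∀ x ∈ a, 0 < x) (hl : ∀ x ∈ l, 0 < x) :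
    fundamentalQ (compOfList a ha) (wordContent l) =
      if l.sum = a.sum ∧ ∀ p ∈ partialSums a, p ∈ partialSums l then 1 else 0 := by
  have hd : (wordContent l).degree = l.sum := by
    rw [← exponents_sum, exponents_wordContent l hl]
  rw [fundamentalQ_apply, hd]
  refine if_congr (and_congr_right fun hs => ?_) rfl rfl
  simp only [mem_cuts_wordContent, mem_descentSet]
  constructor
  · intro h p hp
    obtain ⟨v, hv, rfl⟩ := List.mem_map.1 hp
    rcases Nat.eq_zero_or_pos (a.take v).sum with h0 | h0
    · exact List.mem_map.2 ⟨0, by simp, by simp [h0]⟩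
    rcases (show (a.take v).sum ≤ a.sum from
      (List.take_sublist v a).sum_le_sum fun _ _ => Nat.zero_le _).lt_or_eq with h1 | h1
    · exact h _ ⟨⟨v, rfl⟩, h0, h1⟩
    · exact List.mem_map.2 ⟨l.length, by simp, by
        rw [List.take_length, h1, hs]
        rfl⟩
  · rintro h p ⟨⟨v, rfl⟩, h0, h1⟩
    refine h _ ?_
    refine List.mem_map.2 ⟨min v a.length, List.mem_range.2 (by omega), ?_⟩
    rw [← List.take_eq_take_min]
    rfl

lemma pos_of_mem_compositionLists : ∀ {n : ℕ} {l : List ℕ}, l ∈ compositionLists n →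
    ∀ x ∈ l, 0 < x
  | 0, l, hl, x, hx => by
    rw [List.mem_singleton.1 hl] at hx
    exact absurd hx List.not_mem_nil
  | n + 1, l, hl, x, hx => by
    obtain ⟨l', hl', h⟩ := List.mem_flatMap.1 hl
    have ih := pos_of_mem_compositionLists hl'
    rcases l' with - | ⟨a, t⟩
    · simp only [List.mem_singleton] at h
      subst h
      simp at hx
      omega
    · simp only [List.mem_cons, List.not_mem_nil, or_false] at h ih
      rcases h with rfl | rfl
      · simp only [List.mem_cons] at hx
        rcases hx with rfl | hx
        · exact Nat.one_pos
        · exact ih x hx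
      · simp only [List.mem_cons] at hx
        rcases hx with rfl | hx
        · exact Nat.succ_pos _
        · exact ih x (Or.inr hx)

/-- The partition with given parts. -/
def partition (l : List ℕ) (h : l.SortedGE) : YoungDiagram := YoungDiagram.ofRowLens l h

lemma schur_partition (l : List ℕ) (h : l.SortedGE) (w : List ℕ) :
    schur (partition l h) (wordContent w) =
      chainCount (List.replicate l.length 0) w.reverse l := by
  refine skewSchur_eq_chainCount (rowLen_ofRowLens h) ?_ (by simp) w
  funext i
  refine (congrFun rowLen_bot i).trans ?_
  simp [ofList]

lemma skewSchur_skewShape {outer inner : List ℕ} (ho : outer.SortedGE) (hi : inner.SortedGE)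
    (h : List.Forall₂ (· ≤ ·) inner outer) (w : List ℕ) :
    skewSchur (skewShape outer inner ho hi h) (wordContent w) =
      chainCount inner w.reverse outer :=
  skewSchur_eq_chainCount (rowLen_ofRowLens ho) (rowLen_ofRowLens hi) h.length_eq.symm w

lemma isHomogeneousQSym_schur {μ : YoungDiagram} {n : ℕ} (hμ : μ.card = n) :
    IsHomogeneousQSym n (schur μ) :=
  isHomogeneousQSym_skewSchur ((size_straight μ).trans hμ)

/-! ### Four pairs of skew shapes -/

/-- Compared with s_31 this leaves s_22, which is Schur-positive but not D-positive. -/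
lemma skewSchur_32_1 : skewSchur (skewShape [3, 2] [1, 0] (by decide) (by decide) (by decide)) =
    schur (partition [3, 1] (by decide)) + schur (partition [2, 2] (by decide)) := by
  refine IsHomogeneousQSym.ext (n := 4) (isHomogeneousQSym_skewSchur rfl) (.add (isHomogeneousQSym_schur rfl)
    (isHomogeneousQSym_schur rfl)) fun l hl => ?_
  change skewSchur _ _ = schur _ _ + schur _ _
  rw [skewSchur_skewShape, schur_partition, schur_partition]
  norm_cast
  revert l
  decide +kernel

lemma skewSchur_311_1 :
    skewSchur (skewShape [3, 1, 1] [1, 0, 0] (by decide) (by decide) (by decide)) =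
      schur (partition [3, 1] (by decide)) + schur (partition [2, 1, 1] (by decide)) := by
  refine IsHomogeneousQSym.ext (n := 4) (isHomogeneousQSym_skewSchur rfl) (.add (isHomogeneousQSym_schur rfl)
    (isHomogeneousQSym_schur rfl)) fun l hl => ?_
  change skewSchur _ _ = schur _ _ + schur _ _
  rw [skewSchur_skewShape, schur_partition, schur_partition]
  norm_cast
  revert l
  decide +kernel

/-- The difference with s_22 is F-positive, while 22 does not occur in the Schur expansion given by
`skewSchur_311_1`. -/
lemma skewSchur_311_1_eq_add_fundamentalQ :
    skewSchur (skewShape [3, 1, 1] [1, 0, 0] (by decide) (by decide) (by decide)) =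
      schur (partition [2, 2] (by decide)) +
        (fundamentalQ (compOfList [3, 1] (by decide)) + fundamentalQ (compOfList [1, 3] (by decide))
        + (fundamentalQ (compOfList [2, 1, 1] (by decide)) +
          fundamentalQ (compOfList [1, 1, 2] (by decide)))) := by
  refine IsHomogeneousQSym.ext (n := 4) (isHomogeneousQSym_skewSchur rfl) (.add (isHomogeneousQSym_schur rfl)
    (.add (.add (isHomogeneousQSym_fundamentalQ rfl) (isHomogeneousQSym_fundamentalQ rfl))
      (.add (isHomogeneousQSym_fundamentalQ rfl) (isHomogeneousQSym_fundamentalQ rfl)))) fun l hl => ?_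
  change skewSchur _ _ = schur _ _ + (fundamentalQ _ _ + fundamentalQ _ _ +
    (fundamentalQ _ _ + fundamentalQ _ _))
  have hp := pos_of_mem_compositionLists hl
  rw [skewSchur_skewShape, schur_partition]
  simp only [fundamentalQ_wordContent _ hp]
  norm_cast
  clear hp
  revert l
  decide +kernel

/-- The difference is M-positive, but a row of two boxes contains a 1×2 rectangle and a column does
not. -/
lemma skewSchur_2 : schur (partition [2] (by decide)) =
    schur (partition [1, 1] (by decide)) + monomialQ (compOfList [2] (by decide)) := by
  refine IsHomogeneousQSym.ext (n := 2) (isHomogeneousQSym_schur rfl) (.add (isHomogeneousQSym_schur rfl)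
    (isHomogeneousQSym_monomialQ rfl)) fun l hl => ?_
  change schur _ _ = schur _ _ + monomialQ _ _
  rw [schur_partition, schur_partition, monomialQ_apply,
    exponents_wordContent l (pos_of_mem_compositionLists hl)]
  norm_cast
  revert l
  decide +kernel

lemma skewSchur_421_2 :
    skewSchur (skewShape [4, 2, 1] [2, 0, 0] (by decide) (by decide) (by decide)) =
      schur (partition [3, 2] (by decide)) + (schur (partition [4, 1] (by decide)) +
        (schur (partition [3, 1, 1] (by decide)) + schur (partition [2, 2, 1] (by decide)))) := by
  refine IsHomogeneousQSym.ext (n := 5) (isHomogeneousQSym_skewSchur rfl) (.add (isHomogeneousQSym_schur rfl)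
    (.add (isHomogeneousQSym_schur rfl) (.add (isHomogeneousQSym_schur rfl)
      (isHomogeneousQSym_schur rfl)))) fun l hl => ?_
  change skewSchur _ _ = schur _ _ + (schur _ _ + (schur _ _ + schur _ _))
  simp only [skewSchur_skewShape, schur_partition]
  norm_cast
  revert l
  decide +kernel

/-- With `skewSchur_421_2` this shows equal Schur supports, as 32 occurs on both sides; yet the
function with the extra s_32 is strictly larger. -/
lemma skewSchur_431_21 :
    skewSchur (skewShape [4, 3, 1] [2, 1, 0] (by decide) (by decide) (by decide)) =
      skewSchur (skewShape [4, 2, 1] [2, 0, 0] (by decide) (by decide) (by decide)) +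
        schur (partition [3, 2] (by decide)) := by
  refine IsHomogeneousQSym.ext (n := 5) (isHomogeneousQSym_skewSchur rfl) (.add (isHomogeneousQSym_skewSchur rfl)
    (isHomogeneousQSym_schur rfl)) fun l hl => ?_
  change skewSchur _ _ = skewSchur _ _ + schur _ _
  simp only [skewSchur_skewShape, schur_partition]
  norm_cast
  revert l
  decide +kernel

end SkewQSym

/-! ### The implication diagram and its completeness. -/

namespace SkewQSym

/-! ### Positivity -/

section Positivity

variable {ι : Type} {B : ι → Series} {f g : Series}

lemma isExpansion_single (B : ι → Series) (i : ι) : IsExpansion B (Finsupp.single i 1) (B i) := by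
  rw [IsExpansion, Finsupp.linearCombination_single, one_smul]

lemma IsExpansion.add {c d : ι →₀ ℚ} (hc : IsExpansion B c f) (hd : IsExpansion B d g) :
    IsExpansion B (c + d) (f + g) := by
  unfold IsExpansion at *
  rw [map_add, hc, hd]

lemma single_nonneg (i j : ι) : (0 : ℚ) ≤ Finsupp.single i 1 j := by
  classical
  rw [Finsupp.single_apply]
  split_ifs
  · exact zero_le_one
  · exact le_rfl

lemma isPositive_self (B : ι → Series) (i : ι) : IsPositive B (B i) :=
  ⟨_, isExpansion_single B i, single_nonneg i⟩

lemma IsPositive.add (hf : IsPositive B f) (hg : IsPositive B g) : IsPositive B (f + g) := by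
  obtain ⟨c, hc, hc0⟩ := hf
  obtain ⟨d, hd, hd0⟩ := hg
  exact ⟨_, hc.add hd, fun i => add_nonneg (hc0 i) (hd0 i)⟩

lemma IsPositive.trans {κ : Type} {C : κ → Series} (hf : IsPositive C f)
    (hC : ∀ k, IsPositive B (C k)) : IsPositive B f := by
  choose e he he0 using hC
  obtain ⟨c, hc, hc0⟩ := hf
  refine ⟨_, IsExpansion.bind he hc, fun i => ?_⟩
  rw [linearCombination_finsupp_apply]
  exact Finset.sum_nonneg fun k _ => mul_nonneg (hc0 k) (he0 k i)

lemma IsPositive.apply_nonneg (hf : IsPositive B f) {m : ℕ →₀ ℕ} (hB : ∀ i, 0 ≤ B i m) :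
    0 ≤ f m := by
  obtain ⟨c, hc, hc0⟩ := hf
  rw [hc.eval]
  exact Finset.sum_nonneg fun i _ => mul_nonneg (hc0 i) (hB i)

/-- Containment of supports of positive functions is inherited from a difference. -/
lemma posSupport_subset_of_isPositive_sub (hB : LinearIndependent ℚ B) {c d : ι →₀ ℚ}
    (hc : IsExpansion B c f) (hd : IsExpansion B d g) (h : IsPositive B (f - g)) :
    posSupport B g ⊆ posSupport B f := by
  intro i hi
  rw [hd.mem_posSupport_iff hB] at hi
  rw [hc.mem_posSupport_iff hB]
  have h1 := ((hc.sub hd).isPositive_iff hB).1 h i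
  rw [Finsupp.sub_apply] at h1
  linarith

lemma posSupport_eq_nzSupport (hB : LinearIndependent ℚ B) {c : ι →₀ ℚ}
    (hc : IsExpansion B c f) (h : ∀ i, 0 ≤ c i) : posSupport B f = nzSupport B f := by
  ext i
  rw [hc.mem_posSupport_iff hB, hc.mem_nzSupport_iff hB]
  exact ⟨ne_of_gt, (h i).lt_of_ne'⟩

/-- Containment of supports passes from a basis to one in which it is positive. -/
lemma posSupport_subset_of_isPositive {κ : Type} {C : κ → Series} (hB : LinearIndependent ℚ B)
    (hC : LinearIndependent ℚ C) (hCB : ∀ k, IsPositive B (C k)) {c d : κ →₀ ℚ}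
    (hc : IsExpansion C c f) (hd : IsExpansion C d g) (hc0 : ∀ k, 0 ≤ c k) (hd0 : ∀ k, 0 ≤ d k)
    (h : posSupport C g ⊆ posSupport C f) : posSupport B g ⊆ posSupport B f := by
  choose e he he0 using hCB
  intro i hi
  rw [(IsExpansion.bind he hd).mem_posSupport_iff hB, linearCombination_finsupp_apply] at hi
  rw [(IsExpansion.bind he hc).mem_posSupport_iff hB, linearCombination_finsupp_apply]
  obtain ⟨k, _, hk⟩ := Finset.exists_ne_zero_of_sum_ne_zero hi.ne'
  have hdk : 0 < d k := (hd0 k).lt_of_ne' (left_ne_zero_of_mul hk)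
  have hek : 0 < e k i := (he0 k i).lt_of_ne' (right_ne_zero_of_mul hk)
  have hck : 0 < c k := (hc.mem_posSupport_iff hC k).1 (h ((hd.mem_posSupport_iff hC k).2 hdk))
  exact Finset.sum_pos' (fun k _ => mul_nonneg (hc0 k) (he0 k i))
    ⟨k, Finsupp.mem_support_iff.2 hck.ne', mul_pos hck hek⟩

end Positivity

/-! ### The arrows of the diagram -/

lemma isPositive_fundamentalQ_schur (μ : YoungDiagram) : IsPositive fundamentalQ (schur μ) :=
  ⟨_, isExpansion_fundamentalCoeff _, fundamentalCoeff_nonneg _⟩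

lemma isPositive_monomialQ_fundamentalQ (α : Comp) : IsPositive monomialQ (fundamentalQ α) :=
  exists_fundamentalQ_expansion α

lemma isPositive_monomialQ_skewSchur (A : SkewShape) : IsPositive monomialQ (skewSchur A) :=
  IsPositive.trans ⟨_, isExpansion_fundamentalCoeff A, fundamentalCoeff_nonneg A⟩
    isPositive_monomialQ_fundamentalQ

lemma linearIndependent_schur : LinearIndependent ℚ schur :=
  isDisjointExpansion_dualImmaculate.linearIndependent_schur

lemma Condition.Arrow.holds {P Q : Condition} (h : Condition.Arrow P Q) {A B : SkewShape}
    (hP : P.Holds A B) : Q.Holds A B := by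
  obtain ⟨c, hc, hc0⟩ := exists_schur_expansion_skewSchur A
  obtain ⟨d, hd, hd0⟩ := exists_schur_expansion_skewSchur B
  have hs := linearIndependent_schur
  have hc1 := posSupport_eq_nzSupport hs hc hc0
  have hd1 := posSupport_eq_nzSupport hs hd hd0
  have hA := isExpansion_fundamentalCoeff A
  have hB := isExpansion_fundamentalCoeff B
  obtain ⟨a, ha, _⟩ := isPositive_monomialQ_skewSchur A
  obtain ⟨b, hb, _⟩ := isPositive_monomialQ_skewSchur B
  cases h with
  | dPos_schurPos => exact isDisjointExpansion_dualImmaculate.isPositive_schur (hc.sub hd) hP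
  | schurPos_fPos => exact hP.trans isPositive_fundamentalQ_schur
  | fPos_mPos => exact hP.trans isPositive_monomialQ_fundamentalQ
  | schurPos_schurSupp =>
    have h := posSupport_subset_of_isPositive_sub hs hc hd hP
    rwa [hc1, hd1] at h
  | fPos_fSupp =>
    exact posSupport_subset_of_isPositive_sub linearIndependent_fundamentalQ hA hB hP
  | mPos_mSupp => exact posSupport_subset_of_isPositive_sub linearIndependent_monomialQ ha hb hP
  | schurSupp_fSupp =>
    refine posSupport_subset_of_isPositive linearIndependent_fundamentalQ hs
      isPositive_fundamentalQ_schur hc hd hc0 hd0 ?_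
    rw [hc1, hd1]
    exact hP
  | fSupp_mSupp =>
    exact posSupport_subset_of_isPositive linearIndependent_monomialQ
      linearIndependent_fundamentalQ isPositive_monomialQ_fundamentalQ hA hB
      (fundamentalCoeff_nonneg A) (fundamentalCoeff_nonneg B) hP
  | fSupp_overlaps => exact SkewQSym.fSupp_overlaps hP

lemma holds_of_reflTransGen {P Q : Condition} (h : Relation.ReflTransGen Condition.Arrow P Q)
    {A B : SkewShape} (hP : P.Holds A B) : Q.Holds A B := by
  induction h with
  | refl => exact hP
  | tail _ h ih => exact h.holds ih

/-! ### The implications that fail -/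

lemma monomialQ_nonneg (α : Comp) (m : ℕ →₀ ℕ) : 0 ≤ monomialQ α m := by
  rw [monomialQ_apply]
  split_ifs
  · exact zero_le_one
  · exact le_rfl

lemma fillingSeries_nonneg (cells : Finset (ℕ × ℕ)) (P : (ℕ → ℕ → ℕ) → Prop) (m : ℕ →₀ ℕ) :
    0 ≤ fillingSeries cells P m := by
  rw [fillingSeries_apply]
  exact Nat.cast_nonneg _

/-- A Schur function is `D`-positive only if it dominates the dual immaculate function of its
rows. -/
lemma schur_apply_ne_zero_of_isPositive_dualImmaculate {μ : YoungDiagram}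
    (h : IsPositive dualImmaculate (schur μ)) {m : ℕ →₀ ℕ}
    (hm : dualImmaculate (diagramComp μ) m ≠ 0) : schur μ m ≠ 0 := by
  have hD := isDisjointExpansion_dualImmaculate
  have he := hD.expansion μ
  have h0 := (he.isPositive_iff hD.indep).1 h
  rw [he.eval]
  refine (Finset.sum_pos' (fun i _ => mul_nonneg (h0 i) (fillingSeries_nonneg _ _ _))
    ⟨diagramComp μ, ?_, ?_⟩).ne'
  · rw [Finsupp.mem_support_iff, hD.key_eq_one]
    exact one_ne_zero
  · rw [hD.key_eq_one, one_mul]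
    exact (fillingSeries_nonneg _ _ _).lt_of_ne' hm

lemma compCells_diagramComp (μ : YoungDiagram) : compCells (diagramComp μ) = μ.cells := by
  ext ⟨i, j⟩
  rw [mem_compCells, diagramComp, compRow_shiftedComp, shiftedRow_diagramVector,
    YoungDiagram.mem_cells, YoungDiagram.mem_iff_lt_rowLen]

/-- The immaculate tableau with rows 0 1 and 1 1 has content (1, 3), whereas three equal entries do
not fit into two columns of a semistandard tableau. -/
lemma not_isPositive_dualImmaculate_schur_22 :
    ¬ IsPositive dualImmaculate (schur (partition [2, 2] (by decide))) := by
  intro h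
  refine schur_apply_ne_zero_of_isPositive_dualImmaculate h (m := wordContent [1, 3]) ?_ ?_
  · rw [dualImmaculate, compCells_diagramComp, fillingSeries_ne_zero]
    have hc : (partition [2, 2] (by decide)).cells = {(0, 0), (0, 1), (1, 0), (1, 1)} := by
      decide +kernel
    rw [hc]
    refine ⟨fun i j => if (i, j) ∈ ({(0, 1), (1, 0), (1, 1)} : Finset (ℕ × ℕ)) then 1 else 0,
      fun i j hij => if_neg fun h => hij ?_, ⟨?_, ?_⟩, ?_⟩
    · simp only [Finset.mem_insert, Finset.mem_singleton] at h ⊢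
      tauto
    · intro i j₁ j₂ hj h1 h2
      simp only [Finset.mem_insert, Finset.mem_singleton, Prod.mk.injEq] at h1 h2 ⊢
      split_ifs
      all_goals omega
    · intro i₁ i₂ hi h1 h2
      simp only [Finset.mem_insert, Finset.mem_singleton, Prod.mk.injEq, and_true, and_false,
        zero_ne_one, or_false, false_or] at h1 h2 ⊢
      split_ifs
      all_goals omega
    · ext v
      rw [content_apply, wordContent_apply]
      rcases v with - | - | v
      · decide +kernel
      · decide +kernel
      · rw [List.getD_eq_default _ _ (by simp), Finset.card_eq_zero, Finset.filter_eq_empty_iff]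
        intro c _
        split_ifs
        · omega
        · exact not_false
  · rw [schur_partition]
    decide +kernel

open Condition

lemma exists_schurPos_not_dPos : ∃ A B : SkewShape, A.size = B.size ∧
    schurPos.Holds A B ∧ ¬ dPos.Holds A B := by
  refine ⟨skewShape [3, 2] [1, 0] (by decide) (by decide) (by decide),
    .straight (partition [3, 1] (by decide)), rfl, ?_⟩
  have h := skewSchur_32_1
  rw [add_comm, ← sub_eq_iff_eq_add] at h
  simp only [Holds]
  change IsPositive schur (_ - schur _) ∧ ¬ IsPositive dualImmaculate (_ - schur _)
  rw [h]
  exact ⟨isPositive_self _ _, not_isPositive_dualImmaculate_schur_22⟩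

lemma partition_injective {l l' : List ℕ} {h : l.SortedGE} {h' : l'.SortedGE}
    (hp : partition l h = partition l' h') (i : ℕ) : l.getD i 0 = l'.getD i 0 := by
  have := congrArg (fun μ => YoungDiagram.rowLen μ i) hp
  simpa only [partition, rowLen_ofRowLens, ofList] using this

lemma exists_fPos_not_schurSupp : ∃ A B : SkewShape, A.size = B.size ∧
    fPos.Holds A B ∧ ¬ schurSupp.Holds A B := by
  refine ⟨skewShape [3, 1, 1] [1, 0, 0] (by decide) (by decide) (by decide),
    .straight (partition [2, 2] (by decide)), rfl, ?_, ?_⟩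
  · have h := skewSchur_311_1_eq_add_fundamentalQ
    rw [add_comm, ← sub_eq_iff_eq_add] at h
    change IsPositive fundamentalQ (_ - schur _)
    rw [h]
    exact ((isPositive_self _ _).add (isPositive_self _ _)).add
      ((isPositive_self _ _).add (isPositive_self _ _))
  · intro h
    have hA : IsExpansion schur _ (skewSchur (skewShape [3, 1, 1] [1, 0, 0] (by decide) (by decide)
        (by decide))) := skewSchur_311_1 ▸ (isExpansion_single schur (partition [3, 1]
          (by decide))).add (isExpansion_single schur (partition [2, 1, 1] (by decide)))
    have hB := isExpansion_single schur (partition [2, 2] (by decide))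
    have h1 := h ((hB.mem_nzSupport_iff linearIndependent_schur _).2
      (by rw [Finsupp.single_eq_same]; exact one_ne_zero))
    refine (hA.mem_nzSupport_iff linearIndependent_schur _).1 h1 ?_
    rw [Finsupp.add_apply, Finsupp.single_eq_of_ne, Finsupp.single_eq_of_ne, add_zero]
    · intro h2
      have := partition_injective h2 1
      simp at this
    · intro h2
      have := partition_injective h2 1
      simp at this

lemma exists_mPos_not_overlaps : ∃ A B : SkewShape, A.size = B.size ∧
    mPos.Holds A B ∧ ¬ overlaps.Holds A B := by
  refine ⟨.straight (partition [2] (by decide)), .straight (partition [1, 1] (by decide)), rfl,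
    ?_, ?_⟩
  · have h := skewSchur_2
    rw [add_comm, ← sub_eq_iff_eq_add] at h
    change IsPositive monomialQ (schur _ - schur _)
    rw [h]
    exact isPositive_self _ _
  · intro h
    have h1 := (dominated_rows_iff _ _).1 h 1 2 le_rfl one_le_two
    revert h1
    decide +kernel

lemma exists_schurSupp_not_mPos : ∃ A B : SkewShape, A.size = B.size ∧
    schurSupp.Holds A B ∧ ¬ mPos.Holds A B := by
  have hs := linearIndependent_schur
  refine ⟨skewShape [4, 2, 1] [2, 0, 0] (by decide) (by decide) (by decide),
    skewShape [4, 3, 1] [2, 1, 0] (by decide) (by decide) (by decide), rfl, ?_, ?_⟩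
  · obtain ⟨c, hc, hc0⟩ : IsPositive schur (schur (partition [4, 1] (by decide)) +
        (schur (partition [3, 1, 1] (by decide)) + schur (partition [2, 2, 1] (by decide)))) :=
      (isPositive_self _ _).add ((isPositive_self _ _).add (isPositive_self _ _))
    have h1 := isExpansion_single schur (partition [3, 2] (by decide))
    have hA := h1.add hc
    rw [← skewSchur_421_2] at hA
    have hB := hA.add h1
    rw [← skewSchur_431_21] at hB
    intro μ hμ
    rw [hB.mem_nzSupport_iff hs] at hμ
    rw [hA.mem_nzSupport_iff hs]
    have h2 := single_nonneg (partition [3, 2] (by decide)) μ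
    have h3 := hc0 μ
    simp only [Finsupp.add_apply] at hμ ⊢
    intro h4
    apply hμ
    linarith
  · intro h
    change IsPositive monomialQ _ at h
    rw [skewSchur_431_21, sub_add_cancel_left] at h
    -- The negative of s_32 has a negative coefficient at its leading monomial.
    have h1 : 0 ≤ - schur (partition [3, 2] (by decide)) (wordContent [3, 2]) :=
      h.apply_nonneg fun α => monomialQ_nonneg α _
    rw [schur_partition, neg_nonneg] at h1
    norm_cast at h1

/-- A pair refuting P₀ ⇒ Q₀ also refutes P ⇒ Q whenever P follows from P₀ and Q₀ follows from Q. Up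
to this, the four witnesses cover all pairs that are neither derivable nor undecided. -/
lemma exists_holds_not_holds {P Q : Condition} (h : ¬ Relation.ReflTransGen Arrow P Q)
    (h' : ¬ Undecided P Q) :
    ∃ A B : SkewShape, A.size = B.size ∧ P.Holds A B ∧ ¬ Q.Holds A B := by
  have key : ∀ {P₀ Q₀ : Condition}, (∃ A B : SkewShape, A.size = B.size ∧ P₀.Holds A B ∧
      ¬ Q₀.Holds A B) → Relation.ReflTransGen Arrow P₀ P → Relation.ReflTransGen Arrow Q Q₀ →
      ∃ A B : SkewShape, A.size = B.size ∧ P.Holds A B ∧ ¬ Q.Holds A B :=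
    fun ⟨A, B, hs, hP, hQ⟩ h1 h2 =>
      ⟨A, B, hs, holds_of_reflTransGen h1 hP, fun h => hQ (holds_of_reflTransGen h2 h)⟩
  have refl : ∀ {P : Condition}, Relation.ReflTransGen Arrow P P := .refl
  have ds : ∀ {P}, Relation.ReflTransGen Arrow schurPos P → Relation.ReflTransGen Arrow dPos P :=
    .head .dPos_schurPos
  have sf : ∀ {P}, Relation.ReflTransGen Arrow fPos P → Relation.ReflTransGen Arrow schurPos P :=
    .head .schurPos_fPos
  have fm : ∀ {P}, Relation.ReflTransGen Arrow mPos P → Relation.ReflTransGen Arrow fPos P :=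
    .head .fPos_mPos
  have sS : ∀ {P}, Relation.ReflTransGen Arrow schurSupp P →
    Relation.ReflTransGen Arrow schurPos P := .head .schurPos_schurSupp
  have fF : ∀ {P}, Relation.ReflTransGen Arrow fSupp P → Relation.ReflTransGen Arrow fPos P :=
    .head .fPos_fSupp
  have mM : ∀ {P}, Relation.ReflTransGen Arrow mSupp P → Relation.ReflTransGen Arrow mPos P :=
    .head .mPos_mSupp
  have SF : ∀ {P}, Relation.ReflTransGen Arrow fSupp P → Relation.ReflTransGen Arrow schurSupp P :=
    .head .schurSupp_fSupp
  have FM : ∀ {P}, Relation.ReflTransGen Arrow mSupp P → Relation.ReflTransGen Arrow fSupp P :=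
    .head .fSupp_mSupp
  have FO : ∀ {P}, Relation.ReflTransGen Arrow overlaps P → Relation.ReflTransGen Arrow fSupp P :=
    .head .fSupp_overlaps
  have e1 := key exists_schurPos_not_dPos
  have e2 := key exists_fPos_not_schurSupp
  have e3 := key exists_mPos_not_overlaps
  have e4 := key exists_schurSupp_not_mPos
  clear key
  -- The arrows are available as rules that prepend one step to a path, so each of the 64 cases is
  -- settled by a short search.
  cases P <;> cases Q <;> first
    | exact absurd (by solve_by_elim) h
    | exact (h' Undecided.overlaps_fSupp).elim
    | exact (h' Undecided.overlaps_mSupp).elim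
    | exact e1 (by solve_by_elim) (by solve_by_elim)
    | exact e2 (by solve_by_elim) (by solve_by_elim)
    | exact e3 (by solve_by_elim) (by solve_by_elim)
    | exact e4 (by solve_by_elim) (by solve_by_elim)

end SkewQSym

open SkewQSym

theorem mainTheorem8 :
    -- every skew Schur function has exactly one expansion in each of the bases
    (∀ A : SkewShape,
      (∃! c, IsExpansion schur c (skewSchur A)) ∧
      (∃! c, IsExpansion monomialQ c (skewSchur A)) ∧
      (∃! c, IsExpansion fundamentalQ c (skewSchur A)) ∧
      (∃! c, IsExpansion quasiSchur c (skewSchur A)) ∧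
      (∃! c, IsExpansion dualImmaculate c (skewSchur A))) ∧
    -- `D`-positivity of a difference implies Schur-positivity
    (∀ A B : SkewShape,
      IsPositive dualImmaculate (skewSchur A - skewSchur B) →
        IsPositive schur (skewSchur A - skewSchur B)) ∧
    -- `D`-support containment, in both conventions, is Schur support containment
    (∀ A B : SkewShape,
      (nzSupport dualImmaculate (skewSchur B) ⊆ nzSupport dualImmaculate (skewSchur A) ↔
        nzSupport schur (skewSchur B) ⊆ nzSupport schur (skewSchur A)) ∧
      (posSupport dualImmaculate (skewSchur B) ⊆ posSupport dualImmaculate (skewSchur A) ↔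
        nzSupport schur (skewSchur B) ⊆ nzSupport schur (skewSchur A))) ∧
    -- `S`-positivity is Schur-positivity
    (∀ f : Series, IsSymmetricFunction f → (IsPositive quasiSchur f ↔ IsPositive schur f)) ∧
    (∀ A B : SkewShape,
      IsPositive quasiSchur (skewSchur A - skewSchur B) ↔
        IsPositive schur (skewSchur A - skewSchur B)) ∧
    -- `S`-support containment is Schur support containment
    (∀ A B : SkewShape,
      posSupport quasiSchur (skewSchur B) ⊆ posSupport quasiSchur (skewSchur A) ↔
        nzSupport schur (skewSchur B) ⊆ nzSupport schur (skewSchur A)) ∧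
    -- the three forms of the overlap condition are equivalent
    (∀ A B : SkewShape,
      ((∀ k, 1 ≤ k → Dominated (rowsPartition A k) (rowsPartition B k)) ↔
        ∀ l, 1 ≤ l → Dominated (colsPartition A l) (colsPartition B l)) ∧
      ((∀ k, 1 ≤ k → Dominated (rowsPartition A k) (rowsPartition B k)) ↔
        ∀ k l, 1 ≤ k → 1 ≤ l → rects A k l ≤ rects B k l)) ∧
    -- every arrow of the diagram is an implication
    (∀ P Q : Condition, Condition.Arrow P Q →
      ∀ A B : SkewShape, P.Holds A B → Q.Holds A B) ∧
    -- apart from the undecided ones, every implication that does not follow from the arrows is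
    -- false, even for skew shapes of equal size; in particular the converse of every arrow
    -- other than the one to the overlap condition is false
    (∀ P Q : Condition, ¬ Relation.ReflTransGen Condition.Arrow P Q →
      ¬ Condition.Undecided P Q →
      ∃ A B : SkewShape, A.size = B.size ∧ P.Holds A B ∧ ¬ Q.Holds A B) := by
  have hs := linearIndependent_schur
  have hD := isDisjointExpansion_dualImmaculate
  have hQ := isDisjointExpansion_quasiSchur
  refine ⟨fun A => ?_, fun A B h => ?_, fun A B => ?_, fun f hf => ?_, fun A B => ?_,
    fun A B => ?_, fun A B => ⟨?_, dominated_rows_iff A B⟩, fun P Q h A B hP => h.holds hP,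
    fun P Q h h' => exists_holds_not_holds h h'⟩
  · obtain ⟨c, hc, _⟩ := exists_schur_expansion_skewSchur A
    obtain ⟨a, ha, _⟩ := isPositive_monomialQ_skewSchur A
    exact ⟨hc.existsUnique hs, ha.existsUnique linearIndependent_monomialQ,
      (isExpansion_fundamentalCoeff A).existsUnique linearIndependent_fundamentalQ,
      hQ.existsUnique hc, hD.existsUnique hc⟩
  · exact Condition.Arrow.holds .dPos_schurPos h
  · obtain ⟨c, hc, hc0⟩ := exists_schur_expansion_skewSchur A
    obtain ⟨d, hd, hd0⟩ := exists_schur_expansion_skewSchur B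
    exact ⟨hD.nzSupport_iff hc hd, hD.posSupport_iff hc hd hc0 hd0⟩
  · obtain ⟨_, c, hc, _⟩ := exists_schur_expansion hf
    exact hQ.isPositive_iff quasiSchurCoeff_nonneg hc
  · obtain ⟨c, hc, hc0⟩ := exists_schur_expansion_skewSchur A
    obtain ⟨d, hd, hd0⟩ := exists_schur_expansion_skewSchur B
    exact hQ.isPositive_iff quasiSchurCoeff_nonneg (hc.sub hd)
  · obtain ⟨c, hc, hc0⟩ := exists_schur_expansion_skewSchur A
    obtain ⟨d, hd, hd0⟩ := exists_schur_expansion_skewSchur B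
    exact hQ.posSupport_iff hc hd hc0 hd0
  · exact (dominated_rows_iff A B).trans (dominated_cols_iff A B).symm
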